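/- Let $k\ge 0$ be an integer and let $h\colon\{0,1\}^k\to\{0,1\}$ be any symmetric Boolean function; let $W_h\subseteq\{0,\dots,k\}$ be such that $h(x)=1$ iff the Hamming weight $|x|$ lies in $W_h$. $\|\cdot\|$ denotes the spectral norm of a real matrix and the Euclidean norm of a vector. For $n\ge k$ let $\mathcal C_n$ be the set of $k$-subsets of $[n]=\{1,\dots,n\}$. For $A\in\mathcal C_n$ and $S\subseteq[n]$ let $f_A(S)$ be the value of $h$ on the restriction to $A$ of the indicator string of $S$, so that $f_A(S)=1$ iff $|A\cap S|\in W_h$. The adversary bound $\mathrm{Adv}(L_h^n)\in[0,\infty]$ of the problem of learning $A$ from queries to $f_A$ is the supremum of $\|\Gamma\|$ over all real symmetric $\mathcal C_n\times\mathcal C_n$ matrices $\Gamma$ with zero diagonal such that, for every $S\subseteq[n]$, the submatrix of $\Gamma$ with rows $\{A: f_A(S)=0\}$ and columns $\{B: f_B(S)=1\}$ has spectral norm at most $1$ (an empty matrix has norm $0$). Let $\mathrm{Adv}(L_h)=\lim_{n\to\infty}\mathrm{Adv}(L_h^n)$. For integers $m\ge 1$, $0\le t\le m$ and a real $0<p<1$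 let $K^{(m,p)}_t\in\mathbb R^{m+1}$ be the vector with entries $$K^{(m,p)}_t[x]=\sqrt{\binom mx p^x(1-p)^{m-x}}\;\sum_{i=0}^t(-1)^i p^{t-i}(1-p)^i\binom xi\binom{m-x}{t-i},\qquad x=0,\dots,m,$$ and let $\varkappa^{(m,p)}_t=K^{(m,p)}_t/\|K^{(m,p)}_t\|$. For $d=(d_0,\dots,d_k)\in\mathbb R^{k+1}$ and $0<m\le k$ put $$M^{(d)}_{m,p}=\sum_{i=0}^m d_{k-i}\,\varkappa^{(m,p)}_{m-i}\bigl(\varkappa^{(m,p)}_{m-i}\bigr)^*,$$ and for $0\le t\le k-m$ let $M^{(d)}_{m,p,t}$ be the submatrix of $M^{(d)}_{m,p}$ formed by the rows in $W_0(t)$ and the columns in $W_1(t)$, where $W_1(t)=\{\ell: 0\le\ell\le m,\ \ell+t\in W_h\}$ and $W_0(t)=\{0,\dots,m\}\setminus W_1(t)$. **Theorem.** For every symmetric $h$, the limit $\mathrm{Adv}(L_h)$ exists in $[0,\infty]$ and equals the supremum of $\max_{0\le i\le k}d_i$ over all lists of real numbers $d=(d_0,\dots,d_k)$ such that - $d_k=0$,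 and - $\|M^{(d)}_{m,p,t}\|\le 1$ for all integers $0<m\le k$, $0\le t\le k-m$ and all reals $0<p<1$. Moreover, if $h$ is not constant, this common value is finite. -/

import Mathlib

open Filter Topology

/- Throughout, the norm of a real matrix is its spectral norm (the `ℓ²` operator norm). -/
open scoped Matrix.Norms.L2Operator

namespace HiddenSubset

/-- A Boolean function is symmetric if permuting the input bits does not change its value. -/
def IsSymmetric {k : ℕ} (h : (Fin k → Bool) → Bool) : Prop :=
  ∀ (σ : Equiv.Perm (Fin k)) (x : Fin k → Bool), h (x ∘ σ) = h x

/-- The Hamming weight of a bit string. -/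
def weight {k : ℕ} (x : Fin k → Bool) : ℕ :=
  (Finset.univ.filter fun j => x j = true).card

/-- The set `W_h ⊆ {0, …, k}` of the Hamming weights of the inputs accepted by `h`. -/
def weights {k : ℕ} (h : (Fin k → Bool) → Bool) : Finset ℕ :=
  (Finset.univ.filter fun x => h x = true).image weight

/-! ### The learning problem and its adversary bound -/

/-- The set of the `k`-subsets of an `n`-element set. -/
abbrev KSubset (n k : ℕ) : Type := {A : Finset (Fin n) // A.card = k}

/-- The function `f_A`: the value of `h` on the restriction to the positions in `A` of the
`n`-bit string that is the indicator of `S`. -/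
def hiddenFun {k : ℕ} (h : (Fin k → Bool) → Bool) {n : ℕ} (A : KSubset n k)
    (S : Finset (Fin n)) : Bool :=
  h fun j => decide (A.1.orderEmbOfFin A.2 j ∈ S)

/-- `Γ ∘ Δ_S`: the submatrix of `Γ` with rows `{A | f_A(S) = 0}` and columns
`{B | f_B(S) = 1}`. -/
def queryBlock {k : ℕ} (h : (Fin k → Bool) → Bool) {n : ℕ}
    (Γ : Matrix (KSubset n k) (KSubset n k) ℝ) (S : Finset (Fin n)) :
    Matrix {A : KSubset n k // hiddenFun h A S = false}
      {B : KSubset n k // hiddenFun h B S = true} ℝ :=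
  Γ.submatrix Subtype.val Subtype.val

/-- Feasible adversary matrices for the learning problem `L_h^n`: real symmetric matrices with
zero diagonal such that `‖Γ ∘ Δ_S‖ ≤ 1` for every query `S`. -/
structure IsAdversaryMatrix {k : ℕ} (h : (Fin k → Bool) → Bool) {n : ℕ}
    (Γ : Matrix (KSubset n k) (KSubset n k) ℝ) : Prop where
  symm : Γ.IsSymm
  diag : ∀ A, Γ A A = 0
  query : ∀ S : Finset (Fin n), ‖queryBlock h Γ S‖ ≤ 1

/-- The adversary bound `Adv(L_h^n)`, the supremum of `‖Γ‖` over the feasible adversary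
matrices, as an extended real (it is infinite when the problem is not solvable, that is,
when `h` is constant and there are at least two `k`-subsets). -/
noncomputable def adv {k : ℕ} (h : (Fin k → Bool) → Bool) (n : ℕ) : EReal :=
  ⨆ (Γ : Matrix (KSubset n k) (KSubset n k) ℝ) (_ : IsAdversaryMatrix h Γ), ((‖Γ‖ : ℝ) : EReal)

/-! ### Weighted Krawtchouk vectors and the optimisation problem -/

/-- The weighted Krawtchouk vector `K_t^{(m,p)} ∈ ℝ^{m+1}`. -/
noncomputable def krawtchouk (m : ℕ) (p : ℝ) (t : ℕ) : EuclideanSpace ℝ (Fin (m + 1)) :=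
  WithLp.toLp 2 fun x =>
    Real.sqrt ((m.choose x : ℝ) * p ^ (x : ℕ) * (1 - p) ^ (m - (x : ℕ))) *
      ∑ i ∈ Finset.range (t + 1), (-1 : ℝ) ^ i * p ^ (t - i) * (1 - p) ^ i *
        ((x : ℕ).choose i : ℝ) * ((m - (x : ℕ)).choose (t - i) : ℝ)

/-- The normalised Krawtchouk vector `ϰ_t^{(m,p)} = K_t^{(m,p)} / ‖K_t^{(m,p)}‖`. -/
noncomputable def kappa (m : ℕ) (p : ℝ) (t : ℕ) : EuclideanSpace ℝ (Fin (m + 1)) :=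
  ‖krawtchouk m p t‖⁻¹ • krawtchouk m p t

/-- The matrix `M_{m,p}^{(d)} = ∑_{i=0}^m d_{k-i} ϰ_{m-i} ϰ_{m-i}^*` (used for `m ≤ k`). -/
noncomputable def krawtchoukMatrix {k : ℕ} (d : Fin (k + 1) → ℝ) (m : ℕ) (p : ℝ) :
    Matrix (Fin (m + 1)) (Fin (m + 1)) ℝ :=
  ∑ i ∈ Finset.range (m + 1), d ⟨k - i, by omega⟩ •
    Matrix.vecMulVec (kappa m p (m - i)).ofLp (kappa m p (m - i)).ofLp

/-- `W_1(t) = {ℓ | 0 ≤ ℓ ≤ m, ℓ + t ∈ W_h}`. -/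
def W₁ {k : ℕ} (h : (Fin k → Bool) → Bool) (m t : ℕ) : Finset (Fin (m + 1)) :=
  Finset.univ.filter fun l => (l : ℕ) + t ∈ weights h

/-- `W_0(t) = {0, …, m} \ W_1(t)`. -/
def W₀ {k : ℕ} (h : (Fin k → Bool) → Bool) (m t : ℕ) : Finset (Fin (m + 1)) :=
  Finset.univ \ W₁ h m t

/-- `M_{m,p,t}^{(d)}`: the submatrix of `M_{m,p}^{(d)}` with rows `W_0(t)` and columns
`W_1(t)`. -/
noncomputable def krawtchoukBlock {k : ℕ} (h : (Fin k → Bool) → Bool) (d : Fin (k + 1) → ℝ)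
    (m : ℕ) (p : ℝ) (t : ℕ) : Matrix (W₀ h m t) (W₁ h m t) ℝ :=
  (krawtchoukMatrix d m p).submatrix Subtype.val Subtype.val

/-- The constraints on the list `d = (d_0, …, d_k)`. -/
structure IsFeasible {k : ℕ} (h : (Fin k → Bool) → Bool) (d : Fin (k + 1) → ℝ) : Prop where
  last : d (Fin.last k) = 0
  block : ∀ m t : ℕ, 0 < m → m ≤ k → t ≤ k - m → ∀ p : ℝ, 0 < p → p < 1 →
    ‖krawtchoukBlock h d m p t‖ ≤ 1

/-- The supremum of `max_i d_i` over the feasible lists `d`, as an extended real. -/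
noncomputable def krawtchoukValue {k : ℕ} (h : (Fin k → Bool) → Bool) : EReal :=
  ⨆ (d : Fin (k + 1) → ℝ) (_ : IsFeasible h d),
    ((Finset.univ.sup' Finset.univ_nonempty d : ℝ) : EReal)

end HiddenSubset

/-! Identify a `k`-subset of `[n]` with the normalised sum of its `k!` enumerations in the `k`-th
tensor power of `ℝⁿ` (`embedMatrix`). With `u` the uniform unit vector, put `T_d = ∑_I d_{|I|} (1 -
uu*)^{⊗I} ⊗ (uu*)^{⊗Iᶜ}` (`tensorOp`). The compressions of these operators to `k`-subsets
(`learnMatrix`) are exactly the matrices that commute with the symmetric group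
(`IsInvariant.exists_learnMatrix`), so both sides of the theorem become statements about lists `d`.

A query `S` cuts `[n]` into two parts. Let `p = |S|/n`. The normalised indicators of the parts span
a plane in which `u` has coordinates `(√p, √(1-p))`; the other vectors used are orthogonal to `u`
and each lives in one part. In a symmetric tensor, fix which positions carry vectors outside the
plane and which ones, `t` of them living in `S`. The remaining `m` positions carry a symmetric
function on `{0,1}^m`, on which `T_d` is diagonal in the Krawtchouk basis with eigenvalues `d_{k-m},
…, d_k`. A function of weight `ℓ` there comes from sets with `|A ∩ S| = ℓ + t`, so the constraint
for `S` splits into the blocks `M_{m,p,t}` (`tensorOp_bilin_assemble`).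

Lower bound. For every `n` a feasible list satisfies the query constraints exactly
(`learnMatrix_query`). The diagonal of its matrix is constant and tends to `d_k = 0`, so it can be
subtracted. Test vectors with entries of order `n^{-k/2}` barely see words with repeated letters,
and they show that the norm is at least `d_i` in the limit (`exists_le_adv`).

Upper bound. Let `v` be a unit vector on which `Γ` exceeds `c`. Averaging the entrywise product of
`Γ` and `vv*` over the symmetric group keeps `Γ` feasible and makes the all-ones vector reach the
same value, which is approximately `d_0` (`IsAdversaryMatrix.exists_list`). Test vectors show that
limits of such lists satisfy every block constraint (`norm_krawtchoukBlock_le_of_tendsto`). The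
lists need not be bounded in `n`, so they are rescaled before compactness is used; the uniform bound
on feasible lists for nonconstant `h` (`exists_bound_feasible`) rules out a degenerate limit and
also gives finiteness. Constant `h` is treated separately. -/

namespace HiddenSubset

open Matrix Finset

/-! ### Euclidean norms and bilinear forms -/

section Norm

variable {α β : Type*} [Fintype α] [Fintype β]

/-- The Euclidean norm of a real vector. -/
noncomputable def l2 (f : α → ℝ) : ℝ := √(f ⬝ᵥ f)

lemma dotProduct_self_nonneg' (f : α → ℝ) : 0 ≤ f ⬝ᵥ f :=
  Finset.sum_nonneg fun i _ => mul_self_nonneg (f i)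

lemma l2_nonneg (f : α → ℝ) : 0 ≤ l2 f := Real.sqrt_nonneg _

lemma l2_sq (f : α → ℝ) : l2 f ^ 2 = f ⬝ᵥ f := Real.sq_sqrt (dotProduct_self_nonneg' f)

lemma l2_mul_self (f : α → ℝ) : l2 f * l2 f = f ⬝ᵥ f := by rw [← sq, l2_sq]

lemma norm_toLp_eq_l2 (f : α → ℝ) : ‖WithLp.toLp 2 f‖ = l2 f := by
  rw [EuclideanSpace.norm_eq, l2]
  congr 1
  exact Finset.sum_congr rfl fun i _ => by simp [sq]

lemma inner_toLp_eq (f g : α → ℝ) :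
    inner ℝ (WithLp.toLp 2 f : EuclideanSpace ℝ α) (WithLp.toLp 2 g) = f ⬝ᵥ g := by
  simp [EuclideanSpace.inner_eq_star_dotProduct, dotProduct_comm]

lemma abs_dotProduct_le (f g : α → ℝ) : |f ⬝ᵥ g| ≤ l2 f * l2 g := by
  rw [← inner_toLp_eq, ← norm_toLp_eq_l2, ← norm_toLp_eq_l2]
  exact abs_real_inner_le_norm _ _

lemma l2_smul (c : ℝ) (f : α → ℝ) : l2 (c • f) = |c| * l2 f := by
  simp only [← norm_toLp_eq_l2]
  exact norm_smul c (WithLp.toLp 2 f)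

lemma l2_eq_zero {f : α → ℝ} (hf : l2 f = 0) : f = 0 := by
  rw [← norm_toLp_eq_l2] at hf
  simpa using hf

lemma abs_apply_le_l2 (f : α → ℝ) (a : α) : |f a| ≤ l2 f := by
  rw [← norm_toLp_eq_l2]
  exact PiLp.norm_apply_le (WithLp.toLp 2 f : EuclideanSpace ℝ α) a

lemma l2_single [DecidableEq α] (a : α) (c : ℝ) : l2 (Pi.single a c) = |c| := by
  simp [l2, Real.sqrt_mul_self_eq_abs]

lemma abs_bilin_le_norm (M : Matrix α β ℝ) [DecidableEq β] (f : α → ℝ) (g : β → ℝ) :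
    |f ⬝ᵥ M *ᵥ g| ≤ ‖M‖ * (l2 f * l2 g) := by
  refine (abs_dotProduct_le _ _).trans ?_
  have := M.l2_opNorm_mulVec (WithLp.toLp 2 g)
  rw [norm_toLp_eq_l2 g] at this
  have h2 : l2 (M *ᵥ g) ≤ ‖M‖ * l2 g := by
    rw [← norm_toLp_eq_l2]; exact this
  calc l2 f * l2 (M *ᵥ g) ≤ l2 f * (‖M‖ * l2 g) := by gcongr; exact l2_nonneg f
    _ = _ := by ring

lemma norm_le_of_bilin_le (M : Matrix α β ℝ) [DecidableEq β] {c : ℝ} (hc : 0 ≤ c)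
    (H : ∀ f g, |f ⬝ᵥ M *ᵥ g| ≤ c * (l2 f * l2 g)) : ‖M‖ ≤ c := by
  rw [Matrix.l2_opNorm_def]
  refine ContinuousLinearMap.opNorm_le_bound _ hc fun x => ?_
  have h1 := H (M *ᵥ x.ofLp) x.ofLp
  rw [abs_of_nonneg (dotProduct_self_nonneg' _), ← l2_mul_self] at h1
  have h2 : ‖x‖ = l2 x.ofLp := by rw [← norm_toLp_eq_l2]
  have h3 : ‖(toEuclideanLin (𝕜 := ℝ) (m := α) (n := β) ≪≫ₗ LinearMap.toContinuousLinearMap) M x‖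
      = l2 (M *ᵥ x.ofLp) := by
    rw [← norm_toLp_eq_l2]; rfl
  rw [h3, h2]
  rcases (l2_nonneg (M *ᵥ x.ofLp)).eq_or_lt with h0 | h0
  · rw [← h0]; exact mul_nonneg hc (l2_nonneg _)
  · refine le_of_mul_le_mul_left ?_ h0
    linarith

variable {P Q : α → Prop}

lemma sum_subtype_of_support [Fintype (Subtype P)] {F : α → ℝ} (hF : ∀ a, ¬ P a → F a = 0) :
    ∑ a : Subtype P, F a = ∑ a, F a := by
  classical
  refine Finset.sum_of_injOn (fun a : Subtype P => (a : α))
    (Subtype.val_injective.injOn) (by simp) (fun a _ ha => hF a fun hp => ha ?_) (fun _ _ => rfl)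
  exact ⟨⟨a, hp⟩, by simp, rfl⟩

lemma submatrix_bilin [Fintype (Subtype P)] [Fintype (Subtype Q)] (M : Matrix α α ℝ)
    {f g : α → ℝ} (hf : ∀ a, ¬ P a → f a = 0) (hg : ∀ a, ¬ Q a → g a = 0) :
    (fun a : Subtype P => f a) ⬝ᵥ
      (M.submatrix (Subtype.val : Subtype P → α) (Subtype.val : Subtype Q → α)) *ᵥ
        (fun a : Subtype Q => g a) = f ⬝ᵥ M *ᵥ g := by
  simp only [dotProduct, mulVec, submatrix_apply]
  rw [← sum_subtype_of_support (P := P) (F := fun a => f a * ∑ b, M a b * g b)]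
  · refine Finset.sum_congr rfl fun a _ => ?_
    rw [← sum_subtype_of_support (P := Q) (F := fun b => M a b * g b)]
    intro b hb
    rw [hg b hb, mul_zero]
  · intro a ha
    rw [hf a ha, zero_mul]

lemma l2_subtype [Fintype (Subtype P)] {f : α → ℝ} (hf : ∀ a, ¬ P a → f a = 0) :
    l2 (fun a : Subtype P => f a) = l2 f := by
  simp only [l2, dotProduct]
  rw [sum_subtype_of_support (P := P) (F := fun a => f a * f a)]
  intro a ha
  rw [hf a ha, zero_mul]

/-- Extension by zero replaces vectors on a block by supported vectors on the whole index set, so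
later estimates never handle subtype-indexed matrices. -/
lemma norm_submatrix_le_iff [Fintype (Subtype P)] [Fintype (Subtype Q)]
    [DecidableEq (Subtype Q)] (M : Matrix α α ℝ) {c : ℝ} (hc : 0 ≤ c) :
    ‖M.submatrix (Subtype.val : Subtype P → α) (Subtype.val : Subtype Q → α)‖ ≤ c ↔
      ∀ f g : α → ℝ, (∀ a, ¬ P a → f a = 0) → (∀ a, ¬ Q a → g a = 0) →
        |f ⬝ᵥ M *ᵥ g| ≤ c * (l2 f * l2 g) := by
  classical
  constructor
  · intro H f g hf hg
    rw [← submatrix_bilin M hf hg, ← l2_subtype hf, ← l2_subtype hg]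
    refine (abs_bilin_le_norm _ _ _).trans ?_
    gcongr
    exact mul_nonneg (l2_nonneg _) (l2_nonneg _)
  · intro H
    refine norm_le_of_bilin_le _ hc fun f g => ?_
    have hf : ∀ a, ¬ P a → (fun a => if h : P a then f ⟨a, h⟩ else 0) a = 0 := by
      intro a ha; simp [ha]
    have hg : ∀ a, ¬ Q a → (fun a => if h : Q a then g ⟨a, h⟩ else 0) a = 0 := by
      intro a ha; simp [ha]
    have := H _ _ hf hg
    rw [← submatrix_bilin M hf hg, ← l2_subtype hf, ← l2_subtype hg] at this
    simpa [Subtype.prop] using this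

/-- A symmetric matrix whose quadratic form is bounded by `c` has norm at most `c`. -/
lemma norm_le_of_quadratic_le [DecidableEq α] {M : Matrix α α ℝ} (hM : M.IsSymm) {c : ℝ}
    (hc : 0 ≤ c) (H : ∀ f : α → ℝ, l2 f = 1 → |f ⬝ᵥ M *ᵥ f| ≤ c) : ‖M‖ ≤ c := by
  have hs : ∀ (r : ℝ) (f : α → ℝ), (r • f) ⬝ᵥ M *ᵥ (r • f) = r ^ 2 * (f ⬝ᵥ M *ᵥ f) := by
    intro r f; simp only [mulVec_smul, smul_dotProduct, dotProduct_smul, smul_eq_mul]; ring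
  have H' : ∀ f : α → ℝ, |f ⬝ᵥ M *ᵥ f| ≤ c * l2 f ^ 2 := by
    intro f
    rcases (l2_nonneg f).eq_or_lt with h0 | h0
    · rw [l2_eq_zero h0.symm]; simp [mul_nonneg hc (sq_nonneg _)]
    · have := H ((l2 f)⁻¹ • f) (by
        rw [l2_smul, abs_of_nonneg (inv_nonneg.2 h0.le), inv_mul_cancel₀ h0.ne'])
      rw [hs, abs_mul, abs_of_nonneg (sq_nonneg _), inv_pow, inv_mul_le_iff₀ (by positivity)] at this
      linarith
  have hsym : ∀ f g : α → ℝ, g ⬝ᵥ M *ᵥ f = f ⬝ᵥ M *ᵥ g := by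
    intro f g
    rw [dotProduct_mulVec, ← mulVec_transpose, hM.eq, dotProduct_comm]
  -- Polarisation: `4 f·Mg = Q(f+g) - Q(f-g)` for the quadratic form `Q`, and the squared norms of
  -- `f+g` and `f-g` add up to `4`.
  have key : ∀ f g : α → ℝ, l2 f = 1 → l2 g = 1 → |f ⬝ᵥ M *ᵥ g| ≤ c := by
    intro f g hf hg
    have h1 := H' (f + g)
    have h2 := H' (f - g)
    rw [l2_sq] at h1 h2
    have e1 : (f + g) ⬝ᵥ (f + g) = 2 + 2 * (f ⬝ᵥ g) := by
      rw [add_dotProduct, dotProduct_add, dotProduct_add, ← l2_sq, ← l2_sq, hf, hg,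
        dotProduct_comm g f]; ring
    have e2 : (f - g) ⬝ᵥ (f - g) = 2 - 2 * (f ⬝ᵥ g) := by
      rw [sub_dotProduct, dotProduct_sub, dotProduct_sub, ← l2_sq, ← l2_sq, hf, hg,
        dotProduct_comm g f]; ring
    rw [e1, mulVec_add, add_dotProduct, dotProduct_add, dotProduct_add, hsym f g, abs_le] at h1
    rw [e2, mulVec_sub, sub_dotProduct, dotProduct_sub, dotProduct_sub, hsym f g, abs_le] at h2
    rw [abs_le]
    constructor <;> linarith [h1.1, h1.2, h2.1, h2.2]
  refine norm_le_of_bilin_le _ hc fun f g => ?_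
  rcases (l2_nonneg f).eq_or_lt with h0 | h0
  · rw [l2_eq_zero h0.symm]
    simpa using mul_nonneg hc (mul_nonneg (l2_nonneg _) (l2_nonneg _))
  rcases (l2_nonneg g).eq_or_lt with h0' | h0'
  · rw [l2_eq_zero h0'.symm]
    simpa using mul_nonneg hc (mul_nonneg (l2_nonneg _) (l2_nonneg _))
  have := key ((l2 f)⁻¹ • f) ((l2 g)⁻¹ • g) (by
        rw [l2_smul, abs_of_nonneg (inv_nonneg.2 h0.le), inv_mul_cancel₀ h0.ne']) (by
        rw [l2_smul, abs_of_nonneg (inv_nonneg.2 h0'.le), inv_mul_cancel₀ h0'.ne'])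
  rw [mulVec_smul, smul_dotProduct, dotProduct_smul, smul_eq_mul, smul_eq_mul, abs_mul, abs_mul,
    abs_of_nonneg (inv_nonneg.2 h0.le), abs_of_nonneg (inv_nonneg.2 h0'.le),
    inv_mul_le_iff₀ h0, inv_mul_le_iff₀ h0'] at this
  linarith

lemma mulVec_bilin {γ δ : Type*} [Fintype γ] [Fintype δ] (X : Matrix α γ ℝ) (M : Matrix α β ℝ)
    (Y : Matrix β δ ℝ) (f : γ → ℝ) (g : δ → ℝ) :
    (X *ᵥ f) ⬝ᵥ M *ᵥ (Y *ᵥ g) = f ⬝ᵥ (Xᵀ * M * Y) *ᵥ g := by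
  rw [← mulVec_mulVec, ← mulVec_mulVec, dotProduct_mulVec f, vecMul_transpose]

lemma dotProduct_mulVec_isometry {γ : Type*} [Fintype γ] [DecidableEq γ] {X : Matrix α γ ℝ}
    (hX : Xᵀ * X = 1) (f g : γ → ℝ) : (X *ᵥ f) ⬝ᵥ (X *ᵥ g) = f ⬝ᵥ g := by
  classical
  have := mulVec_bilin X (1 : Matrix α α ℝ) X f g
  rwa [one_mulVec, Matrix.mul_one, hX, one_mulVec] at this

lemma l2_mulVec_isometry {γ : Type*} [Fintype γ] [DecidableEq γ] {X : Matrix α γ ℝ}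
    (hX : Xᵀ * X = 1) (f : γ → ℝ) : l2 (X *ᵥ f) = l2 f := by
  rw [l2, dotProduct_mulVec_isometry hX, l2]

end Norm

/-! ### Tensor powers of matrices -/

section Tensor

variable {κ α β γ : Type*} [Fintype κ]

/-- The tensor product of a family of matrices, indexed by functions. -/
def tensorMatrix (N : κ → Matrix α β ℝ) : Matrix (κ → α) (κ → β) ℝ :=
  Matrix.of fun a b => ∏ j, N j (a j) (b j)

lemma tensorMatrix_apply (N : κ → Matrix α β ℝ) (a : κ → α) (b : κ → β) :
    tensorMatrix N a b = ∏ j, N j (a j) (b j) := rfl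

lemma tensorMatrix_transpose (N : κ → Matrix α β ℝ) :
    (tensorMatrix N)ᵀ = tensorMatrix fun j => (N j)ᵀ := rfl

variable [DecidableEq κ] [Fintype β]

lemma tensorMatrix_mul (N : κ → Matrix α β ℝ) (N' : κ → Matrix β γ ℝ) :
    tensorMatrix N * tensorMatrix N' = tensorMatrix fun j => N j * N' j := by
  ext a c
  simp only [Matrix.mul_apply, tensorMatrix_apply, Finset.prod_univ_sum, Fintype.piFinset_univ,
    Finset.prod_mul_distrib]

omit [DecidableEq κ] [Fintype β] in
lemma tensorMatrix_one [DecidableEq α] :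
    tensorMatrix (fun _ : κ => (1 : Matrix α α ℝ)) = 1 := by
  classical
  ext a b
  rw [tensorMatrix_apply, Matrix.one_apply]
  split_ifs with h
  · subst h; simp
  · obtain ⟨j, hj⟩ := Function.ne_iff.1 h
    exact Finset.prod_eq_zero (Finset.mem_univ j) (by simp [hj])

/-- `∑_I d_{|I|} ⨂_{j ∈ I} (1 - v v^*) ⊗ ⨂_{j ∉ I} v v^*`. -/
noncomputable def tensorOp (κ : Type*) [Fintype κ] [DecidableEq κ] [DecidableEq α] (v : α → ℝ)
    (d : ℕ → ℝ) : Matrix (κ → α) (κ → α) ℝ :=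
  ∑ I : Finset κ, d #I •
    tensorMatrix fun j => if j ∈ I then 1 - vecMulVec v v else vecMulVec v v

omit [Fintype β] in
lemma tensorMatrix_isometry [DecidableEq α] [DecidableEq β] [Fintype α] {X : Matrix α β ℝ}
    (hX : Xᵀ * X = 1) :
    (tensorMatrix fun _ : κ => X)ᵀ * (tensorMatrix fun _ : κ => X) = 1 := by
  rw [tensorMatrix_transpose, tensorMatrix_mul, hX, tensorMatrix_one]

omit [Fintype β] in
/-- Compression of `tensorOp` by a tensor power of an isometry. -/
lemma tensorOp_pullback [DecidableEq α] [DecidableEq β] [Fintype α] {X : Matrix α β ℝ}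
    (hX : Xᵀ * X = 1) (v : α → ℝ) (d : ℕ → ℝ) :
    (tensorMatrix fun _ : κ => X)ᵀ * tensorOp κ v d * (tensorMatrix fun _ : κ => X) =
      tensorOp κ (Xᵀ *ᵥ v) d := by
  have h1 : Xᵀ * vecMulVec v v * X = vecMulVec (Xᵀ *ᵥ v) (Xᵀ *ᵥ v) := by
    rw [mul_vecMulVec, vecMulVec_mul, mulVec_transpose]
  rw [tensorOp, Matrix.mul_sum, Matrix.sum_mul, tensorOp]
  refine Finset.sum_congr rfl fun I _ => ?_
  rw [Matrix.mul_smul, Matrix.smul_mul, tensorMatrix_transpose, tensorMatrix_mul, tensorMatrix_mul]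
  congr 2
  ext1 j
  split_ifs
  · rw [Matrix.mul_sub, Matrix.sub_mul, Matrix.mul_one, hX, h1]
  · rw [h1]

omit [Fintype β] in
lemma tensorOp_apply [DecidableEq α] (v : α → ℝ) (d : ℕ → ℝ) (a b : κ → α) :
    tensorOp κ v d a b = ∑ I : Finset κ, d #I *
      ∏ j, if j ∈ I then (if a j = b j then 1 else 0) - v (a j) * v (b j)
        else v (a j) * v (b j) := by
  rw [tensorOp, Matrix.sum_apply]
  refine Finset.sum_congr rfl fun I _ => ?_
  rw [Matrix.smul_apply, tensorMatrix_apply, smul_eq_mul]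
  congr 1
  refine Finset.prod_congr rfl fun j _ => ?_
  split_ifs with h1 h2 <;> simp [vecMulVec_apply, *]

/-- A crude bound on the norm of `tensorOp`. -/
lemma abs_tensorOp_bilin_le [DecidableEq α] [Fintype α] {v : α → ℝ} (hv : v ⬝ᵥ v = 1)
    {d : ℕ → ℝ} {D : ℝ} (hd : ∀ i ≤ Fintype.card κ, |d i| ≤ D) (f g : (κ → α) → ℝ) :
    |f ⬝ᵥ tensorOp κ v d *ᵥ g| ≤ 2 ^ Fintype.card κ * D * (l2 f * l2 g) := by
  have hV : vecMulVec v v * vecMulVec v v = vecMulVec v v := by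
    rw [vecMulVec_mul_vecMulVec, hv, one_smul]
  have hVt : (vecMulVec v v)ᵀ = vecMulVec v v := by rw [transpose_vecMulVec]
  -- Each summand is a symmetric idempotent, hence a contraction. The factor `2 ^ |κ|` counts the
  -- sets `I`.
  have hproj : ∀ I : Finset κ, ∀ f g : (κ → α) → ℝ,
      |f ⬝ᵥ (tensorMatrix fun j : κ => if j ∈ I then 1 - vecMulVec v v else vecMulVec v v) *ᵥ g| ≤
        l2 f * l2 g := by
    intro I
    set P := tensorMatrix fun j : κ => if j ∈ I then 1 - vecMulVec v v else vecMulVec v v with hP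
    have hPt : Pᵀ = P := by
      rw [hP, tensorMatrix_transpose]
      congr 1; ext1 j
      split_ifs <;> simp [hVt]
    have hPP : P * P = P := by
      rw [hP, tensorMatrix_mul]
      congr 1; ext1 j
      split_ifs
      · rw [mul_sub, sub_mul, sub_mul, hV]; simp
      · exact hV
    have hsq : ∀ f g : (κ → α) → ℝ, f ⬝ᵥ P *ᵥ g = (P *ᵥ f) ⬝ᵥ (P *ᵥ g) := by
      intro f g
      have := mulVec_bilin P (1 : Matrix (κ → α) (κ → α) ℝ) P f g
      rw [one_mulVec, Matrix.mul_one, hPt, hPP] at this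
      exact this.symm
    have hle : ∀ f, l2 (P *ᵥ f) ≤ l2 f := by
      intro f
      have h1 := abs_dotProduct_le f (P *ᵥ f)
      rw [hsq, ← l2_sq, abs_of_nonneg (sq_nonneg _)] at h1
      rcases (l2_nonneg (P *ᵥ f)).eq_or_lt with h0 | h0
      · rw [← h0]; exact l2_nonneg _
      · exact le_of_mul_le_mul_right (by rw [← sq]; exact h1) h0
    intro f g
    rw [hsq]
    exact (abs_dotProduct_le _ _).trans
      (mul_le_mul (hle f) (hle g) (l2_nonneg _) (l2_nonneg _))
  rw [tensorOp, sum_mulVec, dotProduct_sum]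
  refine (Finset.abs_sum_le_sum_abs _ _).trans ?_
  have : ∀ I ∈ (Finset.univ : Finset (Finset κ)), |f ⬝ᵥ (d #I •
      tensorMatrix fun j : κ => if j ∈ I then 1 - vecMulVec v v else vecMulVec v v) *ᵥ g| ≤
        D * (l2 f * l2 g) := by
    intro I _
    rw [smul_mulVec, dotProduct_smul, smul_eq_mul, abs_mul]
    have := hd #I (Finset.card_le_univ I)
    exact mul_le_mul this (hproj I f g) (abs_nonneg _) ((abs_nonneg _).trans this)
  refine (Finset.sum_le_card_nsmul _ _ _ this).trans (le_of_eq ?_)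
  rw [Finset.card_univ, Fintype.card_finset, nsmul_eq_mul]
  push_cast
  ring

end Tensor

/-! ### Symmetric functions on the Boolean cube -/

section Cube

variable {κ : Type*} [Fintype κ] [DecidableEq κ]

/-- The Hamming weight of a bit string indexed by an arbitrary finite type. -/
def hammingWeight (z : κ → Bool) : ℕ := #{j | z j = true}

omit [DecidableEq κ] in
lemma hammingWeight_le (z : κ → Bool) : hammingWeight z ≤ Fintype.card κ :=
  Finset.card_le_univ _

omit [DecidableEq κ] in
lemma hammingWeight_comp_perm (z : κ → Bool) (σ : Equiv.Perm κ) :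
    hammingWeight (z ∘ σ) = hammingWeight z := by
  refine Finset.card_bij (fun j _ => σ j) (by simp) (by simp) fun j hj => ⟨σ.symm j, ?_, by simp⟩
  simpa using hj

omit [DecidableEq κ] in
/-- Functions with equinumerous fibres agree up to a permutation. -/
lemma exists_perm_comp_eq {γ : Type*} [DecidableEq γ] (f g : κ → γ)
    (H : ∀ c, #{j | f j = c} = #{j | g j = c}) : ∃ σ : Equiv.Perm κ, g ∘ σ = f := by
  have e : ∀ c, Nonempty ({j // f j = c} ≃ {j // g j = c}) := fun c =>
    Fintype.card_eq.1 (by rw [Fintype.card_subtype, Fintype.card_subtype, H c])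
  refine ⟨Equiv.ofFiberEquiv fun c => (e c).some, ?_⟩
  ext1 j
  exact Equiv.ofFiberEquiv_map _ j

lemma exists_perm_of_hammingWeight_eq {z z' : κ → Bool} (H : hammingWeight z = hammingWeight z') :
    ∃ σ : Equiv.Perm κ, z' ∘ σ = z := by
  have h1 : ∀ w : κ → Bool, #{j | w j = false} = Fintype.card κ - hammingWeight w := by
    intro w
    rw [hammingWeight, ← Finset.card_compl]
    congr 1; ext j; simp
  refine exists_perm_comp_eq z z' fun c => ?_
  cases c
  · rw [h1, h1, H]
  · exact H

lemma sum_hammingWeight (F : ℕ → ℝ) :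
    ∑ z : κ → Bool, F (hammingWeight z) =
      ∑ x ∈ range (Fintype.card κ + 1), ((Fintype.card κ).choose x : ℝ) * F x := by
  have := Finset.sum_powerset_apply_card (fun x => F x) (x := (Finset.univ : Finset κ))
  rw [Finset.powerset_univ, Finset.card_univ] at this
  simp only [nsmul_eq_mul] at this
  rw [← this]
  refine Finset.sum_nbij' (fun z => ({j | z j = true} : Finset κ)) (fun s j => decide (j ∈ s))
    (by simp) (by simp) ?_ ?_ (fun z _ => rfl)
  · intro z _; ext j; simp
  · intro s _; ext j; simp

end Cube

/-! ### Krawtchouk vectors -/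

/-- The orthogonal matrix that maps the vector `(√p, √(1-p))` to a standard basis vector. -/
noncomputable def rotation (p : ℝ) : Matrix Bool Bool ℝ :=
  Matrix.of fun c z => if c then (if z then -√(1 - p) else √p) else (if z then √p else √(1 - p))

/-- The unit vector `(√p, √(1-p))`. -/
noncomputable def biasVector (p : ℝ) : Bool → ℝ := fun z => if z then √p else √(1 - p)

/-- The value at `x` ones of the sum of all products of `m` entries of `rotation p`, `t` of which
are from the second row. -/
noncomputable def krawCoeff (m : ℕ) (p : ℝ) (t x : ℕ) : ℝ :=
  ((Polynomial.C (√p) + Polynomial.C (-√(1 - p)) * Polynomial.X) ^ x *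
    (Polynomial.C (√(1 - p)) + Polynomial.C (√p) * Polynomial.X) ^ (m - x)).coeff t

section Rotation

variable {p : ℝ}

lemma rotation_transpose_mul (h0 : 0 ≤ p) (h1 : p ≤ 1) : (rotation p)ᵀ * rotation p = 1 := by
  have e0 : √p * √p = p := Real.mul_self_sqrt h0
  have e1 : √(1 - p) * √(1 - p) = 1 - p := Real.mul_self_sqrt (by linarith)
  ext a b
  cases a <;> cases b <;>
    simp [rotation, Matrix.mul_apply, e0, e1, mul_comm]

lemma rotation_mul_transpose (h0 : 0 ≤ p) (h1 : p ≤ 1) : rotation p * (rotation p)ᵀ = 1 := by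
  rw [mul_eq_one_comm]; exact rotation_transpose_mul h0 h1

lemma rotation_transpose_mulVec : (rotation p)ᵀ *ᵥ Pi.single false 1 = biasVector p := by
  ext b
  cases b <;> simp [rotation, biasVector]

end Rotation

lemma coeff_linear_pow (a b : ℝ) (x i : ℕ) :
    ((Polynomial.C a + Polynomial.C b * Polynomial.X) ^ x).coeff i =
      a ^ (x - i) * b ^ i * (x.choose i : ℝ) := by
  rw [add_comm, add_pow, Polynomial.finsetSum_coeff]
  have : ∀ j, (((Polynomial.C b * Polynomial.X) ^ j * Polynomial.C a ^ (x - j) *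
      (x.choose j : Polynomial ℝ)).coeff i) =
      if i = j then a ^ (x - j) * b ^ j * (x.choose j : ℝ) else 0 := by
    intro j
    have e : (Polynomial.C b * Polynomial.X) ^ j * Polynomial.C a ^ (x - j) *
      (x.choose j : Polynomial ℝ) =
        Polynomial.C (a ^ (x - j) * b ^ j * (x.choose j : ℝ)) * Polynomial.X ^ j := by
      simp only [map_mul, map_pow, map_natCast]; ring
    rw [e, Polynomial.coeff_C_mul_X_pow]
  simp only [this, Finset.sum_ite_eq, Finset.mem_range]
  split_ifs with h
  · rfl
  · rw [Nat.choose_eq_zero_of_lt (by omega)]; simp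

/-! ### Diagonalisation of `tensorOp` on the Boolean cube -/

section Diagonalise

variable {κ : Type*} [Fintype κ] [DecidableEq κ]

/-- Generating function: `X` marks the positions where the second row of `rotation p` is chosen. The
product of linear polynomials is grouped by the bits of `z` in `h1` and expanded over all choices
`c` in `h2`. -/
lemma sum_prod_rotation (p : ℝ) (t : ℕ) (z : κ → Bool) :
    (∑ c : κ → Bool, if hammingWeight c = t then ∏ j, rotation p (c j) (z j) else 0) =
      krawCoeff (Fintype.card κ) p t (hammingWeight z) := by
  have h1 : ∏ j, (Polynomial.C (rotation p false (z j)) +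
      Polynomial.C (rotation p true (z j)) * Polynomial.X) =
      (Polynomial.C (√p) + Polynomial.C (-√(1 - p)) * Polynomial.X) ^ hammingWeight z *
    (Polynomial.C (√(1 - p)) + Polynomial.C (√p) * Polynomial.X) ^
      (Fintype.card κ - hammingWeight z) := by
    rw [← Finset.prod_mul_prod_compl ({j | z j = true} : Finset κ), hammingWeight,
      ← Finset.card_compl, ← Finset.prod_const, ← Finset.prod_const]
    congr 1
    · refine Finset.prod_congr rfl fun j hj => ?_
      have : z j = true := by simpa using hj
      simp [rotation, this]
    · refine Finset.prod_congr rfl fun j hj => ?_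
      have : z j = false := by simpa using hj
      simp [rotation, this]
  have h2 : ∏ j, (Polynomial.C (rotation p false (z j)) +
      Polynomial.C (rotation p true (z j)) * Polynomial.X) =
      ∑ c : κ → Bool, Polynomial.C (∏ j, rotation p (c j) (z j)) *
        Polynomial.X ^ hammingWeight c := by
    have : ∀ j, Polynomial.C (rotation p false (z j)) +
      Polynomial.C (rotation p true (z j)) * Polynomial.X =
      ∑ b : Bool, Polynomial.C (rotation p b (z j)) *
        (if b = true then (Polynomial.X : Polynomial ℝ) else 1) := by
      intro j; simp [add_comm]
    simp only [this]
    rw [Finset.prod_univ_sum, Fintype.piFinset_univ]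
    refine Finset.sum_congr rfl fun c _ => ?_
    rw [Finset.prod_mul_distrib, map_prod, Finset.prod_ite, hammingWeight]
    simp
  rw [krawCoeff, ← h1, h2, Polynomial.finsetSum_coeff]
  refine Finset.sum_congr rfl fun c _ => ?_
  rw [Polynomial.coeff_C_mul_X_pow]
  simp only [eq_comm]

/-- For a basis vector both tensor factors are diagonal, and at the word `c` only the set `I` of the
positions of its ones contributes. -/
lemma tensorOp_single (d : ℕ → ℝ) :
    tensorOp κ (Pi.single false 1 : Bool → ℝ) d = Matrix.diagonal fun c => d (hammingWeight c) := by
  ext a b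
  rw [tensorOp_apply, Matrix.diagonal_apply]
  split_ifs with h
  · subst h
    rw [Finset.sum_eq_single ({j | a j = true} : Finset κ)]
    · rw [Finset.prod_eq_one, mul_one, hammingWeight]
      intro j _
      cases hj : a j <;> simp [hj]
    · intro I _ hI
      rw [Finset.prod_eq_zero_iff.2, mul_zero]
      by_contra! hne
      refine hI ?_
      ext j
      have := hne j (Finset.mem_univ j)
      cases hj : a j <;> by_cases hjI : j ∈ I <;> simp_all
    · simp
  · obtain ⟨j, hj⟩ := Function.ne_iff.1 h
    refine Finset.sum_eq_zero fun I _ => ?_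
    rw [Finset.prod_eq_zero (Finset.mem_univ j), mul_zero]
    cases hj' : a j <;> cases hj'' : b j <;> simp_all

/-- The `t`-th isotypic component of a symmetric function on the cube. -/
lemma rotation_mulVec_symm (p : ℝ) (φ : ℕ → ℝ) (c : κ → Bool) :
    ((Fintype.card κ).choose (hammingWeight c) : ℝ) *
      ((tensorMatrix fun _ : κ => rotation p) *ᵥ fun z => φ (hammingWeight z)) c =
      ∑ x ∈ range (Fintype.card κ + 1), ((Fintype.card κ).choose x : ℝ) *
        (φ x * krawCoeff (Fintype.card κ) p (hammingWeight c) x) := by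
  set F := (tensorMatrix fun _ : κ => rotation p) *ᵥ fun z => φ (hammingWeight z) with hF
  -- The transform of a symmetric function is symmetric, so its value at `c` can be found by summing
  -- over the whole weight level of `c`, where `sum_prod_rotation` applies.
  have hsymm : ∀ c', hammingWeight c' = hammingWeight c → F c' = F c := by
    intro c' hc'
    obtain ⟨σ, rfl⟩ := exists_perm_of_hammingWeight_eq hc'
    simp only [hF, mulVec, dotProduct, tensorMatrix_apply]
    refine Fintype.sum_equiv (Equiv.arrowCongr σ (Equiv.refl Bool)) _ _ fun z => ?_
    have e : (Equiv.arrowCongr σ (Equiv.refl Bool)) z = z ∘ σ.symm := by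
      ext j; simp [Equiv.arrowCongr]
    rw [e, hammingWeight_comp_perm]
    congr 1
    refine Fintype.prod_equiv σ _ _ fun j => ?_
    simp
  have h1 : (∑ c', if hammingWeight c' = hammingWeight c then F c' else 0) =
      ((Fintype.card κ).choose (hammingWeight c) : ℝ) * F c := by
    have : ∀ c' : κ → Bool, (if hammingWeight c' = hammingWeight c then F c' else 0) =
        (fun x => if x = hammingWeight c then F c else 0) (hammingWeight c') := by
      intro c'
      by_cases h : hammingWeight c' = hammingWeight c
      · simp [h, hsymm c' h]
      · simp [h]
    simp only [this]
    rw [sum_hammingWeight (κ := κ) (fun x => if x = hammingWeight c then F c else 0)]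
    have := Nat.lt_succ_of_le (hammingWeight_le c)
    simp [this]
  rw [← h1, ← sum_hammingWeight (κ := κ)
    (fun x => φ x * krawCoeff (Fintype.card κ) p (hammingWeight c) x)]
  simp only [← sum_prod_rotation, Finset.mul_sum]
  rw [Finset.sum_comm]
  refine Finset.sum_congr rfl fun c' _ => ?_
  split_ifs
  · simp only [hF, mulVec, dotProduct, tensorMatrix_apply, mul_comm]
  · simp

end Diagonalise

/-! ### Orthonormality of the Krawtchouk vectors -/

section Kappa

variable {m : ℕ} {p : ℝ}

/-- As functions on the cube, these coefficients are images of the indicators of the weight levels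
`t` and `s` under an orthogonal matrix. Distinct levels are disjoint, and level `t` has `m.choose t`
points. -/
lemma krawCoeff_orthogonal (h0 : 0 ≤ p) (h1 : p ≤ 1) {t s : ℕ} :
    ∑ x ∈ range (m + 1), (m.choose x : ℝ) * (krawCoeff m p t x * krawCoeff m p s x) =
      if t = s then (m.choose t : ℝ) else 0 := by
  have hc := sum_hammingWeight (κ := Fin m) (fun x => krawCoeff m p t x * krawCoeff m p s x)
  rw [Fintype.card_fin] at hc
  rw [← hc]
  have hZ : tensorMatrix (fun _ : Fin m => rotation p) *
      (tensorMatrix (fun _ : Fin m => rotation p))ᵀ = 1 := by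
    rw [tensorMatrix_transpose, tensorMatrix_mul, rotation_mul_transpose h0 h1, tensorMatrix_one]
  have e : ∀ t, (fun z : Fin m → Bool => krawCoeff m p t (hammingWeight z)) =
      (tensorMatrix (fun _ : Fin m => rotation p))ᵀ *ᵥ
        (fun c => if hammingWeight c = t then 1 else 0) := by
    intro t
    ext z
    have := sum_prod_rotation p t z
    rw [Fintype.card_fin] at this
    rw [← this, mulVec, dotProduct]
    refine Finset.sum_congr rfl fun c _ => ?_
    split_ifs <;> simp [tensorMatrix_apply]
  have := dotProduct_mulVec_isometry (X := (tensorMatrix (fun _ : Fin m => rotation p))ᵀ)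
    (by rw [transpose_transpose]; exact hZ)
    (fun c => if hammingWeight c = t then 1 else 0) (fun c => if hammingWeight c = s then 1 else 0)
  rw [← e, ← e] at this
  simp only [dotProduct] at this
  rw [this]
  have h2 := sum_hammingWeight (κ := Fin m)
    (fun x => (if x = t then (1 : ℝ) else 0) * (if x = s then 1 else 0))
  rw [h2, Fintype.card_fin]
  split_ifs with hts
  · subst hts
    by_cases htm : t < m + 1
    · simp [htm]
    · simp [htm, Nat.choose_eq_zero_of_lt (show m < t by omega)]
  · refine Finset.sum_eq_zero fun x _ => ?_
    by_cases hx : x = t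
    · subst hx; simp [hts]
    · simp [hx]

/-- The explicit sum is the Cauchy product for the `t`-th coefficient in `krawCoeff`. The powers of
`√p` and `√(1 - p)` in the binomial weight combine with those of the coefficient up to a factor that
depends on `t` only and disappears in `kappa`. -/
lemma krawtchouk_apply (h0 : 0 ≤ p) (h1 : p ≤ 1) (t : ℕ) (x : Fin (m + 1)) :
    krawtchouk m p t x = (√p * √(1 - p)) ^ t * (√(m.choose x : ℝ) * krawCoeff m p t x) := by
  have e0 : √p * √p = p := Real.mul_self_sqrt h0
  have e1 : √(1 - p) * √(1 - p) = 1 - p := Real.mul_self_sqrt (by linarith)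
  have hx : (x : ℕ) ≤ m := Nat.lt_succ_iff.1 x.2
  simp only [krawtchouk, krawCoeff]
  have hanti := Finset.Nat.sum_antidiagonal_eq_sum_range_succ (M := ℝ)
    (fun i j => ((Polynomial.C (√p) + Polynomial.C (-√(1 - p)) * Polynomial.X) ^ (x : ℕ)).coeff i *
    ((Polynomial.C (√(1 - p)) + Polynomial.C (√p) * Polynomial.X) ^ (m - (x : ℕ))).coeff j) t
  rw [Polynomial.coeff_mul, hanti]
  have hs : √((m.choose x : ℝ) * p ^ (x : ℕ) * (1 - p) ^ (m - (x : ℕ))) =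
      √(m.choose x : ℝ) * (√p ^ (x : ℕ) * √(1 - p) ^ (m - (x : ℕ))) := by
    rw [mul_assoc, Real.sqrt_mul (by positivity),
      Real.sqrt_mul (pow_nonneg h0 _)]
    congr 2
    · rw [Real.sqrt_eq_iff_mul_self_eq (pow_nonneg h0 _) (by positivity), ← mul_pow, e0]
    · rw [Real.sqrt_eq_iff_mul_self_eq (pow_nonneg (by linarith) _) (by positivity), ← mul_pow, e1]
  rw [hs, mul_left_comm (_ ^ t), mul_assoc]
  congr 1
  rw [Finset.mul_sum, Finset.mul_sum]
  refine Finset.sum_congr rfl fun i hi => ?_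
  have hit : i ≤ t := Nat.lt_succ_iff.1 (Finset.mem_range.1 hi)
  rw [coeff_linear_pow, coeff_linear_pow]
  -- Outside the ranges `i ≤ x` and `t - i ≤ m - x` a binomial coefficient vanishes on both sides;
  -- inside them no truncated subtraction in an exponent loses anything.
  by_cases h2 : i ≤ x
  swap
  · rw [Nat.choose_eq_zero_of_lt (show (x : ℕ) < i by omega)]; simp
  by_cases h3 : t - i ≤ m - x
  swap
  · rw [Nat.choose_eq_zero_of_lt (show m - (x : ℕ) < t - i by omega)]; simp
  obtain ⟨y, hy⟩ := Nat.exists_eq_add_of_le h2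
  obtain ⟨w, hw⟩ := Nat.exists_eq_add_of_le h3
  obtain ⟨s, rfl⟩ := Nat.exists_eq_add_of_le hit
  have hs' : i + s - i = s := by omega
  rw [hs'] at hw ⊢
  rw [hw, hy, show i + y - i = y by omega, show s + w - s = w by omega]
  generalize √p = a at *
  generalize √(1 - p) = b at *
  rw [← e1, ← e0, neg_pow b]
  ring

lemma norm_krawtchouk (h0 : 0 ≤ p) (h1 : p ≤ 1) (t : ℕ) :
    ‖krawtchouk m p t‖ = (√p * √(1 - p)) ^ t * √(m.choose t : ℝ) := by
  have h := krawCoeff_orthogonal (m := m) h0 h1 (t := t) (s := t)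
  rw [if_pos rfl, ← Fin.sum_univ_eq_sum_range
    (fun x => (m.choose x : ℝ) * (krawCoeff m p t x * krawCoeff m p t x))] at h
  rw [EuclideanSpace.norm_eq, Real.sqrt_eq_iff_mul_self_eq (by positivity) (by positivity)]
  rw [mul_mul_mul_comm, Real.mul_self_sqrt (by positivity), ← h, Finset.mul_sum]
  refine Finset.sum_congr rfl fun x _ => ?_
  rw [krawtchouk_apply h0 h1, Real.norm_eq_abs, sq_abs]
  linear_combination ((√p * √(1 - p)) ^ t) ^ 2 * (krawCoeff m p t x) ^ 2 *
    Real.mul_self_sqrt (show (0 : ℝ) ≤ (m.choose x : ℝ) by positivity)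

lemma kappa_apply (h0 : 0 < p) (h1 : p < 1) (t : ℕ) (x : Fin (m + 1)) :
    kappa m p t x = √(m.choose x : ℝ) * krawCoeff m p t x / √(m.choose t : ℝ) := by
  have hp : 0 < (√p * √(1 - p)) ^ t := by
    have := Real.sqrt_pos.2 h0
    have := Real.sqrt_pos.2 (show 0 < 1 - p by linarith)
    positivity
  rw [kappa, PiLp.smul_apply, norm_krawtchouk h0.le h1.le, krawtchouk_apply h0.le h1.le,
    smul_eq_mul, mul_inv, div_eq_mul_inv]
  field_simp

lemma kappa_orthogonal (h0 : 0 < p) (h1 : p < 1) {t s : ℕ} (ht : t ≤ m) :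
    (kappa m p t).ofLp ⬝ᵥ (kappa m p s).ofLp = if t = s then 1 else 0 := by
  have h := krawCoeff_orthogonal (m := m) h0.le h1.le (t := t) (s := s)
  rw [← Fin.sum_univ_eq_sum_range
    (fun x => (m.choose x : ℝ) * (krawCoeff m p t x * krawCoeff m p s x))] at h
  have : (kappa m p t).ofLp ⬝ᵥ (kappa m p s).ofLp =
      (∑ x : Fin (m + 1), (m.choose x : ℝ) * (krawCoeff m p t x * krawCoeff m p s x)) *
        ((√(m.choose t : ℝ))⁻¹ * (√(m.choose s : ℝ))⁻¹) := by
    rw [dotProduct, Finset.sum_mul]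
    refine Finset.sum_congr rfl fun x _ => ?_
    rw [kappa_apply h0 h1, kappa_apply h0 h1]
    have := Real.mul_self_sqrt (show (0 : ℝ) ≤ (m.choose x : ℝ) by positivity)
    linear_combination (krawCoeff m p t x * krawCoeff m p s x) *
      ((√(m.choose t : ℝ))⁻¹ * (√(m.choose s : ℝ))⁻¹) * this
  rw [this, h]
  split_ifs with hts
  · subst hts
    have h2 : (0 : ℝ) < m.choose t := by exact_mod_cast Nat.choose_pos ht
    have := Real.mul_self_sqrt h2.le
    rw [← mul_inv, this, mul_inv_cancel₀ h2.ne']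
  · simp

lemma l2_kappa (h0 : 0 < p) (h1 : p < 1) {t : ℕ} (ht : t ≤ m) : l2 (kappa m p t).ofLp = 1 := by
  rw [l2, kappa_orthogonal h0 h1 ht, if_pos rfl, Real.sqrt_one]

/-- `∑_{j ≤ m} d_j ϰ_j ϰ_j^*`. -/
noncomputable def krawMatrix (m : ℕ) (p : ℝ) (d : ℕ → ℝ) : Matrix (Fin (m + 1)) (Fin (m + 1)) ℝ :=
  ∑ j ∈ range (m + 1), d j • vecMulVec (kappa m p j).ofLp (kappa m p j).ofLp

lemma krawMatrix_bilin (d : ℕ → ℝ) (f g : Fin (m + 1) → ℝ) :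
    f ⬝ᵥ krawMatrix m p d *ᵥ g =
      ∑ j ∈ range (m + 1), d j * ((f ⬝ᵥ (kappa m p j).ofLp) * ((kappa m p j).ofLp ⬝ᵥ g)) := by
  rw [krawMatrix, sum_mulVec, dotProduct_sum]
  refine Finset.sum_congr rfl fun j _ => ?_
  rw [smul_mulVec, dotProduct_smul, smul_eq_mul, vecMulVec_mulVec]
  simp [dotProduct_smul, mul_comm]

end Kappa

/-- On symmetric functions on the cube, `tensorOp` acts as the Krawtchouk matrix. -/
lemma tensorOp_symm_bilin {κ : Type*} [Fintype κ] [DecidableEq κ] {m : ℕ}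
    (hm : Fintype.card κ = m) {p : ℝ} (h0 : 0 < p) (h1 : p < 1) (d : ℕ → ℝ) (φ ψ : ℕ → ℝ) :
    (fun z : κ → Bool => φ (hammingWeight z)) ⬝ᵥ tensorOp κ (biasVector p) d *ᵥ
        (fun z => ψ (hammingWeight z)) =
      (fun x : Fin (m + 1) => √(m.choose x : ℝ) * φ x) ⬝ᵥ krawMatrix m p d *ᵥ
        (fun x => √(m.choose x : ℝ) * ψ x) := by
  subst hm
  rw [← rotation_transpose_mulVec, ← tensorOp_pullback (rotation_transpose_mul h0.le h1.le),
    ← mulVec_bilin, tensorOp_single, krawMatrix_bilin]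
  -- The transform of a symmetric function at `c` is, up to normalisation, the Krawtchouk
  -- coefficient of degree `|c|`.
  have hF : ∀ (φ : ℕ → ℝ) (c : κ → Bool),
      ((tensorMatrix fun _ : κ => rotation p) *ᵥ fun z => φ (hammingWeight z)) c =
      (√((Fintype.card κ).choose (hammingWeight c) : ℝ))⁻¹ *
        ((fun x : Fin (Fintype.card κ + 1) => √((Fintype.card κ).choose x : ℝ) * φ x) ⬝ᵥ
          (kappa (Fintype.card κ) p (hammingWeight c)).ofLp) := by
    intro φ c
    have h := rotation_mulVec_symm p φ c
    have hpos : (0 : ℝ) < (Fintype.card κ).choose (hammingWeight c) := by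
      exact_mod_cast Nat.choose_pos (hammingWeight_le c)
    rw [mul_comm, ← eq_div_iff hpos.ne'] at h
    rw [h, ← Fin.sum_univ_eq_sum_range (fun x => ((Fintype.card κ).choose x : ℝ) *
        (φ x * krawCoeff (Fintype.card κ) p (hammingWeight c) x)), dotProduct, Finset.mul_sum,
      Finset.sum_div]
    refine Finset.sum_congr rfl fun x _ => ?_
    rw [kappa_apply h0 h1]
    have e1 := Real.mul_self_sqrt (show (0 : ℝ) ≤ ((Fintype.card κ).choose x : ℝ) by positivity)
    have e2 := Real.mul_self_sqrt hpos.le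
    have e3 := Real.sqrt_pos.2 hpos
    generalize √((Fintype.card κ).choose x : ℝ) = a at *
    generalize √((Fintype.card κ).choose (hammingWeight c) : ℝ) = b at *
    rw [← e1, ← e2]
    field_simp
  -- Inserting this factor makes the sum over degrees `j` a sum over the cube, with each degree
  -- repeated for its `choose` many words.
  have hD : ∀ j ∈ range (Fintype.card κ + 1), ∀ y : ℝ,
      ((Fintype.card κ).choose j : ℝ) * ((√((Fintype.card κ).choose j : ℝ))⁻¹ *
        (√((Fintype.card κ).choose j : ℝ))⁻¹ * y) = y := by
    intro j hj y
    have h2 : (0 : ℝ) < (Fintype.card κ).choose j := by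
      exact_mod_cast Nat.choose_pos (Nat.lt_succ_iff.1 (Finset.mem_range.1 hj))
    rw [← mul_inv, Real.mul_self_sqrt h2.le, mul_inv_cancel_left₀ h2.ne']
  rw [← Finset.sum_congr rfl fun j hj => hD j hj (d j * _), ← sum_hammingWeight, dotProduct]
  refine Finset.sum_congr rfl fun c _ => ?_
  rw [mulVec_diagonal, hF, hF, dotProduct_comm _ fun x : Fin (Fintype.card κ + 1) => _ * ψ x]
  ring

/-! ### Decomposition of symmetric tensors by patterns -/

section Pattern

variable {κ β : Type*}

/-- The positions of a word where the letter is in `β`, with the letters. -/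
def pattern (c : κ → Bool ⊕ β) : κ → Option β := fun j => (c j).getRight?

/-- The word with a given pattern and given Boolean letters in the free positions. -/
def assemble (π : κ → Option β) (z : {j // π j = none} → Bool) : κ → Bool ⊕ β := fun j =>
  if h : π j = none then Sum.inl (z ⟨j, h⟩) else Sum.inr ((π j).get (Option.ne_none_iff_isSome.1 h))

lemma assemble_none {π : κ → Option β} (z : {j // π j = none} → Bool) {j : κ} (h : π j = none) :
    assemble π z j = Sum.inl (z ⟨j, h⟩) := by simp [assemble, h]

lemma assemble_some {π : κ → Option β} (z : {j // π j = none} → Bool) {j : κ} {b : β}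
    (h : π j = some b) : assemble π z j = Sum.inr b := by simp [assemble, h]

lemma pattern_assemble (π : κ → Option β) (z : {j // π j = none} → Bool) :
    pattern (assemble π z) = π := by
  ext1 j
  cases h : π j with
  | none => simp [pattern, assemble_none z h]
  | some b => simp [pattern, assemble_some z h]

lemma assemble_injective (π : κ → Option β) : Function.Injective (assemble π) := by
  intro z z' H
  ext1 j
  have := congrFun H j.1
  rwa [assemble_none z j.2, assemble_none z' j.2, Sum.inl.injEq] at this

lemma exists_assemble_eq (c : κ → Bool ⊕ β) : ∃ z, assemble (pattern c) z = c := by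
  -- The value `false` is never reached: at a free position the letter of `c` is Boolean.
  refine ⟨fun j => (c j).elim id fun _ => false, ?_⟩
  ext1 j
  cases h : c j with
  | inl b => rw [assemble_none _ (by simp [pattern, h])]; simp [h]
  | inr b => rw [assemble_some _ (b := b) (by simp [pattern, h])]

variable [Fintype κ] [Fintype β] [DecidableEq κ] [DecidableEq β]

lemma sum_assemble (F : (κ → Bool ⊕ β) → ℝ) :
    ∑ c, F c = ∑ π : κ → Option β, ∑ z : {j // π j = none} → Bool, F (assemble π z) := by
  rw [← Finset.sum_fiberwise _ pattern F]
  refine Finset.sum_congr rfl fun π _ => ?_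
  symm
  refine Finset.sum_bij (fun z _ => assemble π z) (fun z _ => by simp [pattern_assemble])
    (fun z _ z' _ H => assemble_injective π H) (fun c hc => ?_) (fun _ _ => rfl)
  obtain rfl : pattern c = π := by simpa using hc
  obtain ⟨z, hz⟩ := exists_assemble_eq c
  exact ⟨z, Finset.mem_univ _, hz⟩

/-- The number of free positions of a pattern. -/
def freeCard (π : κ → Option β) : ℕ := Fintype.card {j // π j = none}

omit [Fintype β] in
-- At a position where the patterns differ, the two letters differ and one of them lies in `β`,
-- where the vector is zero. Both possible tensor factors then vanish.
lemma tensorOp_assemble_ne (w : Bool → ℝ) (d : ℕ → ℝ) {π π' : κ → Option β} (hne : π ≠ π')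
    (z : {j // π j = none} → Bool) (z' : {j // π' j = none} → Bool) :
    tensorOp κ (Sum.elim w 0) d (assemble π z) (assemble π' z') = 0 := by
  obtain ⟨j, hj⟩ := Function.ne_iff.1 hne
  rw [tensorOp_apply]
  refine Finset.sum_eq_zero fun I _ => ?_
  rw [Finset.prod_eq_zero (Finset.mem_univ j), mul_zero]
  cases h : π j with
  | none =>
    cases h' : π' j with
    | none => exact absurd (h.trans h'.symm) hj
    | some b' => simp [assemble_none z h, assemble_some z' h']
  | some b =>
    cases h' : π' j with
    | none => simp [assemble_some z h, assemble_none z' h']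
    | some b' =>
      have : b ≠ b' := by rintro rfl; exact hj (h.trans h'.symm)
      simp [assemble_some z h, assemble_some z' h', this]

omit [Fintype β] in
-- A fixed letter in `β` is orthogonal to the vector, so only sets `I` that contain all fixed
-- positions contribute, with factor `1` there. This shifts the index of `d` by the number of fixed
-- positions.
lemma tensorOp_assemble (w : Bool → ℝ) (d : ℕ → ℝ) (π : κ → Option β)
    (z z' : {j // π j = none} → Bool) :
    tensorOp κ (Sum.elim w 0) d (assemble π z) (assemble π z') =
      tensorOp {j // π j = none} w (fun i => d (i + (Fintype.card κ - freeCard π))) z z' := by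
  rw [tensorOp_apply, tensorOp_apply]
  symm
  have hinj : Function.Injective fun J : Finset {j // π j = none} =>
      J.map (Function.Embedding.subtype _) ∪ ({j | π j ≠ none} : Finset κ) := by
    intro J J' H
    ext j
    have := Finset.ext_iff.1 H j.1
    simpa [j.2] using this
  refine Finset.sum_of_injOn (fun J : Finset {j // π j = none} =>
      J.map (Function.Embedding.subtype _) ∪ ({j | π j ≠ none} : Finset κ)) hinj.injOn
      (by simp) ?_ ?_
  · intro I _ hI
    have : ∃ j, π j ≠ none ∧ j ∉ I := by
      by_contra! hcon
      refine hI ⟨I.subtype _, by simp, ?_⟩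
      ext j
      by_cases hj : π j = none
      · simp [hj]
      · simp [hj, hcon j hj]
    obtain ⟨j, hj, hjI⟩ := this
    obtain ⟨b, hb⟩ := Option.ne_none_iff_exists'.1 hj
    rw [Finset.prod_eq_zero (Finset.mem_univ j), mul_zero]
    simp [hjI, assemble_some z hb]
  · intro J _
    congr 1
    · congr 1
      rw [Finset.card_union_of_disjoint, Finset.card_map, freeCard, Fintype.card_subtype,
        ← Finset.card_compl]
      · congr 2; ext j; simp
      · rw [Finset.disjoint_left]
        intro j hj
        obtain ⟨i, _, rfl⟩ := Finset.mem_map.1 hj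
        simpa using i.2
    · rw [← Fintype.prod_subtype_mul_prod_subtype (fun j => π j = none)]
      have h2 : ∏ j : {j // ¬ π j = none}, (if (j : κ) ∈ J.map (Function.Embedding.subtype _) ∪
          ({j | π j ≠ none} : Finset κ) then
          (if assemble π z j = assemble π z' j then (1 : ℝ) else 0) -
            (Sum.elim w 0 : Bool ⊕ β → ℝ) (assemble π z j) * Sum.elim w 0 (assemble π z' j)
          else Sum.elim w 0 (assemble π z j) * Sum.elim w 0 (assemble π z' j)) = 1 := by
        refine Finset.prod_eq_one fun j _ => ?_
        obtain ⟨b, hb⟩ := Option.ne_none_iff_exists'.1 j.2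
        rw [assemble_some z hb, assemble_some z' hb]
        simp [j.2]
      rw [h2, mul_one]
      refine Finset.prod_congr rfl fun j _ => ?_
      rw [assemble_none z j.2, assemble_none z' j.2]
      have : ((j : κ) ∈ J.map (Function.Embedding.subtype _) ∪ ({j | π j ≠ none} : Finset κ)) ↔
          j ∈ J := by
        simp [j.2]
      simp only [this, Sum.inl.injEq, Sum.elim_inl]

/-- The coordinates, in the orthonormal basis of Dicke states, of a function of the weight. -/
noncomputable def dicke (m : ℕ) (φ : ℕ → ℝ) : Fin (m + 1) → ℝ := fun x => √(m.choose x : ℝ) * φ x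

lemma dotProduct_hammingWeight {κ : Type*} [Fintype κ] [DecidableEq κ] {m : ℕ}
    (hm : Fintype.card κ = m) (φ ψ : ℕ → ℝ) :
    (fun z : κ → Bool => φ (hammingWeight z)) ⬝ᵥ (fun z => ψ (hammingWeight z)) =
      dicke m φ ⬝ᵥ dicke m ψ := by
  subst hm
  rw [dotProduct, sum_hammingWeight (κ := κ) (fun x => φ x * ψ x), dotProduct,
    ← Fin.sum_univ_eq_sum_range (fun x => ((Fintype.card κ).choose x : ℝ) * (φ x * ψ x))]
  refine Finset.sum_congr rfl fun x _ => ?_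
  rw [dicke, dicke]
  linear_combination -(φ x * ψ x) * Real.mul_self_sqrt
    (show (0 : ℝ) ≤ ((Fintype.card κ).choose x : ℝ) by positivity)

lemma dotProduct_assemble {F G : (κ → Bool ⊕ β) → ℝ} {φ ψ : (κ → Option β) → ℕ → ℝ}
    (hF : ∀ π z, F (assemble π z) = φ π (hammingWeight z))
    (hG : ∀ π z, G (assemble π z) = ψ π (hammingWeight z)) :
    F ⬝ᵥ G = ∑ π, dicke (freeCard π) (φ π) ⬝ᵥ dicke (freeCard π) (ψ π) := by
  rw [dotProduct, sum_assemble]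
  refine Finset.sum_congr rfl fun π _ => ?_
  rw [← dotProduct_hammingWeight (κ := {j // π j = none}) (m := freeCard π) rfl]
  simp only [hF, hG, dotProduct]

/-- On symmetric tensors, `tensorOp` decomposes as a direct sum of Krawtchouk matrices. -/
lemma tensorOp_bilin_assemble {p : ℝ} (h0 : 0 < p) (h1 : p < 1) (d : ℕ → ℝ)
    {F G : (κ → Bool ⊕ β) → ℝ} {φ ψ : (κ → Option β) → ℕ → ℝ}
    (hF : ∀ π z, F (assemble π z) = φ π (hammingWeight z))
    (hG : ∀ π z, G (assemble π z) = ψ π (hammingWeight z)) :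
    F ⬝ᵥ tensorOp κ (Sum.elim (biasVector p) 0) d *ᵥ G =
      ∑ π, dicke (freeCard π) (φ π) ⬝ᵥ
        krawMatrix (freeCard π) p (fun i => d (i + (Fintype.card κ - freeCard π))) *ᵥ
          dicke (freeCard π) (ψ π) := by
  rw [dotProduct, sum_assemble]
  refine Finset.sum_congr rfl fun π _ => ?_
  have h2 := tensorOp_symm_bilin (κ := {j // π j = none}) (m := freeCard π) rfl h0 h1
    (fun i => d (i + (Fintype.card κ - freeCard π))) (φ π) (ψ π)
  refine Eq.trans ?_ h2
  rw [dotProduct]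
  refine Finset.sum_congr rfl fun z _ => ?_
  rw [hF, mulVec, dotProduct, sum_assemble, Finset.sum_eq_single π]
  · simp only [tensorOp_assemble, hG, mulVec, dotProduct]
  · intro π' _ hne
    refine Finset.sum_eq_zero fun z' _ => ?_
    rw [tensorOp_assemble_ne _ _ hne.symm, zero_mul]
  · simp

omit [Fintype β] [DecidableEq β] in
/-- A symmetric tensor depends only on the weights of the Boolean letters in each pattern. -/
lemma exists_hammingWeight_of_symm {F : (κ → Bool ⊕ β) → ℝ}
    (hF : ∀ (σ : Equiv.Perm κ) c, F (c ∘ σ) = F c) :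
    ∃ φ : (κ → Option β) → ℕ → ℝ, ∀ π z, F (assemble π z) = φ π (hammingWeight z) := by
  classical
  have key : ∀ π (z z' : {j // π j = none} → Bool), hammingWeight z = hammingWeight z' →
      F (assemble π z) = F (assemble π z') := by
    intro π z z' H
    obtain ⟨σ, rfl⟩ := exists_perm_of_hammingWeight_eq H
    rw [← hF (Equiv.Perm.ofSubtype σ) (assemble π z')]
    congr 1
    ext1 j
    rw [Function.comp_apply]
    cases h : π j with
    | none =>
      rw [assemble_none _ h]
      have h2 : Equiv.Perm.ofSubtype σ j = σ ⟨j, h⟩ := Equiv.Perm.ofSubtype_apply_of_mem σ h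
      rw [h2, assemble_none z' (σ ⟨j, h⟩).2]
      rfl
    | some b =>
      rw [Equiv.Perm.ofSubtype_apply_of_not_mem σ (by simp [h]), assemble_some _ h,
        assemble_some _ h]
  refine ⟨fun π x => if h : ∃ z : {j // π j = none} → Bool, hammingWeight z = x then
    F (assemble π h.choose) else 0, fun π z => ?_⟩
  have hex : ∃ z' : {j // π j = none} → Bool, hammingWeight z' = hammingWeight z := ⟨z, rfl⟩
  refine Eq.trans ?_ (dif_pos hex).symm
  exact key π _ _ hex.choose_spec.symm

end Pattern

/-! ### Queries -/

section Query

variable {k n : ℕ} {h : (Fin k → Bool) → Bool}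

lemma mem_weights_iff (hsymm : IsSymmetric h) (x : Fin k → Bool) :
    weight x ∈ weights h ↔ h x = true := by
  simp only [weights, Finset.mem_image, Finset.mem_filter, Finset.mem_univ, true_and]
  constructor
  · rintro ⟨y, hy, hxy⟩
    obtain ⟨σ, rfl⟩ := exists_perm_of_hammingWeight_eq hxy
    rwa [hsymm] at hy
  · exact fun hx => ⟨x, hx, rfl⟩

/-- The increasing enumeration of a `k`-subset. -/
def enum (A : KSubset n k) : Fin k → Fin n := A.1.orderEmbOfFin A.2

lemma enum_injective (A : KSubset n k) : Function.Injective (enum A) :=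
  (A.1.orderEmbOfFin A.2).injective

lemma image_enum (A : KSubset n k) : Finset.univ.image (enum A) = A.1 :=
  Finset.image_orderEmbOfFin_univ A.1 A.2

lemma enum_mem (A : KSubset n k) (j : Fin k) : enum A j ∈ A.1 :=
  Finset.orderEmbOfFin_mem A.1 A.2 j

lemma card_filter_enum (A : KSubset n k) (S : Finset (Fin n)) :
    #{j | enum A j ∈ S} = #(A.1 ∩ S) := by
  rw [← Finset.card_image_of_injective _ (enum_injective A)]
  congr 1
  ext a
  simp only [Finset.mem_image, Finset.mem_filter, Finset.mem_univ, true_and, Finset.mem_inter]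
  constructor
  · rintro ⟨j, hj, rfl⟩
    exact ⟨enum_mem A j, hj⟩
  · rintro ⟨ha, haS⟩
    rw [← image_enum A, Finset.mem_image] at ha
    obtain ⟨j, -, rfl⟩ := ha
    exact ⟨j, haS, rfl⟩

lemma hiddenFun_eq_true_iff (hsymm : IsSymmetric h) (A : KSubset n k) (S : Finset (Fin n)) :
    hiddenFun h A S = true ↔ #(A.1 ∩ S) ∈ weights h := by
  rw [hiddenFun, ← mem_weights_iff hsymm, ← card_filter_enum, weight]
  simp only [decide_eq_true_eq]
  rfl

lemma hiddenFun_eq_false_iff (hsymm : IsSymmetric h) (A : KSubset n k) (S : Finset (Fin n)) :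
    hiddenFun h A S = false ↔ #(A.1 ∩ S) ∉ weights h := by
  rw [← hiddenFun_eq_true_iff hsymm, Bool.not_eq_true]

lemma norm_queryBlock_le_iff (hsymm : IsSymmetric h) (Γ : Matrix (KSubset n k) (KSubset n k) ℝ)
    (S : Finset (Fin n)) {c : ℝ} (hc : 0 ≤ c) :
    ‖queryBlock h Γ S‖ ≤ c ↔ ∀ f g : KSubset n k → ℝ,
      (∀ A : KSubset n k, #(A.1 ∩ S) ∈ weights h → f A = 0) →
      (∀ A : KSubset n k, #(A.1 ∩ S) ∉ weights h → g A = 0) →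
        |f ⬝ᵥ Γ *ᵥ g| ≤ c * (l2 f * l2 g) := by
  rw [queryBlock, norm_submatrix_le_iff Γ hc]
  simp only [hiddenFun_eq_true_iff hsymm, hiddenFun_eq_false_iff hsymm, not_not]

lemma norm_krawtchoukBlock_le_iff (d : Fin (k + 1) → ℝ) (m t : ℕ) (p : ℝ) {c : ℝ} (hc : 0 ≤ c) :
    ‖krawtchoukBlock h d m p t‖ ≤ c ↔ ∀ f g : Fin (m + 1) → ℝ,
      (∀ x : Fin (m + 1), (x : ℕ) + t ∈ weights h → f x = 0) →
      (∀ x : Fin (m + 1), (x : ℕ) + t ∉ weights h → g x = 0) →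
        |f ⬝ᵥ krawtchoukMatrix d m p *ᵥ g| ≤ c * (l2 f * l2 g) := by
  have := norm_submatrix_le_iff (P := fun x => x ∈ W₀ h m t) (Q := fun x => x ∈ W₁ h m t)
    (krawtchoukMatrix d m p) hc
  rw [krawtchoukBlock]
  refine this.trans ?_
  simp [W₀, W₁]

end Query

/-- Extension of a list by zeros. -/
def extendList {k : ℕ} (d : Fin (k + 1) → ℝ) : ℕ → ℝ := fun i => if h : i < k + 1 then d ⟨i, h⟩ else 0

lemma krawtchoukMatrix_eq {k : ℕ} (d : Fin (k + 1) → ℝ) {m : ℕ} (hm : m ≤ k) (p : ℝ) :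
    krawtchoukMatrix d m p = krawMatrix m p fun i => extendList d (i + (k - m)) := by
  rw [krawtchoukMatrix, krawMatrix, ← Finset.sum_range_reflect]
  refine Finset.sum_congr rfl fun j hj => ?_
  have hj' : j ≤ m := Nat.lt_succ_iff.1 (Finset.mem_range.1 hj)
  have e1 : m - (m + 1 - 1 - j) = j := by omega
  have e2 : k - (m + 1 - 1 - j) = j + (k - m) := by omega
  have e3 : j + (k - m) < k + 1 := by omega
  rw [e1]
  congr 1
  rw [extendList, dif_pos e3]
  congr 1
  ext1
  exact e2

/-! ### The embedding of `k`-subsets into tensors -/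

section Embedding

variable {k n : ℕ}

lemma exists_enum_comp_eq {a : Fin k → Fin n} (hinj : Function.Injective a) :
    ∃ (A : KSubset n k) (σ : Equiv.Perm (Fin k)), enum A ∘ σ = a := by
  have hcard : #(Finset.univ.image a) = k := by
    rw [Finset.card_image_of_injective _ hinj, Finset.card_univ, Fintype.card_fin]
  set A : KSubset n k := ⟨Finset.univ.image a, hcard⟩ with hA
  have hex : ∀ j, ∃ i, enum A i = a j := by
    intro j
    have : a j ∈ Finset.univ.image (enum A) := by
      rw [image_enum]; exact Finset.mem_image_of_mem _ (Finset.mem_univ _)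
    simpa using this
  choose s hs using hex
  have hsinj : Function.Injective s := by
    intro i j hij
    apply hinj
    rw [← hs, ← hs, hij]
  exact ⟨A, Equiv.ofBijective s (Finite.injective_iff_bijective.1 hsinj), funext hs⟩

/-- An injective word is the same as its set of letters together with an ordering of it. -/
lemma sum_injective (F : (Fin k → Fin n) → ℝ) (hF : ∀ a, ¬ Function.Injective a → F a = 0) :
    ∑ a, F a = ∑ A : KSubset n k, ∑ σ : Equiv.Perm (Fin k), F (enum A ∘ σ) := by
  rw [← Fintype.sum_prod_type' (fun (A : KSubset n k) (σ : Equiv.Perm (Fin k)) => F (enum A ∘ σ))]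
  symm
  refine Finset.sum_of_injOn (fun q : KSubset n k × Equiv.Perm (Fin k) => enum q.1 ∘ q.2)
    ?_ (by simp) ?_ (fun _ _ => rfl)
  · rintro ⟨A, σ⟩ - ⟨B, τ⟩ - H
    simp only at H
    have hAB : A = B := by
      ext1
      rw [← image_enum A, ← image_enum B]
      have e : ∀ (A : KSubset n k) (σ : Equiv.Perm (Fin k)),
          Finset.univ.image (enum A) = Finset.univ.image (enum A ∘ σ) := by
        intro A σ
        rw [← Finset.image_image, Finset.image_univ_equiv]
      rw [e A σ, e B τ, H]
    subst hAB
    congr 1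
    ext1 j
    exact enum_injective A (congrFun H j)
  · intro a _ ha
    refine hF a fun hinj => ha ?_
    obtain ⟨A, σ, rfl⟩ := exists_enum_comp_eq hinj
    exact ⟨(A, σ), by simp, rfl⟩

/-- The isometry that maps a `k`-subset to the normalised sum of its enumerations. -/
noncomputable def embedMatrix (n k : ℕ) : Matrix (Fin k → Fin n) (KSubset n k) ℝ :=
  Matrix.of fun a A => if Finset.univ.image a = A.1 then (√(k.factorial : ℝ))⁻¹ else 0

lemma embedMatrix_eq_zero {a : Fin k → Fin n} (ha : ¬ Function.Injective a) (A : KSubset n k) :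
    embedMatrix n k a A = 0 := by
  rw [embedMatrix, of_apply, if_neg]
  intro hA
  have h2 : #(Finset.univ.image a) = #(Finset.univ : Finset (Fin k)) := by
    rw [hA, A.2, Finset.card_univ, Fintype.card_fin]
  refine ha fun i j hij => ?_
  exact Finset.card_image_iff.1 h2 (by simp) (by simp) hij

lemma image_enum_comp (A : KSubset n k) (σ : Equiv.Perm (Fin k)) :
    Finset.univ.image (enum A ∘ σ) = A.1 := by
  rw [← Finset.image_image, Finset.image_univ_equiv, image_enum]

lemma embedMatrix_enum (A B : KSubset n k) (σ : Equiv.Perm (Fin k)) :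
    embedMatrix n k (enum A ∘ σ) B = if A = B then (√(k.factorial : ℝ))⁻¹ else 0 := by
  simp only [embedMatrix, of_apply, image_enum_comp, Subtype.ext_iff]

lemma sqrt_factorial_pos (k : ℕ) : 0 < √(k.factorial : ℝ) :=
  Real.sqrt_pos.2 (by exact_mod_cast k.factorial_pos)

lemma embedMatrix_isometry : (embedMatrix n k)ᵀ * embedMatrix n k = 1 := by
  ext A B
  rw [Matrix.mul_apply, sum_injective]
  · simp only [transpose_apply, embedMatrix_enum, Finset.sum_const, Finset.card_univ,
      Fintype.card_perm, Fintype.card_fin, nsmul_eq_mul]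
    rw [Finset.sum_eq_single A]
    · rw [if_pos rfl, Matrix.one_apply]
      split_ifs
      · have := Real.mul_self_sqrt (show (0 : ℝ) ≤ k.factorial by positivity)
        have h2 := sqrt_factorial_pos k
        field_simp
        rw [sq, this]
      · simp
    · intro C _ hC; simp [hC]
    · simp
  · intro a ha
    rw [embedMatrix_eq_zero ha, mul_zero]

lemma embedMatrix_mulVec_enum (x : KSubset n k → ℝ) (A : KSubset n k) (σ : Equiv.Perm (Fin k)) :
    (embedMatrix n k *ᵥ x) (enum A ∘ σ) = (√(k.factorial : ℝ))⁻¹ * x A := by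
  simp [mulVec, dotProduct, embedMatrix_enum]

lemma embedMatrix_mulVec_not_injective (x : KSubset n k → ℝ) {a : Fin k → Fin n}
    (ha : ¬ Function.Injective a) : (embedMatrix n k *ᵥ x) a = 0 := by
  simp [mulVec, dotProduct, embedMatrix_eq_zero ha]

lemma embedMatrix_comp_perm (a : Fin k → Fin n) (σ : Equiv.Perm (Fin k)) (A : KSubset n k) :
    embedMatrix n k (a ∘ σ) A = embedMatrix n k a A := by
  simp only [embedMatrix, of_apply]
  rw [← Finset.image_image, Finset.image_univ_equiv]

lemma embedMatrix_mulVec_comp_perm (x : KSubset n k → ℝ) (σ : Equiv.Perm (Fin k))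
    (a : Fin k → Fin n) : (embedMatrix n k *ᵥ x) (a ∘ σ) = (embedMatrix n k *ᵥ x) a := by
  simp [mulVec, dotProduct, embedMatrix_comp_perm]

/-- A tensor is symmetric if it is invariant under permutations of the factors. -/
def IsSymmTensor {κ α : Type*} (y : (κ → α) → ℝ) : Prop :=
  ∀ (σ : Equiv.Perm κ) a, y (a ∘ σ) = y a

lemma IsSymmTensor.tensorMatrix_mulVec {κ α β : Type*} [Fintype κ] [DecidableEq κ] [Fintype β]
    {y : (κ → β) → ℝ} (hy : IsSymmTensor y) (X : Matrix α β ℝ) :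
    IsSymmTensor ((tensorMatrix fun _ : κ => X) *ᵥ y) := by
  intro σ a
  simp only [mulVec, dotProduct, tensorMatrix_apply]
  refine Fintype.sum_equiv (Equiv.arrowCongr σ (Equiv.refl β)) _ _ fun z => ?_
  have e : (Equiv.arrowCongr σ (Equiv.refl β)) z = z ∘ σ.symm := by
    ext j; simp [Equiv.arrowCongr]
  rw [e, hy]
  congr 1
  refine Fintype.prod_equiv σ _ _ fun j => ?_
  simp

lemma embedMatrix_transpose_mulVec {y : (Fin k → Fin n) → ℝ} (hy : IsSymmTensor y)
    (A : KSubset n k) : ((embedMatrix n k)ᵀ *ᵥ y) A = √(k.factorial : ℝ) * y (enum A) := by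
  rw [mulVec, dotProduct, sum_injective]
  · simp only [transpose_apply, embedMatrix_enum, hy _ _, Finset.sum_const, Finset.card_univ,
      Fintype.card_perm, Fintype.card_fin, nsmul_eq_mul]
    rw [Finset.sum_eq_single A]
    · have := Real.mul_self_sqrt (show (0 : ℝ) ≤ k.factorial by positivity)
      have h2 := sqrt_factorial_pos k
      rw [if_pos rfl]
      field_simp
      rw [sq, this]
    · intro C _ hC; simp [hC]
    · simp
  · intro a ha
    rw [transpose_apply, embedMatrix_eq_zero ha, zero_mul]

/-- Projecting a symmetric tensor to the `k`-subsets only erases its entries at words with repeated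
letters, so the loss is a matter of counting collisions. -/
lemma embedMatrix_mul_transpose_mulVec {y : (Fin k → Fin n) → ℝ} (hy : IsSymmTensor y)
    (a : Fin k → Fin n) [Decidable (Function.Injective a)] :
    (embedMatrix n k *ᵥ ((embedMatrix n k)ᵀ *ᵥ y)) a = if Function.Injective a then y a else 0 := by
  split_ifs with ha
  · obtain ⟨A, σ, rfl⟩ := exists_enum_comp_eq ha
    rw [embedMatrix_mulVec_enum, embedMatrix_transpose_mulVec hy,
      inv_mul_cancel_left₀ (sqrt_factorial_pos k).ne', hy]
  · exact embedMatrix_mulVec_not_injective _ ha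

end Embedding

/-! ### Symmetric matrices on `k`-subsets from lists of numbers -/

section Learn

variable {k n : ℕ}

lemma abs_extendList_le (d : Fin (k + 1) → ℝ) (i : ℕ) : |extendList d i| ≤ ‖d‖ := by
  rw [extendList]
  split_ifs with h
  · exact norm_le_pi_norm d ⟨i, h⟩
  · simp

/-- The unit vector with equal entries. -/
noncomputable def uniformVec (n : ℕ) : Fin n → ℝ := fun _ => (√(n : ℝ))⁻¹

lemma uniformVec_dotProduct_self (hn : 0 < n) : uniformVec n ⬝ᵥ uniformVec n = 1 := by
  have hn' : (0 : ℝ) < n := by exact_mod_cast hn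
  have := Real.mul_self_sqrt hn'.le
  simp only [dotProduct, uniformVec, Finset.sum_const, Finset.card_univ, Fintype.card_fin,
    nsmul_eq_mul]
  rw [← mul_inv, this, mul_inv_cancel₀ hn'.ne']

/-- The matrix on `k`-subsets with approximate eigenvalues `d`. -/
noncomputable def learnMatrix (n k : ℕ) (d : ℕ → ℝ) : Matrix (KSubset n k) (KSubset n k) ℝ :=
  (embedMatrix n k)ᵀ * tensorOp (Fin k) (uniformVec n) d * embedMatrix n k

lemma learnMatrix_bilin (d : ℕ → ℝ) (x x' : KSubset n k → ℝ) :
    x ⬝ᵥ learnMatrix n k d *ᵥ x' =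
      (embedMatrix n k *ᵥ x) ⬝ᵥ tensorOp (Fin k) (uniformVec n) d *ᵥ (embedMatrix n k *ᵥ x') := by
  rw [mulVec_bilin, learnMatrix]

lemma learnMatrix_apply (d : ℕ → ℝ) (A B : KSubset n k) :
    learnMatrix n k d A B = (k.factorial : ℝ)⁻¹ * ∑ σ : Equiv.Perm (Fin k),
      ∑ τ : Equiv.Perm (Fin k),
        tensorOp (Fin k) (uniformVec n) d (enum A ∘ σ) (enum B ∘ τ) := by
  have h := learnMatrix_bilin d (Pi.single A 1) (Pi.single B 1)
  have e : Pi.single A 1 ⬝ᵥ learnMatrix n k d *ᵥ Pi.single B 1 = learnMatrix n k d A B := by simp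
  rw [← e, h, dotProduct, sum_injective]
  · rw [Finset.sum_eq_single A]
    · rw [Finset.mul_sum]
      refine Finset.sum_congr rfl fun σ _ => ?_
      rw [embedMatrix_mulVec_enum, mulVec, dotProduct, sum_injective]
      · rw [Finset.sum_eq_single B]
        · simp only [embedMatrix_mulVec_enum, Pi.single_eq_same, mul_one]
          rw [← Finset.sum_mul, mul_comm, mul_assoc, ← mul_inv,
            Real.mul_self_sqrt (by positivity), mul_comm]
        · intro C _ hC; simp [embedMatrix_mulVec_enum, hC]
        · simp
      · intro a ha
        rw [embedMatrix_mulVec_not_injective _ ha, mul_zero]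
    · intro C _ hC; simp [embedMatrix_mulVec_enum, hC]
    · simp
  · intro a ha
    rw [embedMatrix_mulVec_not_injective _ ha, zero_mul]

lemma tensorOp_isSymm {κ α : Type*} [Fintype κ] [DecidableEq κ] [DecidableEq α] (v : α → ℝ)
    (d : ℕ → ℝ) : (tensorOp κ v d).IsSymm := by
  ext a b
  rw [transpose_apply, tensorOp_apply, tensorOp_apply]
  simp only [mul_comm, eq_comm]

lemma learnMatrix_isSymm (d : ℕ → ℝ) : (learnMatrix n k d).IsSymm := by
  rw [IsSymm, learnMatrix, transpose_mul, transpose_mul, transpose_transpose,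
    (tensorOp_isSymm _ _).eq, Matrix.mul_assoc]

/-! #### The diagonal -/

/-- The diagonal entry of `learnMatrix n k d` as a polynomial in `d` and `ε = 1 / n`. -/
noncomputable def diagEntry (k : ℕ) (d : ℕ → ℝ) (ε : ℝ) : ℝ :=
  (k.factorial : ℝ)⁻¹ * ∑ σ : Equiv.Perm (Fin k), ∑ τ : Equiv.Perm (Fin k),
    ∑ I : Finset (Fin k), d #I * ∏ j, if j ∈ I then (if σ j = τ j then 1 else 0) - ε else ε

/-- The diagonal is constant, so subtracting a multiple of the identity makes it zero. It depends on
`n` only through `1 / n`, so its limit is found by continuity at `0`. -/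
lemma learnMatrix_diag (d : ℕ → ℝ) (A : KSubset n k) :
    learnMatrix n k d A A = diagEntry k d (n : ℝ)⁻¹ := by
  have hu : (√(n : ℝ))⁻¹ * (√(n : ℝ))⁻¹ = (n : ℝ)⁻¹ := by
    rw [← mul_inv, Real.mul_self_sqrt (by positivity)]
  rw [learnMatrix_apply, diagEntry]
  congr 1
  refine Finset.sum_congr rfl fun σ _ => Finset.sum_congr rfl fun τ _ => ?_
  rw [tensorOp_apply]
  simp only [uniformVec, hu, Function.comp_apply, (enum_injective A).eq_iff]

/-- At `ε = 0` only the full set `I` survives, and then only `σ = τ`. This is the origin of the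
constraint `d_k = 0`. -/
lemma diagEntry_zero (k : ℕ) (d : ℕ → ℝ) : diagEntry k d 0 = d k := by
  have h1 : ∀ σ τ : Equiv.Perm (Fin k), (∑ I : Finset (Fin k), d #I *
      ∏ j, if j ∈ I then (if σ j = τ j then (1 : ℝ) else 0) - 0 else 0) =
        if σ = τ then d k else 0 := by
    intro σ τ
    rw [Finset.sum_eq_single Finset.univ]
    · simp only [Finset.mem_univ, if_true, sub_zero, Finset.card_univ, Fintype.card_fin]
      split_ifs with h
      · subst h; simp
      · obtain ⟨j, hj⟩ : ∃ j, σ j ≠ τ j := by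
          by_contra! hcon; exact h (Equiv.ext hcon)
        rw [Finset.prod_eq_zero (Finset.mem_univ j), mul_zero]
        simp [hj]
    · intro I _ hI
      obtain ⟨j, hj⟩ : ∃ j, j ∉ I := by
        by_contra! hcon; exact hI (Finset.eq_univ_iff_forall.2 hcon)
      rw [Finset.prod_eq_zero (Finset.mem_univ j), mul_zero]
      simp [hj]
    · simp
  simp only [diagEntry, h1, Finset.sum_ite_eq, Finset.mem_univ, if_true, Finset.sum_const,
    Finset.card_univ, Fintype.card_perm, Fintype.card_fin, nsmul_eq_mul]
  rw [inv_mul_cancel_left₀ (by exact_mod_cast k.factorial_ne_zero)]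

lemma continuous_diagEntry (k : ℕ) :
    Continuous fun q : (ℕ → ℝ) × ℝ => diagEntry k q.1 q.2 := by
  unfold diagEntry
  refine continuous_const.mul (continuous_finsetSum _ fun σ _ => continuous_finsetSum _ fun τ _ =>
    continuous_finsetSum _ fun I _ => ?_)
  refine ((continuous_apply _).comp continuous_fst).mul (continuous_finsetProd _ fun j _ => ?_)
  split_ifs <;> fun_prop

/-! #### Collisions are rare -/

/-- The proportion of the words of length `k` with repeated letters. -/
noncomputable def collision (n k : ℕ) : ℝ := 1 - (n.descFactorial k : ℝ) / (n : ℝ) ^ k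

lemma collision_nonneg (n k : ℕ) : 0 ≤ collision n k := by
  rw [collision, sub_nonneg]
  refine div_le_one_of_le₀ ?_ (by positivity)
  exact_mod_cast Nat.descFactorial_le_pow n k

lemma tendsto_collision (k : ℕ) : Tendsto (fun n => collision n k) atTop (𝓝 0) := by
  have h1 : Tendsto (fun n : ℕ => (1 - (k : ℝ) / n) ^ k) atTop (𝓝 1) := by
    have := ((tendsto_const_div_atTop_nhds_zero_nat (k : ℝ)).const_sub 1).pow k
    simpa using this
  have h2 : Tendsto (fun n : ℕ => (n.descFactorial k : ℝ) / (n : ℝ) ^ k) atTop (𝓝 1) := by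
    refine tendsto_of_tendsto_of_tendsto_of_le_of_le' h1 tendsto_const_nhds ?_ ?_
    · filter_upwards [eventually_ge_atTop (k + 1)] with n hn
      have hn0 : (0 : ℝ) < n := by exact_mod_cast (show 0 < n by omega)
      have : 1 - (k : ℝ) / n = (n - k) / n := by field_simp
      rw [this, div_pow]
      gcongr
      have h3 := Nat.pow_sub_le_descFactorial n k
      have h4 : ((n - k : ℕ) : ℝ) ^ k ≤ (n.descFactorial k : ℝ) := by
        have h5 : ((n + 1 - k : ℕ) : ℝ) ^ k ≤ (n.descFactorial k : ℝ) := by exact_mod_cast h3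
        refine le_trans ?_ h5
        gcongr
        omega
      rwa [Nat.cast_sub (by omega)] at h4
    · refine Filter.Eventually.of_forall fun n => div_le_one_of_le₀ ?_ (by positivity)
      exact_mod_cast Nat.descFactorial_le_pow n k
  have := h2.const_sub 1
  simpa [collision] using this

lemma card_KSubset : (Fintype.card (KSubset n k) : ℝ) * k.factorial = n.descFactorial k := by
  have : Fintype.card (KSubset n k) = n.choose k := by
    rw [Fintype.card_finset_len, Fintype.card_fin]
  rw [this, Nat.descFactorial_eq_factorial_mul_choose]
  push_cast; ring

/-- The difference lives on the non-injective words. There are `n ^ k * collision n k` of these,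
each carrying mass at most `B ^ 2 / n ^ k`. -/
lemma l2_collision_le {y : (Fin k → Fin n) → ℝ} (hy : IsSymmTensor y) {B : ℝ} (hB : 0 ≤ B)
    (hn : 0 < n) (hyB : ∀ a, y a ^ 2 ≤ B ^ 2 / (n : ℝ) ^ k) :
    l2 (y - embedMatrix n k *ᵥ ((embedMatrix n k)ᵀ *ᵥ y)) ≤ B * √(collision n k) := by
  classical
  rw [← abs_of_nonneg (l2_nonneg _), ← abs_of_nonneg (mul_nonneg hB (Real.sqrt_nonneg _)),
    ← sq_le_sq, l2_sq, mul_pow, Real.sq_sqrt (collision_nonneg n k)]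
  have hn0 : (0 : ℝ) < n := by exact_mod_cast hn
  have h1 : ∀ a, (y - embedMatrix n k *ᵥ ((embedMatrix n k)ᵀ *ᵥ y)) a =
      if Function.Injective a then 0 else y a := by
    intro a
    rw [Pi.sub_apply, embedMatrix_mul_transpose_mulVec hy]
    split_ifs <;> simp
  have h2 : ∑ a : Fin k → Fin n, (if Function.Injective a then (1 : ℝ) else 0) =
      n.descFactorial k := by
    rw [sum_injective _ (by intro a ha; simp [ha]), ← card_KSubset]
    have : ∀ (A : KSubset n k) (σ : Equiv.Perm (Fin k)), Function.Injective (enum A ∘ σ) :=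
      fun A σ => (enum_injective A).comp σ.injective
    simp [this, Fintype.card_perm]
  calc _ ≤ ∑ a : Fin k → Fin n, (1 - if Function.Injective a then (1 : ℝ) else 0) *
        (B ^ 2 / (n : ℝ) ^ k) := by
        rw [dotProduct]
        refine Finset.sum_le_sum fun a _ => ?_
        rw [h1]
        split_ifs
        · simp
        · simpa [← sq] using hyB a
    _ = _ := by
        rw [← Finset.sum_mul, Finset.sum_sub_distrib, h2, collision]
        simp only [Finset.sum_const, Finset.card_univ, Fintype.card_fun, Fintype.card_fin,
          nsmul_eq_mul, Nat.cast_pow, mul_one]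
        field_simp

lemma l2_embedMatrix_transpose_mulVec_le (y : (Fin k → Fin n) → ℝ) :
    l2 ((embedMatrix n k)ᵀ *ᵥ y) ≤ l2 y := by
  have h1 := abs_dotProduct_le y (embedMatrix n k *ᵥ ((embedMatrix n k)ᵀ *ᵥ y))
  rw [dotProduct_mulVec, ← mulVec_transpose, ← l2_sq, abs_of_nonneg (sq_nonneg _),
    l2_mulVec_isometry embedMatrix_isometry] at h1
  rcases (l2_nonneg ((embedMatrix n k)ᵀ *ᵥ y)).eq_or_lt with h0 | h0
  · rw [← h0]; exact l2_nonneg _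
  · exact le_of_mul_le_mul_right (by rw [← sq]; exact h1) h0

/-- On symmetric tensors with small entries, `learnMatrix` is close to `tensorOp`. -/
lemma abs_learnMatrix_sub_tensorOp_le (hn : 0 < n) {y y' : (Fin k → Fin n) → ℝ}
    (hy : IsSymmTensor y) (hy' : IsSymmTensor y') {B : ℝ} (hB : 0 ≤ B)
    (hyB : ∀ a, y a ^ 2 ≤ B ^ 2 / (n : ℝ) ^ k) (hyB' : ∀ a, y' a ^ 2 ≤ B ^ 2 / (n : ℝ) ^ k)
    {d : ℕ → ℝ} {D : ℝ} (hd : ∀ i ≤ k, |d i| ≤ D) :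
    |((embedMatrix n k)ᵀ *ᵥ y) ⬝ᵥ learnMatrix n k d *ᵥ ((embedMatrix n k)ᵀ *ᵥ y') -
      y ⬝ᵥ tensorOp (Fin k) (uniformVec n) d *ᵥ y'| ≤
        2 ^ k * D * (B * √(collision n k) * (l2 y + l2 y')) := by
  set V := embedMatrix n k with hV
  set T := tensorOp (Fin k) (uniformVec n) d with hT
  have hTb : ∀ f g, |f ⬝ᵥ T *ᵥ g| ≤ 2 ^ k * D * (l2 f * l2 g) := by
    intro f g
    have := abs_tensorOp_bilin_le (κ := Fin k) (uniformVec_dotProduct_self hn) (d := d) (D := D)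
      (by simpa using hd) f g
    simpa using this
  have hD : 0 ≤ D := (abs_nonneg _).trans (hd 0 (Nat.zero_le _))
  have hle : l2 (V *ᵥ (Vᵀ *ᵥ y)) ≤ l2 y := by
    rw [l2_mulVec_isometry embedMatrix_isometry]
    exact l2_embedMatrix_transpose_mulVec_le y
  rw [learnMatrix_bilin, ← hV, ← hT]
  have e : (V *ᵥ (Vᵀ *ᵥ y)) ⬝ᵥ T *ᵥ (V *ᵥ (Vᵀ *ᵥ y')) - y ⬝ᵥ T *ᵥ y' =
      -((y - V *ᵥ (Vᵀ *ᵥ y)) ⬝ᵥ T *ᵥ y') -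
        (V *ᵥ (Vᵀ *ᵥ y)) ⬝ᵥ T *ᵥ (y' - V *ᵥ (Vᵀ *ᵥ y')) := by
    rw [sub_dotProduct, mulVec_sub, dotProduct_sub]; ring
  rw [e]
  have c1 := l2_collision_le hy hB hn hyB
  have c2 := l2_collision_le hy' hB hn hyB'
  have b1 := hTb (y - V *ᵥ (Vᵀ *ᵥ y)) y'
  have b2 := hTb (V *ᵥ (Vᵀ *ᵥ y)) (y' - V *ᵥ (Vᵀ *ᵥ y'))
  have m1 : l2 (y - V *ᵥ (Vᵀ *ᵥ y)) * l2 y' ≤ B * √(collision n k) * l2 y' :=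
    mul_le_mul_of_nonneg_right c1 (l2_nonneg _)
  have m2 : l2 (V *ᵥ (Vᵀ *ᵥ y)) * l2 (y' - V *ᵥ (Vᵀ *ᵥ y')) ≤ l2 y * (B * √(collision n k)) :=
    mul_le_mul hle c2 (l2_nonneg _) (l2_nonneg _)
  have hc : 0 ≤ 2 ^ k * D := by positivity
  have m1' := mul_le_mul_of_nonneg_left m1 hc
  have m2' := mul_le_mul_of_nonneg_left m2 hc
  calc _ ≤ |(y - V *ᵥ (Vᵀ *ᵥ y)) ⬝ᵥ T *ᵥ y'| +
        |(V *ᵥ (Vᵀ *ᵥ y)) ⬝ᵥ T *ᵥ (y' - V *ᵥ (Vᵀ *ᵥ y'))| := by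
        refine (abs_sub _ _).trans ?_
        rw [abs_neg]
    _ ≤ _ := by linarith

/-- The mean of the row sums of `learnMatrix n k d` is close to `d 0`. -/
lemma abs_sum_learnMatrix_sub_le (hn : 0 < n) {d : ℕ → ℝ} {D : ℝ} (hd : ∀ i ≤ k, |d i| ≤ D)
    {l : ℝ} (hl : (fun _ => 1) ⬝ᵥ learnMatrix n k d *ᵥ (fun _ => 1) =
      l * Fintype.card (KSubset n k)) :
    |l * (1 - collision n k) - d 0| ≤ 2 ^ k * D * (√(collision n k) * 2) := by
  have hn0 : (0 : ℝ) < n := by exact_mod_cast hn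
  -- This is the tensor power of the uniform vector, on which the quadratic form of `tensorOp` is `d
  -- 0`; its compression is proportional to the all-ones vector.
  set y : (Fin k → Fin n) → ℝ := fun _ => (√(n : ℝ))⁻¹ ^ k with hy
  have hsq : ((√(n : ℝ))⁻¹ ^ k) ^ 2 = 1 / (n : ℝ) ^ k := by
    rw [← pow_mul, mul_comm, pow_mul, inv_pow, Real.sq_sqrt hn0.le, inv_pow, one_div]
  have hsymm : IsSymmTensor y := fun _ _ => rfl
  have hl2 : l2 y = 1 := by
    rw [l2, dotProduct]
    simp only [hy, ← sq, hsq, Finset.sum_const, Finset.card_univ, Fintype.card_fun,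
      Fintype.card_fin, nsmul_eq_mul, Nat.cast_pow]
    rw [mul_one_div_cancel (by positivity), Real.sqrt_one]
  have key := abs_learnMatrix_sub_tensorOp_le hn hsymm hsymm (B := 1) zero_le_one
    (fun a => by rw [hy, hsq]; simp) (fun a => by rw [hy, hsq]; simp) hd
  have e1 : (embedMatrix n k)ᵀ *ᵥ y =
      (√(k.factorial : ℝ) * (√(n : ℝ))⁻¹ ^ k) • (fun _ => (1 : ℝ)) := by
    ext A
    rw [embedMatrix_transpose_mulVec hsymm]
    simp [hy]
  have e2 : y ⬝ᵥ tensorOp (Fin k) (uniformVec n) d *ᵥ y = d 0 := by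
    -- Pulling back along the uniform vector, seen as an isometry from `ℝ`, leaves a one-letter
    -- alphabet where `1 - vv* = 0`, so only `I = ∅` remains.
    set X : Matrix (Fin n) Unit ℝ := Matrix.of fun i _ => uniformVec n i with hX
    have hXX : Xᵀ * X = 1 := by
      ext a b
      rw [Matrix.mul_apply]
      simpa [dotProduct, hX] using uniformVec_dotProduct_self hn
    have hy1 : y = (tensorMatrix fun _ : Fin k => X) *ᵥ fun _ => 1 := by
      ext a
      simp [mulVec, dotProduct, tensorMatrix_apply, hX, uniformVec, hy]
    have hv : Xᵀ *ᵥ uniformVec n = fun _ => 1 := by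
      ext a
      simpa [mulVec, dotProduct, hX] using uniformVec_dotProduct_self hn
    rw [hy1, mulVec_bilin, tensorOp_pullback hXX, hv]
    simp only [dotProduct, mulVec, tensorOp_apply]
    rw [Fintype.sum_unique, Fintype.sum_unique, Finset.sum_eq_single ∅]
    · simp
    · intro I _ hI
      obtain ⟨j, hj⟩ := Finset.nonempty_iff_ne_empty.2 hI
      rw [Finset.prod_eq_zero (Finset.mem_univ j), mul_zero]
      simp [hj]
    · simp
  rw [e1, e2, mulVec_smul, smul_dotProduct, dotProduct_smul, hl, hl2] at key
  have e3 : (√(k.factorial : ℝ) * (√(n : ℝ))⁻¹ ^ k) • (√(k.factorial : ℝ) * (√(n : ℝ))⁻¹ ^ k) •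
      (l * (Fintype.card (KSubset n k) : ℝ)) = l * (1 - collision n k) := by
    have h3 := Real.mul_self_sqrt (show (0 : ℝ) ≤ k.factorial by positivity)
    rw [collision, sub_sub_cancel, ← card_KSubset, smul_eq_mul, smul_eq_mul]
    linear_combination (l * (Fintype.card (KSubset n k) : ℝ)) *
      (((√(n : ℝ))⁻¹ ^ k) ^ 2 * h3 + (k.factorial : ℝ) * hsq)
  rw [e3] at key
  refine key.trans (le_of_eq ?_)
  ring

end Learn

/-! ### Every feasible list gives feasible adversary matrices -/

section TypeCount

variable {κ β : Type*} [Fintype κ]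

/-- The number of letters of true type in a pattern. -/
def trueCount (τ : β → Bool) (π : κ → Option β) : ℕ := #{j | (π j).map τ = some true}

lemma card_type_assemble (τ : β → Bool) (π : κ → Option β) (z : {j // π j = none} → Bool) :
    #{j | Sum.elim id τ (assemble π z j) = true} = hammingWeight z + trueCount τ π := by
  classical
  rw [hammingWeight, trueCount, ← Finset.card_map (Function.Embedding.subtype _),
    ← Finset.card_union_of_disjoint]
  · congr 1
    ext j
    cases h : π j with
    | none => simp [assemble_none z h, h]
    | some b => simp [assemble_some z h, h]
  · rw [Finset.disjoint_left]
    intro j hj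
    obtain ⟨i, _, rfl⟩ := Finset.mem_map.1 hj
    have := i.2
    simp [this]

lemma freeCard_add_trueCount_le (τ : β → Bool) (π : κ → Option β) :
    freeCard π + trueCount τ π ≤ Fintype.card κ := by
  classical
  rw [freeCard, trueCount, Fintype.card_subtype, ← Finset.card_union_of_disjoint]
  · exact Finset.card_le_univ _
  · rw [Finset.disjoint_left]
    intro j hj
    have : π j = none := by simpa using hj
    simp [this]

lemma exists_hammingWeight_eq {x : ℕ} (hx : x ≤ Fintype.card κ) :
    ∃ z : κ → Bool, hammingWeight z = x := by
  classical
  obtain ⟨s, -, hs⟩ := Finset.exists_subset_card_eq (s := (Finset.univ : Finset κ)) (n := x)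
    (by simpa using hx)
  exact ⟨fun j => decide (j ∈ s), by simp [hammingWeight, hs]⟩

/-- If a matrix respects types, so does its tensor power. -/
lemma exists_of_tensorMatrix_mulVec_ne_zero {α γ : Type*} [DecidableEq κ] [Fintype γ]
    {X : Matrix α γ ℝ} {τ : α → Bool} {q : γ → Bool} (hX : ∀ x a, X x a ≠ 0 → τ x = q a)
    {f : (κ → γ) → ℝ} {c : κ → α} (hc : ((tensorMatrix fun _ : κ => X) *ᵥ f) c ≠ 0) :
    ∃ a, f a ≠ 0 ∧ #{j | τ (c j) = true} = #{j | q (a j) = true} := by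
  obtain ⟨a, -, ha⟩ := Finset.exists_ne_zero_of_sum_ne_zero hc
  refine ⟨a, right_ne_zero_of_mul ha, ?_⟩
  have h1 := Finset.prod_ne_zero_iff.1 (left_ne_zero_of_mul ha)
  congr 1
  ext j
  simp [hX _ _ (h1 j (Finset.mem_univ j))]

end TypeCount

/-! ### A Parseval frame adapted to a query -/

section Frame

variable {n : ℕ} (q : Fin n → Bool)

/-- The normalised indicator vectors of the two fibres of `q`. -/
noncomputable def fibreMatrix : Matrix Bool (Fin n) ℝ :=
  Matrix.of fun b a => if q a = b then (√(#{a | q a = b} : ℝ))⁻¹ else 0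

/-- The analysis operator of the Parseval frame that consists of the normalised indicator vectors
of the fibres of `q` and the projections of the standard basis orthogonal to them. -/
noncomputable def frameMatrix : Matrix (Bool ⊕ Fin n) (Fin n) ℝ :=
  Matrix.fromRows (fibreMatrix q) (1 - (fibreMatrix q)ᵀ * fibreMatrix q)

variable {q}

lemma fibreMatrix_mul_transpose (hq : Function.Surjective q) :
    fibreMatrix q * (fibreMatrix q)ᵀ = 1 := by
  ext b b'
  rw [Matrix.mul_apply, Matrix.one_apply]
  split_ifs with h
  · subst h
    have hpos : (0 : ℝ) < #{a | q a = b} := by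
      obtain ⟨a, ha⟩ := hq b
      exact_mod_cast Finset.card_pos.2 ⟨a, by simp [ha]⟩
    have h1 : ∀ a, fibreMatrix q b a * (fibreMatrix q)ᵀ a b =
        if q a = b then (#{a | q a = b} : ℝ)⁻¹ else 0 := by
      intro a
      simp only [fibreMatrix, transpose_apply, of_apply]
      split_ifs
      · rw [← mul_inv, Real.mul_self_sqrt hpos.le]
      · simp
    simp only [h1]
    rw [← Finset.sum_filter, Finset.sum_const, nsmul_eq_mul, mul_inv_cancel₀ hpos.ne']
  · refine Finset.sum_eq_zero fun a _ => ?_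
    simp only [fibreMatrix, transpose_apply, of_apply]
    by_cases h1 : q a = b
    · have : q a ≠ b' := fun h2 => h (h1.symm.trans h2)
      simp [this]
    · simp [h1]

/-- With `P` the projection onto the span of the fibre indicators, the Gram matrix is `P + (1 - P)²
= 1`. -/
lemma frameMatrix_isometry (hq : Function.Surjective q) :
    (frameMatrix q)ᵀ * frameMatrix q = 1 := by
  have h1 : (fibreMatrix q)ᵀ * fibreMatrix q * ((fibreMatrix q)ᵀ * fibreMatrix q) =
      (fibreMatrix q)ᵀ * fibreMatrix q := by
    rw [Matrix.mul_assoc, ← Matrix.mul_assoc (fibreMatrix q), fibreMatrix_mul_transpose hq,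
      Matrix.one_mul]
  rw [frameMatrix, transpose_fromRows, fromCols_mul_fromRows, transpose_sub, transpose_one,
    transpose_mul, transpose_transpose, Matrix.sub_mul, Matrix.mul_sub, Matrix.mul_sub, h1]
  simp

/-- The uniform vector lies in the plane of the fibre indicators. Its coordinates there are the
square roots of the relative fibre sizes, which is how `p = |S| / n` enters. -/
lemma fibreMatrix_transpose_mulVec (hq : Function.Surjective q) :
    (fibreMatrix q)ᵀ *ᵥ biasVector ((#{a | q a = true} : ℝ) / n) = uniformVec n := by
  ext a
  have hsum : #{a | q a = true} + #{a | q a = false} = n := by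
    have h1 := Finset.card_filter_add_card_filter_not (s := (Finset.univ : Finset (Fin n)))
      (fun a => q a = true)
    simpa using h1
  have hpos : ∀ b, (0 : ℝ) < #{a | q a = b} := by
    intro b
    obtain ⟨a, ha⟩ := hq b
    exact_mod_cast Finset.card_pos.2 ⟨a, by simp [ha]⟩
  have hn : (0 : ℝ) < n := by
    exact_mod_cast a.pos
  have h2 : 1 - (#{a | q a = true} : ℝ) / n = (#{a | q a = false} : ℝ) / n := by
    have h4 : (#{a | q a = true} : ℝ) + #{a | q a = false} = n := by exact_mod_cast hsum
    rw [← h4]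
    have := hpos true
    have := hpos false
    field_simp
    ring
  have h3 : ∀ b, (√(#{a | q a = b} : ℝ))⁻¹ * √((#{a | q a = b} : ℝ) / n) = (√(n : ℝ))⁻¹ := by
    intro b
    have := Real.sqrt_pos.2 (hpos b)
    rw [Real.sqrt_div (hpos b).le]
    field_simp
  rw [mulVec, dotProduct, Fintype.sum_bool]
  simp only [fibreMatrix, biasVector, transpose_apply, of_apply, h2, uniformVec]
  cases hqa : q a
  · simpa using h3 false
  · simpa using h3 true

lemma frameMatrix_transpose_mulVec (hq : Function.Surjective q) :
    (frameMatrix q)ᵀ *ᵥ Sum.elim (biasVector ((#{a | q a = true} : ℝ) / n)) 0 = uniformVec n := by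
  rw [frameMatrix, transpose_fromRows, fromCols_mulVec_sumElim, fibreMatrix_transpose_mulVec hq]
  simp

/-- Every frame vector is supported in a single fibre of `q`, so the number of letters in `S` can
still be read off after the change of alphabet. -/
lemma frameMatrix_type (x : Bool ⊕ Fin n) (a : Fin n) (hx : frameMatrix q x a ≠ 0) :
    Sum.elim id q x = q a := by
  by_contra hne
  apply hx
  cases x with
  | inl b =>
    have : ¬ q a = b := fun h => hne h.symm
    simp [frameMatrix, fibreMatrix, this]
  | inr c =>
    have hne' : q c ≠ q a := hne
    have hca : c ≠ a := by rintro rfl; exact hne rfl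
    rw [frameMatrix, fromRows_apply_inr, Matrix.sub_apply, Matrix.one_apply_ne hca,
      Matrix.mul_apply, Finset.sum_eq_zero, sub_zero]
    intro b _
    simp only [fibreMatrix, transpose_apply, of_apply]
    by_cases h1 : q c = b
    · have : q a ≠ b := fun h2 => hne' (h1.trans h2.symm)
      simp [this]
    · simp [h1]

end Frame

/-! ### From block constraints to query constraints -/

section Feasible

variable {k n : ℕ} {h : (Fin k → Bool) → Bool}

/-- The estimate is exact for each `n`: the frame for `S` moves the form isometrically to the
alphabet `Bool ⊕ Fin n`, where it is an orthogonal sum over patterns, and each summand is controlled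
by one block constraint with `p = |S| / n`. -/
lemma learnMatrix_query {d : Fin (k + 1) → ℝ} (hd : IsFeasible h d)
    (S : Finset (Fin n)) (f g : KSubset n k → ℝ)
    (hf : ∀ A : KSubset n k, #(A.1 ∩ S) ∈ weights h → f A = 0)
    (hg : ∀ A : KSubset n k, #(A.1 ∩ S) ∉ weights h → g A = 0) :
    |f ⬝ᵥ learnMatrix n k (extendList d) *ᵥ g| ≤ l2 f * l2 g := by
  -- For `S` empty or full, `p` would be `0` or `1`; but then the answer is the same for all `A`, so
  -- `f` or `g` vanishes.
  have hconst : ∀ w, (∀ A : KSubset n k, #(A.1 ∩ S) = w) →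
      |f ⬝ᵥ learnMatrix n k (extendList d) *ᵥ g| ≤ l2 f * l2 g := by
    intro w hw
    by_cases hwW : w ∈ weights h
    · have : f = 0 := funext fun A => hf A (by rwa [hw])
      rw [this]; simpa using mul_nonneg (l2_nonneg _) (l2_nonneg _)
    · have : g = 0 := funext fun A => hg A (by rwa [hw])
      rw [this]; simpa using mul_nonneg (l2_nonneg _) (l2_nonneg _)
  rcases S.eq_empty_or_nonempty with rfl | hS
  · exact hconst 0 fun A => by simp
  by_cases hSu : S = Finset.univ
  · subst hSu
    exact hconst k fun A => by simp [A.2]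
  obtain ⟨a₁, ha₁⟩ := hS
  obtain ⟨a₀, ha₀⟩ : ∃ a, a ∉ S := by
    by_contra! hcon; exact hSu (Finset.eq_univ_iff_forall.2 hcon)
  set q : Fin n → Bool := fun a => decide (a ∈ S) with hq
  have hqs : Function.Surjective q := by
    intro b
    cases b
    · exact ⟨a₀, by simp [hq, ha₀]⟩
    · exact ⟨a₁, by simp [hq, ha₁]⟩
  have hqS : ({a | q a = true} : Finset (Fin n)) = S := by ext a; simp [hq]
  set p : ℝ := (#{a | q a = true} : ℝ) / n with hp
  have hn : (0 : ℝ) < n := by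
    have : 0 < n := a₀.pos
    exact_mod_cast this
  have hp0 : 0 < p := by
    rw [hp, hqS]
    have : (0 : ℝ) < #S := by exact_mod_cast Finset.card_pos.2 ⟨a₁, ha₁⟩
    positivity
  have hp1 : p < 1 := by
    rw [hp, hqS, div_lt_one hn]
    have : #S < Fintype.card (Fin n) := Finset.card_lt_univ_of_notMem ha₀
    rw [Fintype.card_fin] at this
    exact_mod_cast this
  set O := frameMatrix q with hO
  set F : (KSubset n k → ℝ) → (Fin k → Bool ⊕ Fin n) → ℝ := fun f =>
    (tensorMatrix fun _ : Fin k => O) *ᵥ (embedMatrix n k *ᵥ f) with hF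
  have hFsymm : ∀ f, IsSymmTensor (F f) := fun f =>
    IsSymmTensor.tensorMatrix_mulVec (fun σ a => embedMatrix_mulVec_comp_perm f σ a) O
  have hOO : Oᵀ * O = 1 := frameMatrix_isometry hqs
  have hFl2 : ∀ f, l2 (F f) = l2 f := fun f => by
    rw [hF]
    simp only
    rw [l2_mulVec_isometry (tensorMatrix_isometry hOO), l2_mulVec_isometry embedMatrix_isometry]
  have hFT : f ⬝ᵥ learnMatrix n k (extendList d) *ᵥ g =
      F f ⬝ᵥ tensorOp (Fin k) (Sum.elim (biasVector p) 0) (extendList d) *ᵥ F g := by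
    rw [learnMatrix_bilin, hF]
    simp only
    rw [mulVec_bilin (tensorMatrix fun _ : Fin k => O), tensorOp_pullback hOO,
      frameMatrix_transpose_mulVec hqs]
  have hsupp : ∀ (f : KSubset n k → ℝ) (π : Fin k → Option (Fin n)) (z : {j // π j = none} → Bool),
      F f (assemble π z) ≠ 0 →
        ∃ A : KSubset n k, f A ≠ 0 ∧ #(A.1 ∩ S) = hammingWeight z + trueCount q π := by
    intro f π z hne
    obtain ⟨a, ha, hcard⟩ := exists_of_tensorMatrix_mulVec_ne_zero frameMatrix_type hne
    rw [card_type_assemble] at hcard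
    have hinj : Function.Injective a := by
      by_contra hcon; exact ha (embedMatrix_mulVec_not_injective f hcon)
    obtain ⟨A, σ, rfl⟩ := exists_enum_comp_eq hinj
    rw [embedMatrix_mulVec_enum] at ha
    refine ⟨A, right_ne_zero_of_mul ha, ?_⟩
    rw [hcard, ← card_filter_enum]
    symm
    refine Finset.card_bij (fun j _ => σ j) (fun j hj => ?_) (fun _ _ _ _ h => σ.injective h)
      fun j hj => ⟨σ.symm j, ?_, by simp⟩
    · simpa [hq] using hj
    · simpa [hq] using hj
  obtain ⟨φ, hφ⟩ := exists_hammingWeight_of_symm (hFsymm f)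
  obtain ⟨ψ, hψ⟩ := exists_hammingWeight_of_symm (hFsymm g)
  have hφ0 : ∀ (π : Fin k → Option (Fin n)) (x : Fin (freeCard π + 1)),
      (x : ℕ) + trueCount q π ∈ weights h → dicke (freeCard π) (φ π) x = 0 := by
    intro π x hx
    obtain ⟨z, hz⟩ := exists_hammingWeight_eq (κ := {j // π j = none}) (Nat.lt_succ_iff.1 x.2)
    rw [dicke, ← hz, ← hφ]
    by_contra hne
    obtain ⟨A, hA, hAS⟩ := hsupp f π z (right_ne_zero_of_mul hne)
    exact hA (hf A (by rwa [hAS, hz]))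
  have hψ0 : ∀ (π : Fin k → Option (Fin n)) (x : Fin (freeCard π + 1)),
      (x : ℕ) + trueCount q π ∉ weights h → dicke (freeCard π) (ψ π) x = 0 := by
    intro π x hx
    obtain ⟨z, hz⟩ := exists_hammingWeight_eq (κ := {j // π j = none}) (Nat.lt_succ_iff.1 x.2)
    rw [dicke, ← hz, ← hψ]
    by_contra hne
    obtain ⟨A, hA, hAS⟩ := hsupp g π z (right_ne_zero_of_mul hne)
    exact hA (hg A (by rwa [hAS, hz]))
  have hblock : ∀ π : Fin k → Option (Fin n), |dicke (freeCard π) (φ π) ⬝ᵥ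
        krawMatrix (freeCard π) p
          (fun i => extendList d (i + (Fintype.card (Fin k) - freeCard π))) *ᵥ
          dicke (freeCard π) (ψ π)| ≤
      l2 (dicke (freeCard π) (φ π)) * l2 (dicke (freeCard π) (ψ π)) := by
    intro π
    have hle := freeCard_add_trueCount_le q π
    rw [Fintype.card_fin] at hle ⊢
    -- Feasibility says nothing about `m = 0`, but there the matrix is one by one, so its row set or
    -- its column set is empty.
    rcases Nat.eq_zero_or_pos (freeCard π) with hm | hm
    · have hx0 : ∀ x : Fin (freeCard π + 1), (x : ℕ) = 0 := fun x => by
        have := x.2; omega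
      by_cases hW : 0 + trueCount q π ∈ weights h
      · have : dicke (freeCard π) (φ π) = 0 := funext fun x => hφ0 π x (by rwa [hx0])
        rw [this]; simpa using mul_nonneg (l2_nonneg _) (l2_nonneg _)
      · have : dicke (freeCard π) (ψ π) = 0 := funext fun x => hψ0 π x (by rwa [hx0])
        rw [this]; simpa using mul_nonneg (l2_nonneg _) (l2_nonneg _)
    · have hb := (norm_krawtchoukBlock_le_iff d (freeCard π) (trueCount q π) p zero_le_one).1
        (hd.block _ _ hm (by omega) (by omega) p hp0 hp1) _ _ (hφ0 π) (hψ0 π)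
      rwa [krawtchoukMatrix_eq d (by omega), one_mul] at hb
  rw [hFT, tensorOp_bilin_assemble hp0 hp1 _ hφ hψ]
  refine (Finset.abs_sum_le_sum_abs _ _).trans ((Finset.sum_le_sum fun π _ => hblock π).trans ?_)
  -- Cauchy–Schwarz over patterns loses nothing, since the squared norms of the components add up to
  -- those of `f` and `g`.
  refine (Real.sum_mul_le_sqrt_mul_sqrt _ _ _).trans (le_of_eq ?_)
  simp only [l2_sq]
  rw [← dotProduct_assemble hφ hφ, ← dotProduct_assemble hψ hψ, ← hFl2 f, ← hFl2 g, l2, l2]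

/-- A feasible list gives a feasible adversary matrix, after removal of the diagonal. -/
lemma isAdversaryMatrix_learnMatrix (hk : IsSymmetric h) {d : Fin (k + 1) → ℝ}
    (hd : IsFeasible h d) : IsAdversaryMatrix h (n := n)
      (learnMatrix n k (extendList d) - diagEntry k (extendList d) (n : ℝ)⁻¹ • 1) where
  symm := by
    rw [IsSymm, transpose_sub, (learnMatrix_isSymm _).eq, transpose_smul, transpose_one]
  diag A := by simp [learnMatrix_diag]
  query S := by
    rw [norm_queryBlock_le_iff hk _ S zero_le_one]
    intro f g hf hg
    -- The supports of `f` and `g` are disjoint, so a multiple of the identity is invisible to every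
    -- query.
    have h0 : f ⬝ᵥ g = 0 := by
      refine Finset.sum_eq_zero fun A _ => ?_
      by_cases hA : #(A.1 ∩ S) ∈ weights h
      · rw [hf A hA, zero_mul]
      · rw [hg A hA, mul_zero]
    rw [sub_mulVec, smul_mulVec, one_mulVec, dotProduct_sub, dotProduct_smul, h0, smul_zero,
      sub_zero, one_mul]
    exact learnMatrix_query hd S f g hf hg

end Feasible

/-! ### Test vectors -/

section TestTensor

variable {k : ℕ}

lemma pattern_comp_perm {κ β : Type*} (c : κ → Bool ⊕ β) (σ : Equiv.Perm κ) :
    pattern (c ∘ σ) = pattern c ∘ σ := rfl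

lemma freeCard_comp_perm {κ β : Type*} [Fintype κ] [DecidableEq β]
    (π : κ → Option β) (σ : Equiv.Perm κ) : freeCard (π ∘ σ) = freeCard π :=
  Fintype.card_congr (σ.subtypeEquiv fun _ => Iff.rfl)

lemma card_filter_comp_perm {κ : Type*} [Fintype κ] (P : κ → Prop) [DecidablePred P]
    (σ : Equiv.Perm κ) : #{j | P (σ j)} = #{j | P j} := by
  refine Finset.card_bij (fun j _ => σ j) (by simp) (fun _ _ _ _ h => σ.injective h)
    fun j hj => ⟨σ.symm j, ?_, by simp⟩
  simpa using hj

lemma trueCount_comp_perm {κ β : Type*} [Fintype κ] (τ : β → Bool)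
    (π : κ → Option β) (σ : Equiv.Perm κ) : trueCount τ (π ∘ σ) = trueCount τ π :=
  card_filter_comp_perm (fun j => (π j).map τ = some true) σ

/-- The patterns with `m` free positions and `t` letters `true`. -/
def patternClass (k m t : ℕ) : Finset (Fin k → Option Bool) :=
  {π | freeCard π = m ∧ trueCount id π = t}

lemma patternClass_nonempty {m t : ℕ} (hmt : m + t ≤ k) : (patternClass k m t).Nonempty := by
  have hlt : ∀ r ≤ k, #{j : Fin k | (j : ℕ) < r} = r := by
    intro r hr
    rw [Fin.card_filter_val_lt, min_eq_right hr]
  refine ⟨fun j => if (j : ℕ) < m then none else if (j : ℕ) < m + t then some true else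
    some false, ?_⟩
  simp only [patternClass, Finset.mem_filter, Finset.mem_univ, true_and]
  constructor
  · rw [freeCard, Fintype.card_subtype]
    refine Eq.trans ?_ (hlt m (by omega))
    congr 1
    ext j
    simp only [Finset.mem_filter, Finset.mem_univ, true_and]
    split_ifs <;> simp_all
  · have h1 : ({j : Fin k | (j : ℕ) < m + t} : Finset (Fin k)) =
        ({j : Fin k | (j : ℕ) < m} : Finset (Fin k)) ∪
          ({j : Fin k | ((if (j : ℕ) < m then none else if (j : ℕ) < m + t then some true else
            some false : Option Bool)).map id = some true} : Finset (Fin k)) := by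
      ext j
      simp only [Finset.mem_filter, Finset.mem_univ, true_and, Finset.mem_union]
      split_ifs <;> simp_all <;> omega
    have h2 := congrArg Finset.card h1
    rw [hlt _ hmt, Finset.card_union_of_disjoint, hlt m (by omega)] at h2
    · rw [trueCount]; omega
    · rw [Finset.disjoint_left]
      intro j hj
      simp only [Finset.mem_filter, Finset.mem_univ, true_and] at hj
      simp [hj]

/-- The symmetric tensor on four letters that corresponds to a vector in `ℝ^{m+1}`. -/
noncomputable def testTensor (k m t : ℕ) (f : Fin (m + 1) → ℝ) : (Fin k → Bool ⊕ Bool) → ℝ :=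
  fun c => if pattern c ∈ patternClass k m t then
    (√(#(patternClass k m t) : ℝ))⁻¹ * ((√(m.choose #{j | c j = Sum.inl true} : ℝ))⁻¹ *
      if h : #{j | c j = Sum.inl true} < m + 1 then f ⟨_, h⟩ else 0) else 0

/-- The coefficients of `testTensor k m t f` in each pattern. -/
noncomputable def testCoeff (k m t : ℕ) (f : Fin (m + 1) → ℝ) (π : Fin k → Option Bool) (x : ℕ) :
    ℝ :=
  if π ∈ patternClass k m t then
    (√(#(patternClass k m t) : ℝ))⁻¹ * ((√(m.choose x : ℝ))⁻¹ *
      if h : x < m + 1 then f ⟨x, h⟩ else 0) else 0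

lemma testTensor_assemble (m t : ℕ) (f : Fin (m + 1) → ℝ) (π : Fin k → Option Bool)
    (z : {j // π j = none} → Bool) :
    testTensor k m t f (assemble π z) = testCoeff k m t f π (hammingWeight z) := by
  have : #{j | assemble π z j = Sum.inl true} = hammingWeight z := by
    rw [hammingWeight, ← Finset.card_map (Function.Embedding.subtype _)]
    congr 1
    ext j
    cases h : π j with
    | none => simp [assemble_none z h, h]
    | some b => simp [assemble_some z h, h]
  simp only [testTensor, testCoeff, pattern_assemble, this]

lemma testTensor_symm (m t : ℕ) (f : Fin (m + 1) → ℝ) : IsSymmTensor (testTensor k m t f) := by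
  intro σ c
  have h1 : #{j | (c ∘ σ) j = Sum.inl true} = #{j | c j = Sum.inl true} :=
    card_filter_comp_perm (fun j => c j = Sum.inl true) σ
  simp only [testTensor, h1, pattern_comp_perm, patternClass, Finset.mem_filter, Finset.mem_univ,
    true_and, freeCard_comp_perm, trueCount_comp_perm]

lemma dicke_testCoeff (m t : ℕ) (f : Fin (m + 1) → ℝ) {π : Fin k → Option Bool}
    (hπ : π ∈ patternClass k m t) :
    dicke m (testCoeff k m t f π) = (√(#(patternClass k m t) : ℝ))⁻¹ • f := by
  ext x
  have h1 : (0 : ℝ) < m.choose x := by exact_mod_cast Nat.choose_pos (Nat.lt_succ_iff.1 x.2)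
  have h2 := Real.sqrt_pos.2 h1
  simp only [dicke, testCoeff, hπ, if_true, x.2, dif_pos, Pi.smul_apply, smul_eq_mul]
  field_simp

lemma dicke_testCoeff_of_notMem (m t r : ℕ) (f : Fin (m + 1) → ℝ) {π : Fin k → Option Bool}
    (hπ : π ∉ patternClass k m t) : dicke r (testCoeff k m t f π) = 0 := by
  ext x
  simp [dicke, testCoeff, hπ]

lemma sum_patternClass {m t : ℕ} (hmt : m + t ≤ k) (r : ℝ) :
    ∑ π : Fin k → Option Bool, (if π ∈ patternClass k m t then
      (√(#(patternClass k m t) : ℝ))⁻¹ * ((√(#(patternClass k m t) : ℝ))⁻¹ * r) else 0) = r := by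
  have hpos : (0 : ℝ) < #(patternClass k m t) := by
    exact_mod_cast Finset.card_pos.2 (patternClass_nonempty hmt)
  rw [← Finset.sum_filter, Finset.sum_const, nsmul_eq_mul, ← mul_assoc _ _ r, ← mul_inv,
    Real.mul_self_sqrt hpos.le]
  have : #(Finset.filter (fun π => π ∈ patternClass k m t) Finset.univ) =
      #(patternClass k m t) := by congr 1; ext; simp
  rw [this, mul_inv_cancel_left₀ hpos.ne']

lemma testTensor_dotProduct {m t : ℕ} (hmt : m + t ≤ k) (f g : Fin (m + 1) → ℝ) :
    testTensor k m t f ⬝ᵥ testTensor k m t g = f ⬝ᵥ g := by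
  rw [dotProduct_assemble (testTensor_assemble m t f) (testTensor_assemble m t g),
    ← sum_patternClass hmt (f ⬝ᵥ g)]
  refine Finset.sum_congr rfl fun π _ => ?_
  split_ifs with hπ
  · have hm : freeCard π = m := (Finset.mem_filter.1 hπ).2.1
    rw [hm, dicke_testCoeff m t f hπ, dicke_testCoeff m t g hπ, smul_dotProduct, dotProduct_smul,
      smul_eq_mul, smul_eq_mul]
  · rw [dicke_testCoeff_of_notMem _ _ _ f hπ, zero_dotProduct]

/-- The tensor is spread evenly over all patterns of the class, which makes it symmetric. All of
them give the same Krawtchouk form, so their equal shares add up to one copy. -/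
lemma testTensor_bilin {m t : ℕ} (hmt : m + t ≤ k) {p : ℝ} (h0 : 0 < p) (h1 : p < 1)
    (d : ℕ → ℝ) (f g : Fin (m + 1) → ℝ) :
    testTensor k m t f ⬝ᵥ tensorOp (Fin k) (Sum.elim (biasVector p) 0) d *ᵥ testTensor k m t g =
      f ⬝ᵥ krawMatrix m p (fun i => d (i + (k - m))) *ᵥ g := by
  rw [tensorOp_bilin_assemble h0 h1 d (testTensor_assemble m t f) (testTensor_assemble m t g),
    ← sum_patternClass hmt (f ⬝ᵥ krawMatrix m p (fun i => d (i + (k - m))) *ᵥ g)]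
  refine Finset.sum_congr rfl fun π _ => ?_
  split_ifs with hπ
  · have hm : freeCard π = m := (Finset.mem_filter.1 hπ).2.1
    rw [hm, dicke_testCoeff m t f hπ, dicke_testCoeff m t g hπ, smul_dotProduct, mulVec_smul,
      dotProduct_smul, smul_eq_mul, smul_eq_mul, Fintype.card_fin]
  · rw [dicke_testCoeff_of_notMem _ _ _ f hπ, zero_dotProduct]

lemma testTensor_support {m t : ℕ} {f : Fin (m + 1) → ℝ} {c : Fin k → Bool ⊕ Bool}
    (hc : testTensor k m t f c ≠ 0) :
    ∃ l : Fin (m + 1), f l ≠ 0 ∧ #{j | Sum.elim id id (c j) = true} = l + t := by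
  obtain ⟨z, hz⟩ := exists_assemble_eq c
  rw [← hz, testTensor_assemble, testCoeff] at hc
  split_ifs at hc with h1 h2
  · refine ⟨⟨_, h2⟩, right_ne_zero_of_mul (right_ne_zero_of_mul hc), ?_⟩
    have h3 := card_type_assemble id (pattern c) z
    rwa [hz, (Finset.mem_filter.1 h1).2.2] at h3
  · simp at hc
  · simp at hc

end TestTensor

/-- A unit vector orthogonal to the constants that is spread over a set. -/
lemma exists_spread_vector {α : Type*} [Fintype α] [DecidableEq α] {S : Finset α} (hS : 2 ≤ #S) :
    ∃ w : α → ℝ, (∀ a, a ∉ S → w a = 0) ∧ ∑ a, w a = 0 ∧ w ⬝ᵥ w = 1 ∧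
      ∀ a, w a ^ 2 ≤ 2 / (#S : ℝ) := by
  -- The vector takes a constant value on `r` points of `S` and its negative on `r` others; `#S ≥ 2`
  -- gives `#S ≤ 4 * r`, hence the bound on the entries.
  set r := #S / 2 with hr
  obtain ⟨P, hPS, hP⟩ := Finset.exists_subset_card_eq (s := S) (n := r) (by omega)
  obtain ⟨N, hNS, hN⟩ := Finset.exists_subset_card_eq (s := S \ P) (n := r) (by
    rw [Finset.card_sdiff_of_subset hPS]; omega)
  have hdisj : ∀ a, a ∈ P → a ∉ N := fun a ha hN' => (Finset.mem_sdiff.1 (hNS hN')).2 ha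
  have hr1 : 1 ≤ r := by omega
  have hr0 : (0 : ℝ) < 2 * r := by
    have : (1 : ℝ) ≤ r := by exact_mod_cast hr1
    linarith
  have hsq : (√(2 * r : ℝ))⁻¹ * (√(2 * r : ℝ))⁻¹ = (2 * r : ℝ)⁻¹ := by
    rw [← mul_inv, Real.mul_self_sqrt hr0.le]
  have hw2 : ∀ a, ((if a ∈ P then (√(2 * r : ℝ))⁻¹ else 0) - if a ∈ N then (√(2 * r : ℝ))⁻¹ else 0) *
      ((if a ∈ P then (√(2 * r : ℝ))⁻¹ else 0) - if a ∈ N then (√(2 * r : ℝ))⁻¹ else 0) =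
      (if a ∈ P then (2 * r : ℝ)⁻¹ else 0) + if a ∈ N then (2 * r : ℝ)⁻¹ else 0 := by
    intro a
    by_cases h1 : a ∈ P
    · simp [h1, hdisj a h1, ← hsq]
    · by_cases h2 : a ∈ N <;> simp [h1, h2, ← hsq]
  refine ⟨fun a => (if a ∈ P then (√(2 * r : ℝ))⁻¹ else 0) - if a ∈ N then (√(2 * r : ℝ))⁻¹ else 0,
    ?_, ?_, ?_, ?_⟩
  · intro a ha
    have h1 : a ∉ P := fun h => ha (hPS h)
    have h2 : a ∉ N := fun h => ha (Finset.mem_sdiff.1 (hNS h)).1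
    simp [h1, h2]
  · simp [Finset.sum_sub_distrib, hP, hN]
  · rw [dotProduct]
    simp only [hw2, Finset.sum_add_distrib, Finset.sum_ite_mem, Finset.univ_inter,
      Finset.sum_const, hP, hN, nsmul_eq_mul]
    field_simp
    norm_num
  · intro a
    rw [sq, hw2]
    have hS0 : (0 : ℝ) < #S := by exact_mod_cast (show 0 < #S by omega)
    have hle : (2 * r : ℝ)⁻¹ ≤ 2 / (#S : ℝ) := by
      rw [inv_eq_one_div, div_le_div_iff₀ hr0 hS0]
      have : #S ≤ 4 * r := by omega
      have : (#S : ℝ) ≤ 4 * r := by exact_mod_cast this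
      linarith
    by_cases h1 : a ∈ P
    · simpa [h1, hdisj a h1] using hle
    · by_cases h2 : a ∈ N
      · simpa [h1, h2] using hle
      · simp [h1, h2]; positivity

/-- An isometry from a four-dimensional space whose entries are small. -/
lemma exists_testMatrix {n : ℕ} (q : Fin n → Bool) (hq : ∀ b, 2 ≤ #{a | q a = b}) :
    ∃ G : Matrix (Fin n) (Bool ⊕ Bool) ℝ, Gᵀ * G = 1 ∧
      Gᵀ *ᵥ uniformVec n = Sum.elim (biasVector ((#{a | q a = true} : ℝ) / n)) 0 ∧
      (∀ a x, G a x ≠ 0 → q a = Sum.elim id id x) ∧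
      ∀ a x, G a x ^ 2 ≤ 2 / (#{a' | q a' = Sum.elim id id x} : ℝ) := by
  have hqs : Function.Surjective q := by
    intro b
    obtain ⟨a, ha⟩ := Finset.card_pos.1 (show 0 < #{a | q a = b} by have := hq b; omega)
    exact ⟨a, by simpa using ha⟩
  choose w hwS hw0 hw1 hwb using fun b => exists_spread_vector (hq b)
  set Q := fibreMatrix q with hQ
  set R : Matrix Bool (Fin n) ℝ := Matrix.of w with hR
  have hpos : ∀ b, (0 : ℝ) < #{a | q a = b} := by
    intro b
    exact_mod_cast (show 0 < #{a | q a = b} by have := hq b; omega)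
  have hQR : Q * Rᵀ = 0 := by
    ext b b'
    rw [Matrix.mul_apply, Matrix.zero_apply]
    by_cases hb : b = b'
    · subst hb
      have : ∀ a, Q b a * Rᵀ a b = (√(#{a | q a = b} : ℝ))⁻¹ * w b a := by
        intro a
        simp only [hQ, fibreMatrix, hR, transpose_apply, of_apply]
        split_ifs with h
        · rfl
        · rw [hwS b a (by simpa using h)]; simp
      simp only [this, ← Finset.mul_sum, hw0, mul_zero]
    · refine Finset.sum_eq_zero fun a _ => ?_
      simp only [hQ, fibreMatrix, hR, transpose_apply, of_apply]
      split_ifs with h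
      · rw [hwS b' a (by simp [h, hb]), mul_zero]
      · rw [zero_mul]
  have hRQ : R * Qᵀ = 0 := by
    have := congrArg Matrix.transpose hQR
    rwa [transpose_mul, transpose_transpose, transpose_zero] at this
  have hRR : R * Rᵀ = 1 := by
    ext b b'
    rw [Matrix.mul_apply, Matrix.one_apply]
    split_ifs with hb
    · subst hb; exact hw1 b
    · refine Finset.sum_eq_zero fun a _ => ?_
      simp only [hR, transpose_apply, of_apply]
      by_cases h : q a = b
      · rw [hwS b' a (by simp [h, hb]), mul_zero]
      · rw [hwS b a (by simp [h]), zero_mul]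
  -- In each fibre there are two columns: the normalised indicator and a spread vector orthogonal to
  -- it.
  refine ⟨(Matrix.fromRows Q R)ᵀ, ?_, ?_, ?_, ?_⟩
  · rw [transpose_transpose, transpose_fromRows, fromRows_mul_fromCols,
      fibreMatrix_mul_transpose hqs, hQR, hRQ, hRR, fromBlocks_one]
  · rw [transpose_transpose, fromRows_mulVec, ← fibreMatrix_transpose_mulVec hqs, ← hQ,
      mulVec_mulVec, mulVec_mulVec, hQ, fibreMatrix_mul_transpose hqs, one_mulVec, ← hQ, hRQ,
      zero_mulVec]
  · rintro a (b | b) hne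
    · simp only [transpose_apply, fromRows_apply_inl, hQ, fibreMatrix, of_apply] at hne
      by_contra hcon
      exact hne (if_neg hcon)
    · simp only [transpose_apply, fromRows_apply_inr, hR, of_apply] at hne
      by_contra hcon
      exact hne (hwS b a (by simpa using hcon))
  · rintro a (b | b)
    · simp only [transpose_apply, fromRows_apply_inl, hQ, fibreMatrix, of_apply, Sum.elim_inl, id]
      split_ifs
      · rw [inv_pow, Real.sq_sqrt (hpos b).le, inv_eq_one_div]
        have h2 : 1 / (#{a | q a = b} : ℝ) ≤ 2 / (#{a | q a = b} : ℝ) :=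
          div_le_div_of_nonneg_right (by norm_num) (hpos b).le
        exact h2
      · have := hpos b
        simp only [ne_eq, OfNat.ofNat_ne_zero, not_false_eq_true, zero_pow]
        positivity
    · exact hwb b a

/-- Each of the `|ι| ^ k` terms is at most `(c / √n) ^ k * l2 F`. Entries of order `n ^ (-k/2)` are
what makes the mass on words with collisions negligible. -/
lemma tensorMatrix_mulVec_sq_le {k n : ℕ} {ι : Type*} [Fintype ι] {G : Matrix (Fin n) ι ℝ} {c : ℝ}
    (hG : ∀ a x, G a x ^ 2 ≤ c ^ 2 / n) (hc : 0 ≤ c) (F : (Fin k → ι) → ℝ) (a : Fin k → Fin n) :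
    ((tensorMatrix fun _ : Fin k => G) *ᵥ F) a ^ 2 ≤
      ((Fintype.card ι * c) ^ k * l2 F) ^ 2 / (n : ℝ) ^ k := by
  have h0 : 0 ≤ c / √(n : ℝ) := by positivity
  have h1 : ∀ a x, |G a x| ≤ c / √(n : ℝ) := by
    intro a x
    rw [← abs_of_nonneg h0, ← sq_le_sq, div_pow, Real.sq_sqrt (by positivity)]
    exact hG a x
  have h2 : |((tensorMatrix fun _ : Fin k => G) *ᵥ F) a| ≤
      (Fintype.card ι * c) ^ k * l2 F / √(n : ℝ) ^ k := by
    rw [mulVec, dotProduct]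
    refine (Finset.abs_sum_le_sum_abs _ _).trans ?_
    have : ∀ c' ∈ (Finset.univ : Finset (Fin k → ι)),
        |(tensorMatrix fun _ : Fin k => G) a c' * F c'| ≤ (c / √(n : ℝ)) ^ k * l2 F := by
      intro c' _
      rw [abs_mul, tensorMatrix_apply, Finset.abs_prod]
      refine mul_le_mul ?_ (abs_apply_le_l2 F c') (abs_nonneg _) (by positivity)
      refine (Finset.prod_le_prod (fun j _ => abs_nonneg _) fun j _ => h1 _ _).trans ?_
      rw [Finset.prod_const, Finset.card_univ, Fintype.card_fin]
    refine (Finset.sum_le_card_nsmul _ _ _ this).trans (le_of_eq ?_)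
    simp only [Finset.card_univ, Fintype.card_fun, Fintype.card_fin, nsmul_eq_mul, Nat.cast_pow,
      mul_pow, div_pow]
    ring
  rw [← sq_abs]
  refine (pow_le_pow_left₀ (abs_nonneg _) h2 2).trans (le_of_eq ?_)
  rw [div_pow, ← pow_mul, mul_comm k 2, pow_mul √(n : ℝ), Real.sq_sqrt (by positivity)]

/-- Test vectors for the blocks of `learnMatrix`. -/
lemma exists_testVectors {k m t : ℕ} (hmt : m + t ≤ k) {p : ℝ} (h0 : 0 < p) (h1 : p < 1) :
    ∃ B : ℝ, 0 ≤ B ∧ ∀ᶠ n : ℕ in atTop, ∃ (S : Finset (Fin n))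
      (x : (Fin (m + 1) → ℝ) → KSubset n k → ℝ),
      (∀ f A, x f A ≠ 0 → ∃ l : Fin (m + 1), f l ≠ 0 ∧ #(A.1 ∩ S) = l + t) ∧
      (∀ f, l2 (x f) ≤ l2 f) ∧
      ∀ (d : ℕ → ℝ) (D : ℝ), (∀ i ≤ k, |d i| ≤ D) → ∀ f g,
        |x f ⬝ᵥ learnMatrix n k d *ᵥ x g -
          f ⬝ᵥ krawMatrix m ((⌊p * n⌋₊ : ℝ) / n) (fun i => d (i + (k - m))) *ᵥ g| ≤
            B * D * √(collision n k) * (l2 f + l2 g) ^ 2 := by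
  set e := min p (1 - p) with he
  have he0 : 0 < e := lt_min h0 (by linarith)
  have hfl : Tendsto (fun n : ℕ => (⌊p * n⌋₊ : ℝ) / n) atTop (𝓝 p) :=
    (tendsto_nat_floor_mul_div_atTop h0.le).comp tendsto_natCast_atTop_atTop
  -- Both parts will have at least `e / 2 * n` elements, so squared entries of the test matrix are
  -- at most `2 / (e * n / 2) = c ^ 2 / n`. The condition `n > 4 / e` leaves at least two elements
  -- in each part.
  set c : ℝ := √(4 / e) with hc
  have hc2 : c ^ 2 = 4 / e := Real.sq_sqrt (by positivity)
  refine ⟨2 ^ k * (4 * c) ^ k, by positivity, ?_⟩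
  filter_upwards [hfl.eventually (Ioo_mem_nhds (show p - e / 2 < p by linarith)
    (show p < p + e / 2 by linarith)), eventually_gt_atTop ⌈4 / e⌉₊] with n hn hn4
  have hn0 : 0 < n := by omega
  have hn0' : (0 : ℝ) < n := by exact_mod_cast hn0
  have hne : 4 ≤ e * n := by
    have : 4 / e ≤ n := (Nat.le_ceil _).trans (by exact_mod_cast hn4.le)
    rwa [div_le_iff₀' he0] at this
  set s := ⌊p * n⌋₊ with hs
  have hep : e ≤ p := min_le_left _ _
  have hep' : e ≤ 1 - p := min_le_right _ _
  have hs1 : e / 2 * n ≤ s := by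
    have := (lt_div_iff₀ hn0').1 hn.1
    nlinarith
  have hs2 : (s : ℝ) + e / 2 * n ≤ n := by
    have := (div_lt_iff₀ hn0').1 hn.2
    nlinarith
  have hsn : s ≤ n := by
    have : (s : ℝ) ≤ n := by nlinarith
    exact_mod_cast this
  set S : Finset (Fin n) := {a | (a : ℕ) < s} with hS
  have hScard : #S = s := by rw [hS, Fin.card_filter_val_lt, min_eq_right hsn]
  set q : Fin n → Bool := fun a => decide (a ∈ S) with hq
  have hqt : ({a | q a = true} : Finset (Fin n)) = S := by ext a; simp [hq]
  have hqf : ({a | q a = false} : Finset (Fin n)) = Sᶜ := by ext a; simp [hq]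
  have hqe : ∀ b, e / 2 * n ≤ #{a | q a = b} := by
    intro b
    cases b
    · rw [hqf, Finset.card_compl, hScard, Fintype.card_fin, Nat.cast_sub hsn]; linarith
    · rw [hqt, hScard]; exact hs1
  have hq2 : ∀ b, 2 ≤ #{a | q a = b} := by
    intro b
    have h2 : (2 : ℝ) ≤ #{a | q a = b} := by linarith [hqe b]
    exact_mod_cast h2
  obtain ⟨G, hGG, hGu, hGt, hGb⟩ := exists_testMatrix q hq2
  have hGc : ∀ a x, G a x ^ 2 ≤ c ^ 2 / n := by
    intro a x
    refine (hGb a x).trans ?_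
    rw [hc2, div_div]
    have := hqe (Sum.elim id id x)
    rw [div_le_div_iff₀ (by nlinarith) (by positivity)]
    linarith
  rw [hqt, hScard] at hGu
  set y : (Fin (m + 1) → ℝ) → (Fin k → Fin n) → ℝ := fun f =>
    (tensorMatrix fun _ : Fin k => G) *ᵥ testTensor k m t f with hy
  have hl2 : ∀ f, l2 (testTensor k m t f) = l2 f := fun f => by
    rw [l2, testTensor_dotProduct hmt, l2]
  have hyl2 : ∀ f, l2 (y f) = l2 f := fun f => by
    rw [hy]
    simp only
    rw [l2_mulVec_isometry (tensorMatrix_isometry hGG), hl2]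
  have hysymm : ∀ f, IsSymmTensor (y f) := fun f => (testTensor_symm m t f).tensorMatrix_mulVec G
  refine ⟨S, fun f => (embedMatrix n k)ᵀ *ᵥ y f, ?_, ?_, ?_⟩
  · intro f A hne'
    simp only at hne'
    rw [embedMatrix_transpose_mulVec (hysymm f)] at hne'
    obtain ⟨c', hc', hcard⟩ := exists_of_tensorMatrix_mulVec_ne_zero hGt
      (right_ne_zero_of_mul hne')
    obtain ⟨l, hl, hlc⟩ := testTensor_support hc'
    refine ⟨l, hl, ?_⟩
    rw [← hlc, ← hcard, ← card_filter_enum]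
    simp [hq]
  · intro f
    exact (l2_embedMatrix_transpose_mulVec_le _).trans (hyl2 f).le
  · intro d D hd f g
    have hyb : ∀ f' : Fin (m + 1) → ℝ, l2 f' ≤ l2 f + l2 g → ∀ a, y f' a ^ 2 ≤
        ((4 * c) ^ k * (l2 f + l2 g)) ^ 2 / (n : ℝ) ^ k := by
      intro f' hf' a
      refine (tensorMatrix_mulVec_sq_le hGc (Real.sqrt_nonneg _) (testTensor k m t f') a).trans ?_
      rw [hl2]
      have : ((Fintype.card (Bool ⊕ Bool) : ℕ) : ℝ) = 4 := by norm_num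
      rw [this]
      have := l2_nonneg f'
      gcongr
    have hfn := l2_nonneg f
    have hgn := l2_nonneg g
    have key := abs_learnMatrix_sub_tensorOp_le hn0 (hysymm f) (hysymm g)
      (B := (4 * c) ^ k * (l2 f + l2 g)) (by positivity)
      (hyb f (by linarith)) (hyb g (by linarith)) hd
    have hT : y f ⬝ᵥ tensorOp (Fin k) (uniformVec n) d *ᵥ y g =
        f ⬝ᵥ krawMatrix m ((s : ℝ) / n) (fun i => d (i + (k - m))) *ᵥ g := by
      rw [← testTensor_bilin hmt (t := t) _ _ d f g, hy]
      · simp only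
        rw [mulVec_bilin, tensorOp_pullback hGG, hGu]
      · exact div_pos (by nlinarith) hn0'
      · rw [div_lt_one hn0']; nlinarith
    rw [hT, hyl2, hyl2] at key
    refine key.trans (le_of_eq ?_)
    ring

/-! ### Limits -/

section Limit

lemma continuousAt_kappa {m t : ℕ} (ht : t ≤ m) {p : ℝ} (h0 : 0 < p) (h1 : p < 1)
    (x : Fin (m + 1)) : ContinuousAt (fun p => kappa m p t x) p := by
  have hc : Continuous fun p => krawtchouk m p t := by
    unfold krawtchouk
    refine (PiLp.continuous_toLp 2 _).comp (continuous_pi fun x => ?_)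
    fun_prop
  have hne : ‖krawtchouk m p t‖ ≠ 0 := by
    rw [norm_krawtchouk h0.le h1.le]
    have h2 := Real.sqrt_pos.2 h0
    have h3 := Real.sqrt_pos.2 (show 0 < 1 - p by linarith)
    have h4 := Real.sqrt_pos.2 (show (0 : ℝ) < m.choose t by exact_mod_cast Nat.choose_pos ht)
    positivity
  have h2 : ContinuousAt (fun p => kappa m p t) p :=
    (hc.norm.continuousAt.inv₀ hne).smul hc.continuousAt
  exact (PiLp.continuous_apply 2 _ x).continuousAt.comp h2

lemma tendsto_krawMatrix_bilin {ι : Type*} {l : Filter ι} {m : ℕ} {p : ℝ} (h0 : 0 < p) (h1 : p < 1)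
    {P : ι → ℝ} (hP : Tendsto P l (𝓝 p)) {d : ι → ℕ → ℝ} {e : ℕ → ℝ}
    (hd : ∀ j, Tendsto (fun i => d i j) l (𝓝 (e j))) (f g : Fin (m + 1) → ℝ) :
    Tendsto (fun i => f ⬝ᵥ krawMatrix m (P i) (d i) *ᵥ g) l
      (𝓝 (f ⬝ᵥ krawMatrix m p e *ᵥ g)) := by
  simp only [krawMatrix_bilin]
  refine tendsto_finsetSum _ fun j hj => (hd j).mul ?_
  have hk : ∀ x, Tendsto (fun i => kappa m (P i) j x) l (𝓝 (kappa m p j x)) := fun x =>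
    (continuousAt_kappa (Nat.lt_succ_iff.1 (Finset.mem_range.1 hj)) h0 h1 x).tendsto.comp hP
  exact (tendsto_finsetSum _ fun x _ => (hk x).const_mul _).mul
    (tendsto_finsetSum _ fun x _ => (hk x).mul_const _)

lemma continuous_extendList (k i : ℕ) :
    Continuous fun d : Fin (k + 1) → ℝ => extendList d i := by
  unfold extendList
  split_ifs
  · fun_prop
  · fun_prop

variable {k : ℕ} {h : (Fin k → Bool) → Bool}

lemma tendsto_diagEntry {N : ℕ → ℕ} (hN : Tendsto N atTop atTop) {e : ℕ → Fin (k + 1) → ℝ}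
    {e' : Fin (k + 1) → ℝ} (he : Tendsto e atTop (𝓝 e')) :
    Tendsto (fun j => diagEntry k (extendList (e j)) (N j : ℝ)⁻¹) atTop
      (𝓝 (e' (Fin.last k))) := by
  have h1 : Tendsto (fun j => extendList (e j)) atTop (𝓝 (extendList e')) :=
    tendsto_pi_nhds.2 fun i => ((continuous_extendList k i).tendsto e').comp he
  have h2 : Tendsto (fun j => (N j : ℝ)⁻¹) atTop (𝓝 0) :=
    tendsto_inv_atTop_zero.comp (tendsto_natCast_atTop_atTop.comp hN)
  have h3 := ((continuous_diagEntry k).tendsto (extendList e', 0)).comp (h1.prodMk_nhds h2)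
  have h4 : diagEntry k (extendList e') 0 = e' (Fin.last k) := by
    rw [diagEntry_zero, extendList, dif_pos (Nat.lt_succ_self k)]
    rfl
  rw [← h4]
  exact h3

/-- A feasible list bounds the adversary bound from below in the limit. -/
lemma exists_le_adv (hk : IsSymmetric h) {d : Fin (k + 1) → ℝ} (hd : IsFeasible h d)
    (i : Fin (k + 1)) :
    ∃ g : ℕ → ℝ, Tendsto g atTop (𝓝 (d i)) ∧ ∀ᶠ n in atTop, ((g n : ℝ) : EReal) ≤ adv h n := by
  -- With `m = k` and `t = 0` all positions are free and every `d i` is an eigenvalue of the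
  -- Krawtchouk matrix. The value `1 / 2` is an arbitrary point of the open interval.
  obtain ⟨B, hB, hev⟩ := exists_testVectors (k := k) (m := k) (t := 0) le_rfl
    (show (0 : ℝ) < 1 / 2 by norm_num) (by norm_num)
  refine ⟨fun n => d i - B * ‖d‖ * √(collision n k) * 2 ^ 2 -
    |diagEntry k (extendList d) (n : ℝ)⁻¹|, ?_, ?_⟩
  · have h1 : Tendsto (fun n => √(collision n k)) atTop (𝓝 0) := by
      have := (tendsto_collision k).sqrt
      rwa [Real.sqrt_zero] at this
    have h2 := (tendsto_diagEntry tendsto_id (tendsto_const_nhds (x := d))).abs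
    rw [hd.last, abs_zero] at h2
    have h3 := (((h1.const_mul (B * ‖d‖)).mul_const (2 ^ 2)).const_sub (d i)).sub h2
    simpa using h3
  · have hfl : Tendsto (fun n : ℕ => (⌊(1 / 2 : ℝ) * n⌋₊ : ℝ) / n) atTop (𝓝 (1 / 2)) :=
      (tendsto_nat_floor_mul_div_atTop (by norm_num)).comp tendsto_natCast_atTop_atTop
    filter_upwards [hev, hfl.eventually (Ioo_mem_nhds (show (0 : ℝ) < 1 / 2 by norm_num)
      (show (1 / 2 : ℝ) < 1 by norm_num))] with n ⟨S, x, _, hx, hxT⟩ ⟨hp0, hp1⟩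
    set p := (⌊(1 / 2 : ℝ) * n⌋₊ : ℝ) / n with hp
    -- The unit eigenvector for `d i` at the rounded parameter `p`, which varies with `n`.
    set f := (kappa k p i).ofLp with hf
    have hi : (i : ℕ) ≤ k := Nat.lt_succ_iff.1 i.2
    have hf1 : l2 f = 1 := l2_kappa hp0 hp1 hi
    have hM : f ⬝ᵥ krawMatrix k p (fun j => extendList d (j + (k - k))) *ᵥ f = d i := by
      rw [krawMatrix_bilin, Finset.sum_eq_single (i : ℕ)]
      · rw [hf, kappa_orthogonal hp0 hp1 hi, if_pos rfl, mul_one, mul_one, Nat.sub_self,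
          Nat.add_zero, extendList, dif_pos i.2]
      · intro j _ hj
        rw [hf, kappa_orthogonal hp0 hp1 hi, if_neg (Ne.symm hj), zero_mul, mul_zero]
      · intro hi'; exact absurd (Finset.mem_range.2 i.2) hi'
    have key := hxT (extendList d) ‖d‖ (fun j _ => abs_extendList_le d j) f f
    rw [hM, hf1, one_add_one_eq_two] at key
    have hx1 : l2 (x f) ≤ 1 := (hx f).trans hf1.le
    have hx2 : l2 (x f) * l2 (x f) ≤ 1 := mul_le_one₀ hx1 (l2_nonneg _) hx1
    set Γ := learnMatrix n k (extendList d) - diagEntry k (extendList d) (n : ℝ)⁻¹ • 1 with hΓ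
    have hΓadv : ((‖Γ‖ : ℝ) : EReal) ≤ adv h n :=
      le_iSup₂_of_le Γ (isAdversaryMatrix_learnMatrix hk hd) le_rfl
    refine le_trans (EReal.coe_le_coe_iff.2 ?_) hΓadv
    have h1 := abs_bilin_le_norm Γ (x f) (x f)
    have h2 : ‖Γ‖ * (l2 (x f) * l2 (x f)) ≤ ‖Γ‖ :=
      mul_le_of_le_one_right (norm_nonneg _) hx2
    have h3 : x f ⬝ᵥ Γ *ᵥ x f = x f ⬝ᵥ learnMatrix n k (extendList d) *ᵥ x f -
        diagEntry k (extendList d) (n : ℝ)⁻¹ * (l2 (x f) * l2 (x f)) := by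
      rw [hΓ, sub_mulVec, dotProduct_sub, smul_mulVec, one_mulVec, dotProduct_smul, l2_mul_self,
        smul_eq_mul]
    have h4 : diagEntry k (extendList d) (n : ℝ)⁻¹ * (l2 (x f) * l2 (x f)) ≤
        |diagEntry k (extendList d) (n : ℝ)⁻¹| :=
      (mul_le_mul_of_nonneg_right (le_abs_self _) (mul_nonneg (l2_nonneg _) (l2_nonneg _))).trans
        (mul_le_of_le_one_right (abs_nonneg _) hx2)
    have h5 := (abs_le.1 key).1
    have h6 := le_abs_self (x f ⬝ᵥ Γ *ᵥ x f)
    linarith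

lemma eventually_lt_adv (hk : IsSymmetric h) {c : EReal} (hc : c < krawtchoukValue h) :
    ∀ᶠ n in atTop, c < adv h n := by
  rw [krawtchoukValue, lt_iSup_iff] at hc
  obtain ⟨d, hc⟩ := hc
  rw [lt_iSup_iff] at hc
  obtain ⟨hd, hc⟩ := hc
  obtain ⟨i, -, hi⟩ := Finset.exists_mem_eq_sup' (Finset.univ_nonempty) d
  rw [hi] at hc
  obtain ⟨g, hg, hge⟩ := exists_le_adv hk hd i
  have h1 : Tendsto (fun n => ((g n : ℝ) : EReal)) atTop (𝓝 (d i : EReal)) :=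
    (continuous_coe_real_ereal.tendsto _).comp hg
  filter_upwards [hge, h1.eventually (lt_mem_nhds hc)] with n h2 h3
  exact h3.trans_le h2

/-- Limits of feasible matrices satisfy the limiting constraints. -/
lemma norm_krawtchoukBlock_le_of_tendsto {N : ℕ → ℕ} (hN : Tendsto N atTop atTop)
    {e : ℕ → Fin (k + 1) → ℝ} {e' : Fin (k + 1) → ℝ} (he : Tendsto e atTop (𝓝 e'))
    {r : ℕ → ℝ} {r' : ℝ} (hr : Tendsto r atTop (𝓝 r')) (hr0 : ∀ j, 0 ≤ r j)
    (H : ∀ (j : ℕ) (S : Finset (Fin (N j))) (f g : KSubset (N j) k → ℝ),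
      (∀ A : KSubset (N j) k, #(A.1 ∩ S) ∈ weights h → f A = 0) →
      (∀ A : KSubset (N j) k, #(A.1 ∩ S) ∉ weights h → g A = 0) →
      |f ⬝ᵥ learnMatrix (N j) k (extendList (e j)) *ᵥ g| ≤ r j * (l2 f * l2 g))
    {m t : ℕ} (hmk : m ≤ k) (ht : t ≤ k - m) {p : ℝ} (h0 : 0 < p) (h1 : p < 1) :
    ‖krawtchoukBlock h e' m p t‖ ≤ r' := by
  have hr'0 : 0 ≤ r' := ge_of_tendsto' hr hr0
  rw [norm_krawtchoukBlock_le_iff e' m t p hr'0]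
  intro f g hf hg
  obtain ⟨B, hB, hev⟩ := exists_testVectors (k := k) (m := m) (t := t) (by omega) h0 h1
  have hP : Tendsto (fun n : ℕ => (⌊p * n⌋₊ : ℝ) / n) atTop (𝓝 p) :=
    (tendsto_nat_floor_mul_div_atTop h0.le).comp tendsto_natCast_atTop_atTop
  -- The test vectors realise the parameter `⌊p * n⌋₊ / n` rather than `p`, so continuity of the
  -- Krawtchouk vectors in `p` is needed.
  have hlim := tendsto_krawMatrix_bilin (m := m) h0 h1 (hP.comp hN)
    (d := fun j i => extendList (e j) (i + (k - m)))
    (e := fun i => extendList e' (i + (k - m)))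
    (fun i => ((continuous_extendList k _).tendsto e').comp he) f g
  rw [krawtchoukMatrix_eq e' hmk]
  have hcol : Tendsto (fun j => √(collision (N j) k)) atTop (𝓝 0) := by
    have := ((tendsto_collision k).comp hN).sqrt
    rwa [Real.sqrt_zero] at this
  have hbound : Tendsto (fun j => r j * (l2 f * l2 g) +
      B * ‖e j‖ * √(collision (N j) k) * (l2 f + l2 g) ^ 2) atTop
      (𝓝 (r' * (l2 f * l2 g) + B * ‖e'‖ * 0 * (l2 f + l2 g) ^ 2)) :=
    (hr.mul_const _).add (((he.norm.const_mul B).mul hcol).mul_const _)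
  rw [mul_zero, zero_mul, add_zero] at hbound
  refine le_of_tendsto_of_tendsto hlim.abs hbound ?_
  filter_upwards [hN.eventually hev] with j ⟨S, x, hxs, hx, hxT⟩
  have h2 := hxT (extendList (e j)) ‖e j‖ (fun i _ => abs_extendList_le (e j) i) f g
  have h3 := H j S (x f) (x g)
    (fun A hA => by
      by_contra hne
      obtain ⟨l, hl, hlA⟩ := hxs f A hne
      exact hl (hf l (by rwa [← hlA])))
    (fun A hA => by
      by_contra hne
      obtain ⟨l, hl, hlA⟩ := hxs g A hne
      exact hl (hg l (by rwa [← hlA])))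
  have h4 : r j * (l2 (x f) * l2 (x g)) ≤ r j * (l2 f * l2 g) :=
    mul_le_mul_of_nonneg_left (mul_le_mul (hx f) (hx g) (l2_nonneg _) (l2_nonneg _)) (hr0 j)
  simp only [Function.comp_apply]
  rw [abs_le] at h2 h3 ⊢
  constructor <;> linarith [h2.1, h2.2, h3.1, h3.2]

end Limit

/-! ### Invariant matrices -/

section Invariant

variable {k n : ℕ}

/-- The action of a permutation on `k`-subsets. -/
def permSubset (g : Equiv.Perm (Fin n)) : KSubset n k ≃ KSubset n k :=
  (Equiv.finsetCongr g).subtypeEquiv fun A => by simp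

lemma permSubset_val (g : Equiv.Perm (Fin n)) (A : KSubset n k) :
    (permSubset g A).1 = A.1.map g.toEmbedding := rfl

lemma permSubset_mul (g g' : Equiv.Perm (Fin n)) (A : KSubset n k) :
    permSubset (g * g') A = permSubset g (permSubset g' A) := by
  ext1
  simp only [permSubset_val, Finset.map_map]
  rfl

lemma card_permSubset_inter (g : Equiv.Perm (Fin n)) (A : KSubset n k) (S : Finset (Fin n)) :
    #((permSubset g A).1 ∩ S.map g.toEmbedding) = #(A.1 ∩ S) := by
  rw [permSubset_val, ← Finset.map_inter, Finset.card_map]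

/-- The symmetric group acts transitively on the pairs of `k`-subsets with a given size of the
intersection. -/
lemma exists_permSubset {A B A' B' : KSubset n k} (H : #(A.1 ∩ B.1) = #(A'.1 ∩ B'.1)) :
    ∃ g : Equiv.Perm (Fin n), permSubset g A = A' ∧ permSubset g B = B' := by
  -- The four cells of the Venn diagram of `A` and `B` have sizes determined by `#(A ∩ B)`.
  have hfib : ∀ A B : KSubset n k, ∀ c : Bool × Bool,
      #{a | (decide (a ∈ A.1), decide (a ∈ B.1)) = c} =
        if c.1 then (if c.2 then #(A.1 ∩ B.1) else k - #(A.1 ∩ B.1)) else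
          (if c.2 then k - #(A.1 ∩ B.1) else n - (k + k - #(A.1 ∩ B.1))) := by
    rintro A B ⟨c₁, c₂⟩
    cases c₁ <;> cases c₂
    · have : ({a | (decide (a ∈ A.1), decide (a ∈ B.1)) = (false, false)} : Finset (Fin n)) =
          (A.1 ∪ B.1)ᶜ := by ext; simp
      rw [this, Finset.card_compl, Finset.card_union, A.2, B.2, Fintype.card_fin]
      simp
    · have : ({a | (decide (a ∈ A.1), decide (a ∈ B.1)) = (false, true)} : Finset (Fin n)) =
          B.1 \ A.1 := by ext; simp [and_comm]
      rw [this, Finset.card_sdiff, B.2]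
      simp
    · have : ({a | (decide (a ∈ A.1), decide (a ∈ B.1)) = (true, false)} : Finset (Fin n)) =
          A.1 \ B.1 := by ext; simp
      rw [this, Finset.card_sdiff, A.2, Finset.inter_comm]
      simp
    · have : ({a | (decide (a ∈ A.1), decide (a ∈ B.1)) = (true, true)} : Finset (Fin n)) =
          A.1 ∩ B.1 := by ext; simp
      rw [this]
      simp
  obtain ⟨g, hg⟩ := exists_perm_comp_eq (fun a => (decide (a ∈ A.1), decide (a ∈ B.1)))
    (fun a => (decide (a ∈ A'.1), decide (a ∈ B'.1))) fun c => by rw [hfib, hfib, H]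
  have h1 : ∀ a, (g a ∈ A'.1 ↔ a ∈ A.1) ∧ (g a ∈ B'.1 ↔ a ∈ B.1) := by
    intro a
    have := congrFun hg a
    simpa using this
  have h2 : ∀ C C' : KSubset n k, (∀ a, g a ∈ C'.1 ↔ a ∈ C.1) → permSubset g C = C' := by
    intro C C' hC
    ext a
    rw [permSubset_val]
    simp only [Finset.mem_map, Equiv.coe_toEmbedding]
    constructor
    · rintro ⟨b, hb, rfl⟩; exact (hC b).2 hb
    · intro ha
      exact ⟨g.symm a, (hC _).1 (by simpa using ha), by simp⟩
  exact ⟨g, h2 A A' fun a => (h1 a).1, h2 B B' fun a => (h1 a).2⟩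

/-- A matrix on `k`-subsets is invariant if it commutes with the action of the symmetric group. -/
def IsInvariant (Γ : Matrix (KSubset n k) (KSubset n k) ℝ) : Prop :=
  ∀ (g : Equiv.Perm (Fin n)) A B, Γ (permSubset g A) (permSubset g B) = Γ A B

lemma IsInvariant.eq_of_card_eq {Γ : Matrix (KSubset n k) (KSubset n k) ℝ} (hΓ : IsInvariant Γ)
    {A B A' B' : KSubset n k} (H : #(A.1 ∩ B.1) = #(A'.1 ∩ B'.1)) : Γ A B = Γ A' B' := by
  obtain ⟨g, rfl, rfl⟩ := exists_permSubset H
  rw [hΓ]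

lemma embedMatrix_perm (g : Equiv.Perm (Fin n)) (a : Fin k → Fin n) (A : KSubset n k) :
    embedMatrix n k (g ∘ a) (permSubset g A) = embedMatrix n k a A := by
  simp only [embedMatrix, of_apply]
  congr 1
  rw [permSubset_val, Finset.map_eq_image, ← Finset.image_image]
  exact propext (Finset.image_injective g.injective).eq_iff

lemma learnMatrix_invariant (d : ℕ → ℝ) : IsInvariant (learnMatrix n k d) := by
  intro g A B
  simp only [learnMatrix, Matrix.mul_apply, transpose_apply]
  symm
  refine Fintype.sum_equiv (Equiv.arrowCongr (Equiv.refl _) g) _ _ fun b => ?_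
  have e : ∀ b, (Equiv.arrowCongr (Equiv.refl (Fin k)) g) b = g ∘ b := fun b => by
    ext j; simp
  rw [e, embedMatrix_perm]
  congr 1
  refine Fintype.sum_equiv (Equiv.arrowCongr (Equiv.refl _) g) _ _ fun a => ?_
  rw [e, embedMatrix_perm]
  congr 1
  simp [tensorOp_apply, uniformVec]

/-- The number of `r`-subsets that contain a given `i`-subset. -/
def supersetCount (k r i : ℕ) : ℝ := if i ≤ r then ((k - i).choose (r - i) : ℝ) else 0

lemma card_supersets (r : ℕ) (I : Finset (Fin k)) :
    ∑ J ∈ Finset.powersetCard r (Finset.univ : Finset (Fin k)), (if I ⊆ J then (1 : ℝ) else 0) =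
      supersetCount k r #I := by
  rw [← Finset.sum_filter, Finset.sum_const, nsmul_eq_mul, mul_one, supersetCount]
  split_ifs with hI
  · have h1 : #(Finset.powersetCard (r - #I) Iᶜ) = (k - #I).choose (r - #I) := by
      rw [Finset.card_powersetCard, Finset.card_compl, Fintype.card_fin]
    rw [← h1]
    congr 1
    symm
    refine Finset.card_bij' (fun J _ => J ∪ I) (fun J _ => J \ I) ?_ ?_ ?_ ?_
    · intro J hJ
      obtain ⟨hJ1, hJ2⟩ := Finset.mem_powersetCard.1 hJ
      simp only [Finset.mem_filter, Finset.mem_powersetCard, Finset.subset_univ, true_and]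
      refine ⟨?_, Finset.subset_union_right⟩
      rw [Finset.card_union_of_disjoint, hJ2]
      · omega
      · exact (Finset.subset_compl_iff_disjoint_right.1 hJ1)
    · intro J hJ
      simp only [Finset.mem_filter, Finset.mem_powersetCard, Finset.subset_univ, true_and] at hJ
      rw [Finset.mem_powersetCard]
      refine ⟨fun a ha => ?_, ?_⟩
      · simpa using (Finset.mem_sdiff.1 ha).2
      · rw [Finset.card_sdiff_of_subset hJ.2, hJ.1]
    · intro J hJ
      obtain ⟨hJ1, hJ2⟩ := Finset.mem_powersetCard.1 hJ
      exact Finset.union_sdiff_cancel_right (Finset.subset_compl_iff_disjoint_right.1 hJ1)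
    · intro J hJ
      simp only [Finset.mem_filter] at hJ
      exact Finset.sdiff_union_of_subset hJ.2
  · rw [Finset.filter_false_of_mem]
    · simp
    · intro J hJ hIJ
      have := Finset.card_le_card hIJ
      rw [(Finset.mem_powersetCard.1 hJ).2] at this
      exact hI this

/-- Expand the coefficient as a sum over `J ⊇ I` and swap the sums. For fixed `J` the sum over `I ⊆
J` is a product over `J` of `(δ - 1/n) + 1/n = δ`, where `δ` tests whether the two letters agree. -/
lemma tensorOp_supersetCount (r : ℕ) (a b : Fin k → Fin n) :
    tensorOp (Fin k) (uniformVec n) (supersetCount k r) a b =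
      ∑ J ∈ Finset.powersetCard r (Finset.univ : Finset (Fin k)),
        if ∀ j ∈ J, a j = b j then ((n : ℝ)⁻¹) ^ (k - r) else 0 := by
  have hu : (√(n : ℝ))⁻¹ * (√(n : ℝ))⁻¹ = (n : ℝ)⁻¹ := by
    rw [← mul_inv, Real.mul_self_sqrt (by positivity)]
  rw [tensorOp_apply]
  simp only [uniformVec, hu, ← card_supersets, Finset.sum_mul]
  rw [Finset.sum_comm]
  refine Finset.sum_congr rfl fun J hJ => ?_
  have hJr := (Finset.mem_powersetCard.1 hJ).2
  have h1 : ∀ I : Finset (Fin k), (if I ⊆ J then (1 : ℝ) else 0) *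
      (∏ j, if j ∈ I then (if a j = b j then 1 else 0) - (n : ℝ)⁻¹ else (n : ℝ)⁻¹) =
      if I ∈ J.powerset then ((∏ j ∈ I, ((if a j = b j then 1 else 0) - (n : ℝ)⁻¹)) *
        ∏ j ∈ J \ I, (n : ℝ)⁻¹) * (n : ℝ)⁻¹ ^ (k - r) else 0 := by
    intro I
    simp only [Finset.mem_powerset]
    split_ifs with hIJ
    · rw [one_mul, Finset.prod_ite]
      have e1 : Finset.filter (fun j => j ∈ I) Finset.univ = I := by ext; simp
      have e2 : Finset.filter (fun j => j ∉ I) Finset.univ = Iᶜ := by ext; simp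
      rw [e1, e2, mul_assoc, Finset.prod_const, Finset.prod_const, ← pow_add]
      congr 2
      rw [Finset.card_compl, Finset.card_sdiff_of_subset hIJ, hJr, Fintype.card_fin]
      have := Finset.card_le_card hIJ
      have := Finset.card_le_univ J
      rw [Fintype.card_fin] at this
      omega
    · rw [zero_mul]
  simp only [h1]
  rw [Finset.sum_ite_mem, Finset.univ_inter, ← Finset.sum_mul, ← Finset.prod_add]
  simp only [sub_add_cancel]
  split_ifs with h2
  · rw [Finset.prod_eq_one, one_mul]
    intro j hj
    rw [if_pos (h2 j hj)]
  · push Not at h2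
    obtain ⟨j, hj, hne⟩ := h2
    rw [Finset.prod_eq_zero hj (if_neg hne), zero_mul]

/-- Enumerations of `A` and `B` that agree at `r` positions force `r` common elements. Together with
positivity at intersection size `r`, this gives a triangular system. -/
lemma learnMatrix_supersetCount_eq_zero {r : ℕ} {A B : KSubset n k} (H : #(A.1 ∩ B.1) < r) :
    learnMatrix n k (supersetCount k r) A B = 0 := by
  rw [learnMatrix_apply, Finset.sum_eq_zero, mul_zero]
  intro σ _
  refine Finset.sum_eq_zero fun τ _ => ?_
  rw [tensorOp_supersetCount]
  refine Finset.sum_eq_zero fun J hJ => if_neg fun hcon => ?_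
  have hJr := (Finset.mem_powersetCard.1 hJ).2
  have : #(J.image (enum A ∘ σ)) ≤ #(A.1 ∩ B.1) := by
    refine Finset.card_le_card fun a ha => ?_
    obtain ⟨j, hj, rfl⟩ := Finset.mem_image.1 ha
    refine Finset.mem_inter.2 ⟨enum_mem A _, ?_⟩
    rw [hcon j hj]
    exact enum_mem B _
  rw [Finset.card_image_of_injective _ ((enum_injective A).comp σ.injective)] at this
  omega

lemma learnMatrix_supersetCount_pos (hn : 0 < n) {r : ℕ} {A B : KSubset n k}
    (H : #(A.1 ∩ B.1) = r) : 0 < learnMatrix n k (supersetCount k r) A B := by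
  have hn0 : (0 : ℝ) < n := by exact_mod_cast hn
  have hnn : ∀ a b : Fin k → Fin n,
      0 ≤ tensorOp (Fin k) (uniformVec n) (supersetCount k r) a b := by
    intro a b
    rw [tensorOp_supersetCount]
    refine Finset.sum_nonneg fun J _ => ?_
    split_ifs
    · positivity
    · exact le_rfl
  -- An enumeration of `B` that agrees with that of `A` wherever the latter lands in `B`; it
  -- provides one positive term in a sum of nonnegative ones.
  obtain ⟨b, hb⟩ := Finset.exists_equiv_extend_of_card_eq (α := Fin k) (t := B.1)
    (by rw [B.2, Fintype.card_fin]) (s := {j | enum A j ∈ B.1}) (f := enum A)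
    (by
      intro a ha
      obtain ⟨j, hj, rfl⟩ := Finset.mem_image.1 ha
      simpa using hj) (enum_injective A).injOn
  have hbinj : Function.Injective fun j => (b j : Fin n) :=
    Subtype.val_injective.comp b.injective
  obtain ⟨C, τ, hCτ⟩ := exists_enum_comp_eq hbinj
  have hCB : C = B := by
    ext1
    rw [← image_enum_comp C τ, hCτ]
    refine Finset.eq_of_subset_of_card_le ?_ ?_
    · intro a ha
      obtain ⟨j, _, rfl⟩ := Finset.mem_image.1 ha
      exact (b j).2
    · rw [Finset.card_image_of_injective _ hbinj, B.2, Finset.card_univ, Fintype.card_fin]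
  subst hCB
  have hpos : 0 < tensorOp (Fin k) (uniformVec n) (supersetCount k r) (enum A ∘ (1 : Equiv.Perm (Fin k)))
      (enum C ∘ τ) := by
    rw [hCτ, tensorOp_supersetCount]
    refine Finset.sum_pos' (fun J _ => by split_ifs <;> positivity)
      ⟨({j | enum A j ∈ C.1} : Finset (Fin k)), ?_, ?_⟩
    · rw [Finset.mem_powersetCard, card_filter_enum]
      exact ⟨Finset.subset_univ _, H⟩
    · rw [if_pos]
      · positivity
      · intro j hj
        exact (hb j hj).symm
  rw [learnMatrix_apply]
  refine mul_pos (by positivity) ?_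
  refine Finset.sum_pos' (fun σ _ => Finset.sum_nonneg fun τ _ => hnn _ _) ⟨1, Finset.mem_univ _, ?_⟩
  exact Finset.sum_pos' (fun τ _ => hnn _ _) ⟨τ, Finset.mem_univ _, hpos⟩

lemma learnMatrix_add_smul (d d' : ℕ → ℝ) (c : ℝ) :
    learnMatrix n k (d + c • d') = learnMatrix n k d + c • learnMatrix n k d' := by
  have : tensorOp (Fin k) (uniformVec n) (d + c • d') =
      tensorOp (Fin k) (uniformVec n) d + c • tensorOp (Fin k) (uniformVec n) d' := by
    simp only [tensorOp, Finset.smul_sum, ← Finset.sum_add_distrib, Pi.add_apply, Pi.smul_apply,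
      smul_eq_mul, add_smul, mul_smul]
  rw [learnMatrix, this, Matrix.mul_add, Matrix.add_mul, Matrix.mul_smul, Matrix.smul_mul]
  rfl

lemma learnMatrix_extendList (d : ℕ → ℝ) :
    learnMatrix n k (extendList fun i : Fin (k + 1) => d i) = learnMatrix n k d := by
  have : tensorOp (Fin k) (uniformVec n) (extendList fun i : Fin (k + 1) => d i) =
      tensorOp (Fin k) (uniformVec n) d := by
    refine Finset.sum_congr rfl fun I _ => ?_
    have := Finset.card_le_univ I
    rw [Fintype.card_fin] at this
    rw [extendList, dif_pos (by omega)]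
  rw [learnMatrix, this, learnMatrix]

/-- Every invariant matrix is of the form `learnMatrix n k d`. -/
lemma IsInvariant.exists_learnMatrix (hn : 0 < n) {Γ : Matrix (KSubset n k) (KSubset n k) ℝ}
    (hΓ : IsInvariant Γ) : ∃ d : Fin (k + 1) → ℝ, learnMatrix n k (extendList d) = Γ := by
  -- The triangular system is solved by increasing intersection size: adding a multiple of
  -- `supersetCount k r` corrects size `r` without disturbing smaller sizes.
  have key : ∀ r, ∃ d : ℕ → ℝ, ∀ A B : KSubset n k, #(A.1 ∩ B.1) < r →
      learnMatrix n k d A B = Γ A B := by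
    intro r
    induction r with
    | zero => exact ⟨0, fun A B hAB => absurd hAB (Nat.not_lt_zero _)⟩
    | succ r ih =>
      obtain ⟨d, hd⟩ := ih
      by_cases hex : ∃ A B : KSubset n k, #(A.1 ∩ B.1) = r
      · obtain ⟨A₀, B₀, h₀⟩ := hex
        have hpos := learnMatrix_supersetCount_pos hn h₀
        refine ⟨d + ((Γ A₀ B₀ - learnMatrix n k d A₀ B₀) /
          learnMatrix n k (supersetCount k r) A₀ B₀) • supersetCount k r, fun A B hAB => ?_⟩
        rw [learnMatrix_add_smul, Matrix.add_apply, Matrix.smul_apply, smul_eq_mul]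
        rcases Nat.lt_succ_iff_lt_or_eq.1 hAB with hlt | heq
        · rw [learnMatrix_supersetCount_eq_zero hlt, mul_zero, add_zero, hd A B hlt]
        · have hcard : #(A.1 ∩ B.1) = #(A₀.1 ∩ B₀.1) := heq.trans h₀.symm
          rw [(learnMatrix_invariant _).eq_of_card_eq hcard,
            (learnMatrix_invariant _).eq_of_card_eq hcard, hΓ.eq_of_card_eq hcard,
            div_mul_cancel₀ _ hpos.ne']
          ring
      · push Not at hex
        refine ⟨d, fun A B hAB => hd A B ?_⟩
        have := hex A B
        omega
  obtain ⟨d, hd⟩ := key (k + 1)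
  refine ⟨fun i => d i, ?_⟩
  rw [learnMatrix_extendList]
  ext A B
  refine hd A B ?_
  have := Finset.card_le_card (Finset.inter_subset_left (s₁ := A.1) (s₂ := B.1))
  rw [A.2] at this
  omega

end Invariant

/-! ### Symmetrisation of adversary matrices -/

section Symmetrise

variable {k n : ℕ} {h : (Fin k → Bool) → Bool}

/-- The average over the symmetric group of the entrywise product of a matrix with `v v^*`. -/
noncomputable def symmetrise (Γ : Matrix (KSubset n k) (KSubset n k) ℝ) (v : KSubset n k → ℝ) :
    Matrix (KSubset n k) (KSubset n k) ℝ :=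
  Matrix.of fun A B => (Fintype.card (KSubset n k) : ℝ) / n.factorial *
    ∑ g : Equiv.Perm (Fin n), v (permSubset g A) * v (permSubset g B) *
      Γ (permSubset g A) (permSubset g B)

lemma symmetrise_invariant (Γ : Matrix (KSubset n k) (KSubset n k) ℝ) (v : KSubset n k → ℝ) :
    IsInvariant (symmetrise Γ v) := by
  intro g A B
  simp only [symmetrise, of_apply, ← permSubset_mul]
  congr 1
  exact Fintype.sum_equiv (Equiv.mulRight g) _ _ fun g' => rfl

/-- By transitivity the sum is the same for all `A`, and for each `g` the total over `A` is `l2 v ^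
2 = 1`. -/
lemma sum_permSubset_sq {v : KSubset n k → ℝ} (hv : l2 v = 1) (A : KSubset n k) :
    (Fintype.card (KSubset n k) : ℝ) * ∑ g : Equiv.Perm (Fin n), v (permSubset g A) ^ 2 =
      n.factorial := by
  have h1 : ∀ B : KSubset n k, ∑ g : Equiv.Perm (Fin n), v (permSubset g A) ^ 2 =
      ∑ g : Equiv.Perm (Fin n), v (permSubset g B) ^ 2 := by
    intro B
    obtain ⟨g₀, hg₀, -⟩ := exists_permSubset (A := B) (B := B) (A' := A) (B' := A)
      (by simp [A.2, B.2])
    rw [← hg₀]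
    simp only [← permSubset_mul]
    exact Fintype.sum_equiv (Equiv.mulRight g₀) _ _ fun g' => rfl
  have h2 : ∑ B : KSubset n k, ∑ g : Equiv.Perm (Fin n), v (permSubset g B) ^ 2 =
      n.factorial := by
    rw [Finset.sum_comm]
    have : ∀ g : Equiv.Perm (Fin n), ∑ B : KSubset n k, v (permSubset g B) ^ 2 = 1 := by
      intro g
      rw [Fintype.sum_equiv (permSubset g) (fun B => v (permSubset g B) ^ 2) (fun B => v B ^ 2)
        fun _ => rfl]
      have := l2_sq v
      rw [hv, dotProduct] at this
      simp only [← sq] at this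
      linarith
    simp [this, Fintype.card_perm]
  rw [← h2, Finset.sum_congr rfl fun B _ => (h1 B).symm]
  simp

lemma symmetrise_bilin (Γ : Matrix (KSubset n k) (KSubset n k) ℝ) (v f f' : KSubset n k → ℝ) :
    f ⬝ᵥ symmetrise Γ v *ᵥ f' = (Fintype.card (KSubset n k) : ℝ) / n.factorial *
      ∑ g : Equiv.Perm (Fin n), (fun A => f ((permSubset g).symm A) * v A) ⬝ᵥ
        Γ *ᵥ (fun A => f' ((permSubset g).symm A) * v A) := by
  have h1 : ∀ g : Equiv.Perm (Fin n), (fun A => f ((permSubset g).symm A) * v A) ⬝ᵥ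
        Γ *ᵥ (fun A => f' ((permSubset g).symm A) * v A) =
      ∑ A, ∑ B, f A * (v (permSubset g A) * v (permSubset g B) *
        Γ (permSubset g A) (permSubset g B)) * f' B := by
    intro g
    rw [dotProduct]
    symm
    refine Fintype.sum_equiv (permSubset g) _ _ fun A => ?_
    rw [mulVec, dotProduct, Finset.mul_sum]
    refine Fintype.sum_equiv (permSubset g) _ _ fun B => ?_
    simp only [Equiv.symm_apply_apply]
    ring
  rw [Finset.sum_congr rfl fun g _ => h1 g]
  simp only [dotProduct, mulVec, symmetrise, of_apply]
  rw [Finset.sum_comm, Finset.mul_sum]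
  refine Finset.sum_congr rfl fun A _ => ?_
  rw [Finset.sum_comm, Finset.mul_sum, Finset.mul_sum]
  refine Finset.sum_congr rfl fun B _ => ?_
  rw [Finset.mul_sum, Finset.mul_sum, Finset.sum_mul, Finset.mul_sum]
  refine Finset.sum_congr rfl fun g _ => ?_
  ring

/-- With Cauchy–Schwarz over the group, this identity shows that symmetrisation preserves the query
constraints with constant `1`. -/
lemma sum_l2_sq_symmetrise {v : KSubset n k → ℝ} (hv : l2 v = 1) (f : KSubset n k → ℝ) :
    (Fintype.card (KSubset n k) : ℝ) / n.factorial *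
      ∑ g : Equiv.Perm (Fin n), l2 (fun A => f ((permSubset g).symm A) * v A) ^ 2 = l2 f ^ 2 := by
  have h1 : ∀ g : Equiv.Perm (Fin n), l2 (fun A => f ((permSubset g).symm A) * v A) ^ 2 =
      ∑ A, f A ^ 2 * v (permSubset g A) ^ 2 := by
    intro g
    rw [l2_sq, dotProduct]
    symm
    refine Fintype.sum_equiv (permSubset g) _ _ fun A => ?_
    rw [Equiv.symm_apply_apply]
    ring
  have h2 : (0 : ℝ) < n.factorial := by exact_mod_cast n.factorial_pos
  simp only [h1]
  rw [Finset.sum_comm, Finset.mul_sum, l2_sq, dotProduct]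
  refine Finset.sum_congr rfl fun A _ => ?_
  rw [← Finset.mul_sum, div_mul_eq_mul_div, div_eq_iff h2.ne', ← sum_permSubset_sq hv A]
  ring

/-- An adversary matrix of norm above `c` gives a list of numbers. -/
lemma IsAdversaryMatrix.exists_list (hk : IsSymmetric h) (hn : 0 < n)
    {Γ : Matrix (KSubset n k) (KSubset n k) ℝ} (hΓ : IsAdversaryMatrix h Γ) {c : ℝ} (hc0 : 0 ≤ c)
    (hc : c < ‖Γ‖) :
    ∃ (d : Fin (k + 1) → ℝ) (l : ℝ), c < l ∧ diagEntry k (extendList d) (n : ℝ)⁻¹ = 0 ∧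
      (fun _ => 1) ⬝ᵥ learnMatrix n k (extendList d) *ᵥ (fun _ => 1) =
        l * Fintype.card (KSubset n k) ∧
      ∀ (S : Finset (Fin n)) (f g : KSubset n k → ℝ),
        (∀ A : KSubset n k, #(A.1 ∩ S) ∈ weights h → f A = 0) →
        (∀ A : KSubset n k, #(A.1 ∩ S) ∉ weights h → g A = 0) →
        |f ⬝ᵥ learnMatrix n k (extendList d) *ᵥ g| ≤ l2 f * l2 g := by
  obtain ⟨v, hv, hvc⟩ : ∃ v : KSubset n k → ℝ, l2 v = 1 ∧ c < |v ⬝ᵥ Γ *ᵥ v| := by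
    by_contra! hcon
    exact absurd (norm_le_of_quadratic_le hΓ.symm hc0 hcon) (not_le.2 hc)
  -- Feasibility is invariant under a change of sign, so the quadratic form may be taken positive at
  -- `v`.
  obtain ⟨Γ', hΓ', hvc'⟩ : ∃ Γ' : Matrix (KSubset n k) (KSubset n k) ℝ,
      IsAdversaryMatrix h Γ' ∧ c < v ⬝ᵥ Γ' *ᵥ v := by
    rcases lt_abs.1 hvc with h1 | h1
    · exact ⟨Γ, hΓ, h1⟩
    · refine ⟨-Γ, ⟨hΓ.symm.neg, fun A => by rw [Matrix.neg_apply, hΓ.diag, neg_zero], fun S => ?_⟩,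
        by rwa [neg_mulVec, dotProduct_neg]⟩
      have : queryBlock h (-Γ) S = -queryBlock h Γ S := rfl
      rw [this, norm_neg]
      exact hΓ.query S
  obtain ⟨A₀⟩ : Nonempty (KSubset n k) := by
    by_contra hcon
    rw [not_nonempty_iff] at hcon
    simp [l2, dotProduct] at hv
  have hnf : (0 : ℝ) < n.factorial := by exact_mod_cast n.factorial_pos
  obtain ⟨d, hd⟩ := (symmetrise_invariant Γ' v).exists_learnMatrix hn
  refine ⟨d, v ⬝ᵥ Γ' *ᵥ v, hvc', ?_, ?_, ?_⟩
  · rw [← learnMatrix_diag _ A₀, hd]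
    simp [symmetrise, hΓ'.diag]
  -- For the all-ones vector each of the `n!` summands equals `v ⬝ᵥ Γ' *ᵥ v`.
  · rw [hd, symmetrise_bilin]
    simp only [one_mul, Finset.sum_const, Finset.card_univ, Fintype.card_perm, Fintype.card_fin,
      nsmul_eq_mul]
    field_simp
  · intro S f g hf hg
    rw [hd, symmetrise_bilin, abs_mul, abs_of_nonneg (by positivity)]
    have h1 : ∀ σ : Equiv.Perm (Fin n), |(fun A => f ((permSubset σ).symm A) * v A) ⬝ᵥ
        Γ' *ᵥ (fun A => g ((permSubset σ).symm A) * v A)| ≤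
          l2 (fun A => f ((permSubset σ).symm A) * v A) *
            l2 (fun A => g ((permSubset σ).symm A) * v A) := by
      intro σ
      -- Moving the functions by `σ` turns the query `S` into its image under `σ`, for which `Γ'` is
      -- feasible as well.
      have hS : ∀ A : KSubset n k, #(A.1 ∩ S.map σ.toEmbedding) =
          #(((permSubset σ).symm A).1 ∩ S) := by
        intro A
        rw [← card_permSubset_inter σ ((permSubset σ).symm A), Equiv.apply_symm_apply]
      have := (norm_queryBlock_le_iff hk Γ' (S.map σ.toEmbedding) zero_le_one).1
        (hΓ'.query _) (fun A => f ((permSubset σ).symm A) * v A)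
        (fun A => g ((permSubset σ).symm A) * v A)
        (fun A hA => by rw [hf _ (by rwa [← hS]), zero_mul])
        (fun A hA => by rw [hg _ (by rwa [← hS]), zero_mul])
      rwa [one_mul] at this
    set N := (Fintype.card (KSubset n k) : ℝ) / n.factorial with hN
    have hN0 : 0 ≤ N := by positivity
    have h2 : |∑ σ : Equiv.Perm (Fin n), (fun A => f ((permSubset σ).symm A) * v A) ⬝ᵥ
        Γ' *ᵥ (fun A => g ((permSubset σ).symm A) * v A)| ≤
        √(∑ σ : Equiv.Perm (Fin n), l2 (fun A => f ((permSubset σ).symm A) * v A) ^ 2) *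
          √(∑ σ : Equiv.Perm (Fin n), l2 (fun A => g ((permSubset σ).symm A) * v A) ^ 2) :=
      (Finset.abs_sum_le_sum_abs _ _).trans ((Finset.sum_le_sum fun σ _ => h1 σ).trans
        (Real.sum_mul_le_sqrt_mul_sqrt _ _ _))
    refine (mul_le_mul_of_nonneg_left h2 hN0).trans (le_of_eq ?_)
    have e : ∀ f : KSubset n k → ℝ, √N *
        √(∑ σ : Equiv.Perm (Fin n), l2 (fun A => f ((permSubset σ).symm A) * v A) ^ 2) = l2 f := by
      intro f
      rw [← Real.sqrt_mul hN0, sum_l2_sq_symmetrise hv, Real.sqrt_sq (l2_nonneg f)]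
    rw [← e f, ← e g]
    nth_rewrite 1 [← Real.mul_self_sqrt hN0]
    ring

end Symmetrise

/-! ### Boundedness of feasible lists -/

section Bounded

variable {k : ℕ} {h : (Fin k → Bool) → Bool}

lemma krawtchoukMatrix_bilin (d : Fin (k + 1) → ℝ) {m : ℕ} (hm : m ≤ k) (p : ℝ)
    (f g : Fin (m + 1) → ℝ) :
    f ⬝ᵥ krawtchoukMatrix d m p *ᵥ g = ∑ j ∈ range (m + 1), extendList d (j + (k - m)) *
      ((f ⬝ᵥ (kappa m p j).ofLp) * ((kappa m p j).ofLp ⬝ᵥ g)) := by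
  rw [krawtchoukMatrix_eq d hm, krawMatrix_bilin]

lemma extendList_smul (c : ℝ) (d : Fin (k + 1) → ℝ) (i : ℕ) :
    extendList (c • d) i = c * extendList d i := by
  simp only [extendList]
  split_ifs <;> simp

lemma isFeasible_smul {d : Fin (k + 1) → ℝ} (hlast : d (Fin.last k) = 0) {r : ℝ}
    (hblock : ∀ m t : ℕ, m ≤ k → t ≤ k - m → ∀ p : ℝ, 0 < p → p < 1 →
      ‖krawtchoukBlock h d m p t‖ ≤ r) (hr : 0 ≤ r) {c : ℝ} (hc : |c| * r ≤ 1) :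
    IsFeasible h (c • d) where
  last := by rw [Pi.smul_apply, hlast, smul_zero]
  block m t _ hm ht p h0 h1 := by
    rw [norm_krawtchoukBlock_le_iff _ m t p zero_le_one]
    intro f g hf hg
    have key := (norm_krawtchoukBlock_le_iff d m t p hr).1 (hblock m t hm ht p h0 h1) f g hf hg
    have e : f ⬝ᵥ krawtchoukMatrix (c • d) m p *ᵥ g = c * (f ⬝ᵥ krawtchoukMatrix d m p *ᵥ g) := by
      simp only [krawtchoukMatrix_bilin _ hm, extendList_smul, Finset.mul_sum, mul_assoc]
    rw [e, abs_mul]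
    have h2 : 0 ≤ l2 f * l2 g := mul_nonneg (l2_nonneg _) (l2_nonneg _)
    calc |c| * |f ⬝ᵥ krawtchoukMatrix d m p *ᵥ g| ≤ |c| * (r * (l2 f * l2 g)) := by gcongr
      _ = |c| * r * (l2 f * l2 g) := by ring
      _ ≤ 1 * (l2 f * l2 g) := by gcongr

lemma isFeasible_zero : IsFeasible h 0 where
  last := rfl
  block m t _ hm _ p _ _ := by
    rw [norm_krawtchoukBlock_le_iff _ m t p zero_le_one]
    intro f g _ _
    have : ∀ i, extendList (0 : Fin (k + 1) → ℝ) i = 0 := fun i => by simp [extendList]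
    simp only [krawtchoukMatrix_bilin _ hm, this, zero_mul, Finset.sum_const_zero, abs_zero, one_mul]
    exact mul_nonneg (l2_nonneg _) (l2_nonneg _)

lemma krawtchoukValue_nonneg : 0 ≤ krawtchoukValue h := by
  refine le_iSup₂_of_le 0 isFeasible_zero ?_
  have : (Finset.univ : Finset (Fin (k + 1))).sup' Finset.univ_nonempty (0 : Fin (k + 1) → ℝ) = 0 :=
    Finset.sup'_const _ 0
  rw [this]
  exact le_rfl

lemma le_krawtchoukValue {d : Fin (k + 1) → ℝ} (hd : IsFeasible h d) (i : Fin (k + 1)) :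
    ((d i : ℝ) : EReal) ≤ krawtchoukValue h :=
  le_iSup₂_of_le d hd (EReal.coe_le_coe_iff.2 (Finset.le_sup' d (Finset.mem_univ i)))

/-- The entries are square roots of binomial probabilities. Positivity allows `d_{k-m}` to be
isolated from a single entry of `M_{m,p}`. -/
lemma kappa_zero_pos {m : ℕ} {p : ℝ} (h0 : 0 < p) (h1 : p < 1) (x : Fin (m + 1)) :
    0 < kappa m p 0 x := by
  have h2 := Real.sqrt_pos.2 h0
  have h3 := Real.sqrt_pos.2 (show 0 < 1 - p by linarith)
  have h4 := Real.sqrt_pos.2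
    (show (0 : ℝ) < m.choose x by exact_mod_cast Nat.choose_pos (Nat.lt_succ_iff.1 x.2))
  have h5 : krawCoeff m p 0 x = √p ^ (x : ℕ) * √(1 - p) ^ (m - (x : ℕ)) := by
    rw [krawCoeff, Polynomial.coeff_zero_eq_eval_zero]
    simp
  rw [kappa_apply h0 h1, h5]
  simp only [Nat.choose_zero_right, Nat.cast_one, Real.sqrt_one, div_one]
  positivity

/-- A nonconstant symmetric function distinguishes two consecutive weights. -/
lemma exists_weights_ne (hk : IsSymmetric h) (hne : ∃ x y, h x ≠ h y) :
    ∃ w < k, ¬ (w ∈ weights h ↔ w + 1 ∈ weights h) := by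
  by_contra! hcon
  have h1 : ∀ w ≤ k, (w ∈ weights h ↔ 0 ∈ weights h) := by
    intro w
    induction w with
    | zero => simp
    | succ w ih => intro hw; rw [← hcon w (by omega)]; exact ih (by omega)
  have h2 : ∀ x : Fin k → Bool, weight x ≤ k := fun x => by
    have := hammingWeight_le x
    rwa [Fintype.card_fin] at this
  obtain ⟨x, y, hxy⟩ := hne
  refine hxy (Bool.eq_iff_iff.2 ?_)
  rw [← mem_weights_iff hk, ← mem_weights_iff hk, h1 _ (h2 x), h1 _ (h2 y)]

/-- A window of `m + 1 ≥ 2` consecutive weights can be placed so as to contain two neighbouring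
weights with different values, so for each `m` some block is nonempty. -/
lemma exists_mem_blocks (hk : IsSymmetric h) (hne : ∃ x y, h x ≠ h y) {m : ℕ} (hm : 0 < m)
    (hmk : m ≤ k) : ∃ t ≤ k - m, ∃ x y : Fin (m + 1),
      (x : ℕ) + t ∉ weights h ∧ (y : ℕ) + t ∈ weights h := by
  obtain ⟨w, hw, hwne⟩ := exists_weights_ne hk hne
  obtain ⟨t, ht, htw, hwt⟩ : ∃ t ≤ k - m, t ≤ w ∧ w + 1 ≤ t + m :=
    ⟨min w (k - m), min_le_right _ _, min_le_left _ _, by omega⟩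
  have e1 : w - t + t = w := by omega
  have e2 : w + 1 - t + t = w + 1 := by omega
  by_cases h1 : w ∈ weights h
  · have h2 : w + 1 ∉ weights h := fun h2 => hwne ⟨fun _ => h2, fun _ => h1⟩
    exact ⟨t, ht, ⟨w + 1 - t, by omega⟩, ⟨w - t, by omega⟩, by simpa only [e2], by simpa only [e1]⟩
  · have h2 : w + 1 ∈ weights h := by
      by_contra h2; exact hwne ⟨fun h => absurd h h1, fun h => absurd h h2⟩
    exact ⟨t, ht, ⟨w - t, by omega⟩, ⟨w + 1 - t, by omega⟩, by simpa only [e1], by simpa only [e2]⟩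

/-- Downward induction from `d_k = 0`: one entry of a nonempty block at level `m` is `d_{k-m}` times
a positive number plus terms in `d_{k-m+1}, …, d_k`, which are already bounded, and the entry itself
is at most `1` in absolute value. -/
lemma exists_bound_feasible (hk : IsSymmetric h) (hne : ∃ x y, h x ≠ h y) :
    ∃ C : ℝ, ∀ d, IsFeasible h d → ∀ i, |d i| ≤ C := by
  have key : ∀ m ≤ k, ∃ C : ℝ, ∀ d, IsFeasible h d → |extendList d (k - m)| ≤ C := by
    intro m
    induction m using Nat.strong_induction_on with
    | _ m ih =>
      intro hmk
      rcases Nat.eq_zero_or_pos m with rfl | hm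
      · refine ⟨0, fun d hd => ?_⟩
        have h1 : extendList d (k - 0) = d (Fin.last k) := by
          rw [Nat.sub_zero, extendList, dif_pos (Nat.lt_succ_self k)]
          rfl
        rw [h1, hd.last, abs_zero]
      · have ih' : ∀ j, ∃ C : ℝ, j < m → ∀ d, IsFeasible h d →
            |extendList d (j + 1 + (k - m))| ≤ C := by
          intro j
          by_cases hj : j < m
          · obtain ⟨C, hC⟩ := ih (m - (j + 1)) (by omega) (by omega)
            refine ⟨C, fun _ d hd => ?_⟩
            have := hC d hd
            rwa [show k - (m - (j + 1)) = j + 1 + (k - m) by omega] at this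
          · exact ⟨0, fun h => absurd h hj⟩
        choose C hC using ih'
        obtain ⟨t, ht, x, y, hx, hy⟩ := exists_mem_blocks hk hne hm hmk
        have h0 : (0 : ℝ) < 1 / 2 := by norm_num
        have h1 : (1 / 2 : ℝ) < 1 := by norm_num
        have hpx := kappa_zero_pos h0 h1 x
        have hpy := kappa_zero_pos h0 h1 y
        refine ⟨(1 + ∑ j ∈ range m, C j) / (kappa m (1 / 2) 0 x * kappa m (1 / 2) 0 y),
          fun d hd => ?_⟩
        rw [le_div_iff₀ (mul_pos hpx hpy)]
        have hb := (norm_krawtchoukBlock_le_iff d m t (1 / 2) zero_le_one).1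
          (hd.block m t hm hmk ht _ h0 h1) (Pi.single x 1) (Pi.single y 1)
          (fun l hl => by
            rw [Pi.single_apply, if_neg]
            rintro rfl; exact hx hl)
          (fun l hl => by
            rw [Pi.single_apply, if_neg]
            rintro rfl; exact hl hy)
        rw [l2_single, l2_single, krawtchoukMatrix_bilin d hmk] at hb
        simp only [single_dotProduct, dotProduct_single, one_mul, mul_one, abs_one] at hb
        rw [Finset.sum_range_succ', Nat.zero_add] at hb
        have hrest : |∑ j ∈ range m, extendList d (j + 1 + (k - m)) *
            ((kappa m (1 / 2) (j + 1)).ofLp x * (kappa m (1 / 2) (j + 1)).ofLp y)| ≤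
              ∑ j ∈ range m, C j := by
          refine (Finset.abs_sum_le_sum_abs _ _).trans (Finset.sum_le_sum fun j hj => ?_)
          have hjm := Finset.mem_range.1 hj
          have hk1 : ∀ z, |(kappa m (1 / 2) (j + 1)).ofLp z| ≤ 1 := fun z =>
            (abs_apply_le_l2 _ z).trans (l2_kappa h0 h1 (by omega)).le
          rw [abs_mul, abs_mul]
          refine (mul_le_of_le_one_right (abs_nonneg _) ?_).trans (hC j hjm d hd)
          exact mul_le_one₀ (hk1 x) (abs_nonneg _) (hk1 y)
        rw [← abs_of_pos (mul_pos hpx hpy), ← abs_mul]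
        rw [abs_le] at hb hrest ⊢
        constructor <;> linarith [hb.1, hb.2, hrest.1, hrest.2]
  choose! C hC using key
  refine ⟨∑ m ∈ range (k + 1), |C m|, fun d hd i => ?_⟩
  have hi : (i : ℕ) ≤ k := Nat.lt_succ_iff.1 i.2
  have h1 := hC (k - i) (Nat.sub_le _ _) d hd
  rw [show k - (k - (i : ℕ)) = i by omega, extendList, dif_pos i.2] at h1
  refine (h1.trans (le_abs_self _)).trans
    (Finset.single_le_sum (f := fun m => |C m|) (fun m _ => abs_nonneg _) ?_)
  exact Finset.mem_range.2 (by omega)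

lemma krawtchoukValue_lt_top (hk : IsSymmetric h) (hne : ∃ x y, h x ≠ h y) :
    krawtchoukValue h < ⊤ := by
  obtain ⟨C, hC⟩ := exists_bound_feasible hk hne
  refine lt_of_le_of_lt (iSup₂_le fun d hd => ?_) (EReal.coe_lt_top C)
  exact EReal.coe_le_coe_iff.2 (Finset.sup'_le _ _ fun i _ => (le_abs_self _).trans (hC d hd i))

end Bounded

/-! ### The upper bound -/

section Upper

variable {k : ℕ} {h : (Fin k → Bool) → Bool}

/-- All blocks are empty, so only `d_k = 0` remains; as `k > 0`, the number `d_0` is unrestricted.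
-/
lemma krawtchoukValue_eq_top (hk0 : 0 < k) (hk : IsSymmetric h) (hconst : ∀ x y, h x = h y) :
    krawtchoukValue h = ⊤ := by
  rw [EReal.eq_top_iff_forall_lt]
  intro c
  have hfeas : IsFeasible h (Pi.single 0 (c + 1)) := by
    refine ⟨?_, fun m t _ hm ht p _ _ => ?_⟩
    · rw [Pi.single_apply, if_neg]
      intro hcon
      have := congrArg Fin.val hcon
      simp only [Fin.val_last, Fin.val_zero] at this
      omega
    · rw [norm_krawtchoukBlock_le_iff _ m t p zero_le_one]
      intro f g hf hg
      have hW : ∀ x y : Fin (m + 1), ((x : ℕ) + t ∈ weights h ↔ (y : ℕ) + t ∈ weights h) := by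
        intro x y
        have hz : ∀ x : Fin (m + 1), ∃ z : Fin k → Bool, weight z = x + t := fun x =>
          exists_hammingWeight_eq (κ := Fin k) (by rw [Fintype.card_fin]; omega)
        obtain ⟨z, hz1⟩ := hz x
        obtain ⟨z', hz2⟩ := hz y
        rw [← hz1, ← hz2, mem_weights_iff hk, mem_weights_iff hk, hconst z z']
      have h0 : f = 0 ∨ g = 0 := by
        by_cases h1 : ((0 : Fin (m + 1)) : ℕ) + t ∈ weights h
        · exact Or.inl (funext fun x => hf x ((hW x 0).2 h1))
        · exact Or.inr (funext fun x => hg x fun h2 => h1 ((hW 0 x).2 h2))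
      have h2 : 0 ≤ l2 f * l2 g := mul_nonneg (l2_nonneg _) (l2_nonneg _)
      rcases h0 with rfl | rfl <;> simpa using h2
  refine lt_of_lt_of_le ?_ (le_krawtchoukValue hfeas 0)
  rw [Pi.single_eq_same, EReal.coe_lt_coe_iff]
  linarith

lemma adv_eq_zero_of_eq_zero (h : (Fin 0 → Bool) → Bool) (n : ℕ) : adv h n ≤ 0 := by
  refine iSup₂_le fun Γ hΓ => ?_
  have h1 : Γ = 0 := by
    ext A B
    have : A = B := by
      ext1
      rw [Finset.card_eq_zero.1 A.2, Finset.card_eq_zero.1 B.2]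
    rw [this, hΓ.diag, Matrix.zero_apply]
  rw [h1, norm_zero]
  exact le_rfl

lemma learnMatrix_smul {n : ℕ} (c : ℝ) (d : Fin (k + 1) → ℝ) :
    learnMatrix n k (extendList (c • d)) = c • learnMatrix n k (extendList d) := by
  have h1 : extendList (c • d) = 0 + c • extendList d := by
    ext i; simp [extendList_smul]
  have h2 : learnMatrix n k (0 : ℕ → ℝ) = 0 := by
    have := learnMatrix_add_smul (n := n) (k := k) 0 0 (-1 : ℝ)
    simpa using this
  rw [h1, learnMatrix_add_smul, h2, zero_add]

lemma diagEntry_smul (c : ℝ) (d : Fin (k + 1) → ℝ) (ε : ℝ) :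
    diagEntry k (extendList (c • d)) ε = c * diagEntry k (extendList d) ε := by
  simp only [diagEntry, extendList_smul, Finset.mul_sum, mul_assoc, mul_left_comm c]

/-- Otherwise some real `c` above the Krawtchouk value is exceeded by adversary matrices for
infinitely many `n`; a limit of their rescaled lists would be a feasible list with `d_0 ≥ c`. -/
lemma eventually_adv_lt_of_ne (hk : IsSymmetric h) (hne : ∃ x y, h x ≠ h y) {a : EReal}
    (ha : krawtchoukValue h < a) : ∀ᶠ n in atTop, adv h n < a := by
  by_contra hcon
  rw [Filter.not_eventually] at hcon
  obtain ⟨c, hc1, hc2⟩ := EReal.lt_iff_exists_real_btwn.1 ha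
  have hc0 : 0 ≤ c := by
    have := krawtchoukValue_nonneg.trans hc1.le
    exact_mod_cast this
  obtain ⟨φ, hφ, hφ'⟩ := extraction_of_frequently_atTop
    (hcon.and_eventually (eventually_gt_atTop 0))
  have hex : ∀ j, ∃ (d : Fin (k + 1) → ℝ) (l : ℝ), c < l ∧
      diagEntry k (extendList d) (φ j : ℝ)⁻¹ = 0 ∧
      (fun _ => 1) ⬝ᵥ learnMatrix (φ j) k (extendList d) *ᵥ (fun _ => 1) =
        l * Fintype.card (KSubset (φ j) k) ∧
      ∀ (S : Finset (Fin (φ j))) (f g : KSubset (φ j) k → ℝ),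
        (∀ A : KSubset (φ j) k, #(A.1 ∩ S) ∈ weights h → f A = 0) →
        (∀ A : KSubset (φ j) k, #(A.1 ∩ S) ∉ weights h → g A = 0) →
        |f ⬝ᵥ learnMatrix (φ j) k (extendList d) *ᵥ g| ≤ l2 f * l2 g := by
    intro j
    have h1 : (c : EReal) < adv h (φ j) := hc2.trans_le (not_lt.1 (hφ' j).1)
    rw [adv, lt_iSup_iff] at h1
    obtain ⟨Γ, h1⟩ := h1
    rw [lt_iSup_iff] at h1
    obtain ⟨hΓ, h1⟩ := h1
    exact hΓ.exists_list hk (hφ' j).2 hc0 (EReal.coe_lt_coe_iff.1 h1)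
  choose d l hcl hdiag hsum hquery using hex
  -- The pairs `(r d, r)` stay in a compact ball, and the constraints for `r d` hold with bound `r`,
  -- so they survive in a limit `(e', r')`.
  set r : ℕ → ℝ := fun j => (max 1 ‖d j‖)⁻¹ with hr
  have hmax : ∀ j, 0 < max 1 ‖d j‖ := fun j => lt_max_of_lt_left one_pos
  have hr0 : ∀ j, 0 ≤ r j := fun j => (inv_pos.2 (hmax j)).le
  have hr1 : ∀ j, r j ≤ 1 := fun j => inv_le_one_of_one_le₀ (le_max_left _ _)
  have hnorm : ∀ j, ‖r j • d j‖ = r j * ‖d j‖ := fun j => by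
    rw [norm_smul, Real.norm_of_nonneg (hr0 j)]
  have he1 : ∀ j, ‖r j • d j‖ ≤ 1 := fun j => by
    rw [hnorm, hr]
    exact (inv_mul_le_one₀ (hmax j)).2 (le_max_right _ _)
  obtain ⟨⟨e', r'⟩, -, ψ, hψ, hlim⟩ := tendsto_subseq_of_bounded
    (x := fun j => ((r j • d j, r j) : (Fin (k + 1) → ℝ) × ℝ))
    (Metric.isBounded_closedBall (x := 0) (r := 1)) (fun j => by
      rw [mem_closedBall_zero_iff, Prod.norm_mk]
      exact max_le (he1 j) (by rw [Real.norm_of_nonneg (hr0 j)]; exact hr1 j))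
  have hlim1 : Tendsto (fun j => r (ψ j) • d (ψ j)) atTop (𝓝 e') :=
    (continuous_fst.tendsto _).comp hlim
  have hlim2 : Tendsto (fun j => r (ψ j)) atTop (𝓝 r') := (continuous_snd.tendsto _).comp hlim
  have hN : Tendsto (fun j => φ (ψ j)) atTop atTop := (hφ.comp hψ).tendsto_atTop
  have hr'0 : 0 ≤ r' := ge_of_tendsto' hlim2 fun j => hr0 _
  -- The diagonals vanish exactly for each `n`, while they converge to the last entry of the limit.
  have hlast : e' (Fin.last k) = 0 := by
    refine tendsto_nhds_unique (tendsto_diagEntry hN hlim1) ?_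
    simp only [diagEntry_smul, hdiag, mul_zero]
    exact tendsto_const_nhds
  have hblock : ∀ m t : ℕ, m ≤ k → t ≤ k - m → ∀ p : ℝ, 0 < p → p < 1 →
      ‖krawtchoukBlock h e' m p t‖ ≤ r' := by
    intro m t hm ht p h0 h1
    refine norm_krawtchoukBlock_le_of_tendsto hN hlim1 hlim2 (fun j => hr0 _) ?_ hm ht h0 h1
    intro j S f g hf hg
    rw [learnMatrix_smul, smul_mulVec, dotProduct_smul, smul_eq_mul, abs_mul,
      abs_of_nonneg (hr0 _)]
    exact mul_le_mul_of_nonneg_left (hquery _ S f g hf hg) (hr0 _)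
  have hmean : c * r' ≤ e' 0 := by
    have hcol := (tendsto_collision k).comp hN
    have hcol2 : Tendsto (fun j => √(collision (φ (ψ j)) k)) atTop (𝓝 0) := by
      have := hcol.sqrt
      rwa [Real.sqrt_zero] at this
    have hL : Tendsto (fun j => c * r (ψ j) * (1 - collision (φ (ψ j)) k)) atTop
        (𝓝 (c * r' * (1 - 0))) := (hlim2.const_mul c).mul (hcol.const_sub 1)
    have hR : Tendsto (fun j => (r (ψ j) • d (ψ j)) 0 +
        2 ^ k * 1 * (√(collision (φ (ψ j)) k) * 2)) atTop
        (𝓝 (e' 0 + 2 ^ k * 1 * (0 * 2))) :=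
      ((tendsto_pi_nhds.1 hlim1) 0).add ((hcol2.mul_const 2).const_mul _)
    rw [sub_zero, mul_one] at hL
    rw [zero_mul, mul_zero, add_zero] at hR
    refine le_of_tendsto_of_tendsto' hL hR fun j => ?_
    have h1 : (fun _ => 1) ⬝ᵥ learnMatrix (φ (ψ j)) k (extendList (r (ψ j) • d (ψ j))) *ᵥ
        (fun _ => 1) = r (ψ j) * l (ψ j) * Fintype.card (KSubset (φ (ψ j)) k) := by
      rw [learnMatrix_smul, smul_mulVec, dotProduct_smul, hsum, smul_eq_mul, mul_assoc]
    have h2 := abs_sum_learnMatrix_sub_le (hφ' (ψ j)).2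
      (fun i _ => (abs_extendList_le (r (ψ j) • d (ψ j)) i).trans (he1 _)) h1
    have h3 : extendList (r (ψ j) • d (ψ j)) 0 = (r (ψ j) • d (ψ j)) 0 := by
      rw [extendList, dif_pos (Nat.succ_pos k)]
      rfl
    rw [h3] at h2
    have h4 : 0 ≤ 1 - collision (φ (ψ j)) k := by
      rw [collision, sub_sub_cancel]
      positivity
    have h5 : c * r (ψ j) * (1 - collision (φ (ψ j)) k) ≤
        r (ψ j) * l (ψ j) * (1 - collision (φ (ψ j)) k) := by
      refine mul_le_mul_of_nonneg_right ?_ h4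
      rw [mul_comm]
      exact mul_le_mul_of_nonneg_left (hcl _).le (hr0 _)
    have h6 := (abs_le.1 h2).2
    linarith
  -- If `r' = 0`, all multiples of `e'` are feasible, so boundedness forces `e' = 0`; but `‖r d‖ =
  -- 1` as soon as `r < 1`, so `‖e'‖ = 1`. If `r' > 0`, then `e' / r'` is feasible with zeroth entry
  -- at least `c`.
  rcases hr'0.eq_or_lt with hr'z | hr'pos
  · obtain ⟨C, hC⟩ := exists_bound_feasible hk hne
    have hez : e' = 0 := by
      ext i
      by_contra hei
      have hei' : 0 < |e' i| := abs_pos.2 hei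
      have h1 := hC _ (isFeasible_smul (c := (|C| + 1) / |e' i|) hlast hblock hr'0
        (by rw [← hr'z]; simp)) i
      rw [Pi.smul_apply, smul_eq_mul, abs_mul, abs_div, abs_abs,
        div_mul_cancel₀ _ hei'.ne', abs_of_nonneg (by positivity)] at h1
      linarith [le_abs_self C]
    have h1 : Tendsto (fun j => ‖r (ψ j) • d (ψ j)‖) atTop (𝓝 1) := by
      refine tendsto_const_nhds.congr' ?_
      rw [← hr'z] at hlim2
      filter_upwards [hlim2.eventually (gt_mem_nhds one_pos)] with j hj
      have h2 : max 1 ‖d (ψ j)‖ = ‖d (ψ j)‖ := by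
        rcases max_choice 1 ‖d (ψ j)‖ with h3 | h3
        · simp [hr, h3] at hj
        · exact h3
      have h3 := hmax (ψ j)
      rw [hnorm, hr]
      simp only
      rw [h2] at h3 ⊢
      rw [inv_mul_cancel₀ h3.ne']
    have h2 := tendsto_nhds_unique h1 hlim1.norm
    rw [hez, norm_zero] at h2
    exact one_ne_zero h2
  · have hfeas := isFeasible_smul (c := r'⁻¹) hlast hblock hr'0
      (by rw [abs_of_pos (inv_pos.2 hr'pos), inv_mul_cancel₀ hr'pos.ne'])
    have h1 := le_krawtchoukValue hfeas 0
    have h2 : c ≤ (r'⁻¹ • e') 0 := by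
      rw [Pi.smul_apply, smul_eq_mul, inv_mul_eq_div, le_div_iff₀ hr'pos]
      exact hmean
    exact absurd ((EReal.coe_le_coe_iff.2 h2).trans h1) (not_le.2 hc1)

lemma eventually_adv_lt (hk : IsSymmetric h) {a : EReal} (ha : krawtchoukValue h < a) :
    ∀ᶠ n in atTop, adv h n < a := by
  by_cases hne : ∃ x y, h x ≠ h y
  · exact eventually_adv_lt_of_ne hk hne ha
  · push Not at hne
    rcases Nat.eq_zero_or_pos k with rfl | hk0
    · exact Filter.Eventually.of_forall fun n =>
        (adv_eq_zero_of_eq_zero h n).trans_lt (krawtchoukValue_nonneg.trans_lt ha)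
    · rw [krawtchoukValue_eq_top hk0 hk hne] at ha
      exact absurd ha not_top_lt

end Upper

end HiddenSubset

theorem mainTheorem3 (k : ℕ) (h : (Fin k → Bool) → Bool) (hsymm : HiddenSubset.IsSymmetric h) :
    Tendsto (fun n : ℕ => HiddenSubset.adv h n) atTop (𝓝 (HiddenSubset.krawtchoukValue h)) ∧
      ((∃ x y, h x ≠ h y) → HiddenSubset.krawtchoukValue h < ⊤) :=
  ⟨tendsto_order.2 ⟨fun _ ha => HiddenSubset.eventually_lt_adv hsymm ha,
    fun _ ha => HiddenSubset.eventually_adv_lt hsymm ha⟩,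
    HiddenSubset.krawtchoukValue_lt_top hsymm⟩
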